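/- Let $a<b$, $T>0$, $\alpha,\beta\in\mathbb R$, and let $u$ solve the telegraph equation $u_{tt}+2\alpha u_t+\beta^2u=u_{xx}+f$ on $[a,b]\times[0,T]$ with $u(x,0)=f_0(x)$, $u_t(x,0)=f_1(x)$, $u(a,t)=g_0(t)$, $u(b,t)=g_1(t)$, $u_x(a,t)=g_2(t)$, $u_x(b,t)=g_3(t)$. Assume that $u\in C^3([a,b]\times[0,T])$, that $u(\cdot,t)\in C^5[a,b]$ for every $t\in[0,T]$, and that $|\partial^5u/\partial x^5|\le L$ on $[a,b]\times[0,T]$. Let $\Gamma$ be a function with $\Gamma(k)>0$ for small $k>0$ and $\Gamma(k)^2=k^2(1+O(k^j))$ as $k\to0^+$, for some integer $j\ge1$ (for instance $\Gamma(k)=k$ or $\Gamma(k)=2\sin(k/2)$). For $N\ge1$ and $k>0$ put $h=(b-a)/N$, $x_i=a+ih$, $t_n=nk$. Let $B_i$ be the $C^4$ piecewise quintic B-spline supported on $[x_{i-3},x_{i+3}]$, with values $1,26,66,26,1$ at $x_{i-2},\dots,x_{i+2}$. A numerical solution is a family $U^n=\sum_{i=-2}^{N+2}c^n_iB_i$ ($0\le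 t_n\le T$) such that: (i) $U^n(a)=g_0(t_n)$, $U^n(b)=g_1(t_n)$, $(U^n)'(a)=g_2(t_n)$, $(U^n)'(b)=g_3(t_n)$ for all $n$ with $t_n\le T$; (ii) $U^0(x_i)=f_0(x_i)$ for $0\le i\le N$ and, if $k\le T$, $U^1(x_i)=\big[f_0+kf_1+\tfrac{k^2}{2}\big(f(\cdot,0)-\beta^2f_0-2\alpha f_1+f_0''\big)\big](x_i)$ for $0<i<N$; (iii) for all $n\ge1$ with $t_{n+1}\le T$, and all $0\le i\le N$, with $\Gamma=\Gamma(k)$, at the point $x_i$: $$(1+\alpha\Gamma)\,U^{n+1}-\tfrac{\Gamma^2}{2}(U^{n+1})''=(2-\beta^2\Gamma^2)\,U^n+(\alpha\Gamma-1)\,U^{n-1}+\tfrac{\Gamma^2}{2}(U^{n-1})''+\Gamma^2f(x_i,t_n).$$ These conditions leave the second derivatives of $U^0$ and $U^1$ at $a$ and $b$ free; fix $M\ge0$ and require that they be at most $M$ in absolute value. Then $\|u-U\|_\infty=O(h^2+k)$: there are constants $C,\delta>0$, independent of $N$ and $k$, such that whenever $h<\delta$ and $0<k<\delta$ a numerical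 solution exists, and every numerical solution satisfies $$\max_{x\in[a,b]}|u(x,t_n)-U^n(x)|\le C\,(h^2+k)\qquad\text{for all } n\ge0 \text{ with } t_n\le T.$$ -/

import Mathlib

open Set Filter Topology Asymptotics

noncomputable section

/-- The knots `x_i = a + i h`, `h = (b - a) / N`, for every integer `i` (those with
`0 ≤ i ≤ N` are the mesh points of `[a, b]`, the others extend the mesh uniformly). -/
def knot (a b : ℝ) (N : ℕ) (i : ℤ) : ℝ := a + i * ((b - a) / N)

/-- The quintic B-spline `B_i` (unnormalised, with value `66` at its centre `x_i`), supported on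
`[x_{i-3}, x_{i+3}]`. -/
def quinticBSpline (a b : ℝ) (N : ℕ) (i : ℤ) (x : ℝ) : ℝ :=
  1 / ((b - a) / N) ^ 5 *
    (if x < knot a b N (i - 3) then 0
    else if x < knot a b N (i - 2) then
      (x - knot a b N (i - 3)) ^ 5
    else if x < knot a b N (i - 1) then
      (x - knot a b N (i - 3)) ^ 5 - 6 * (x - knot a b N (i - 2)) ^ 5
    else if x < knot a b N i then
      (x - knot a b N (i - 3)) ^ 5 - 6 * (x - knot a b N (i - 2)) ^ 5
        + 15 * (x - knot a b N (i - 1)) ^ 5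
    else if x < knot a b N (i + 1) then
      (knot a b N (i + 3) - x) ^ 5 - 6 * (knot a b N (i + 2) - x) ^ 5
        + 15 * (knot a b N (i + 1) - x) ^ 5
    else if x < knot a b N (i + 2) then
      (knot a b N (i + 3) - x) ^ 5 - 6 * (knot a b N (i + 2) - x) ^ 5
    else if x < knot a b N (i + 3) then
      (knot a b N (i + 3) - x) ^ 5
    else 0)

/-- The spline `∑_{i=-2}^{N+2} c_i B_i` as a function on the real line (it is of class `C^4`
there, so that its first two derivatives below are genuine derivatives). -/
def quinticSpline (a b : ℝ) (N : ℕ) (c : ℤ → ℝ) (x : ℝ) : ℝ :=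
  ∑ i ∈ Finset.Icc (-2 : ℤ) (N + 2), c i * quinticBSpline a b N i x

/-- `u` solves `u_tt + 2 α u_t + β² u = u_xx + f` on `[a, b] × [0, T]`, with the initial conditions
`u(x, 0) = f₀(x)`, `u_t(x, 0) = f₁(x)` and the boundary conditions `u(a, t) = g₀(t)`,
`u(b, t) = g₁(t)`, `u_x(a, t) = g₂(t)`, `u_x(b, t) = g₃(t)`. -/
structure IsTelegraphSolution (a b T α β : ℝ) (f : ℝ → ℝ → ℝ) (f₀ f₁ g₀ g₁ g₂ g₃ : ℝ → ℝ)
    (u : ℝ → ℝ → ℝ) : Prop where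
  pde : ∀ x ∈ Icc a b, ∀ t ∈ Icc 0 T,
    iteratedDerivWithin 2 (fun s => u x s) (Icc 0 T) t
        + 2 * α * derivWithin (fun s => u x s) (Icc 0 T) t + β ^ 2 * u x t
      = iteratedDerivWithin 2 (fun y => u y t) (Icc a b) x + f x t
  initial_value : ∀ x ∈ Icc a b, u x 0 = f₀ x
  initial_velocity : ∀ x ∈ Icc a b, derivWithin (fun s => u x s) (Icc 0 T) 0 = f₁ x
  left_value : ∀ t ∈ Icc 0 T, u a t = g₀ t
  right_value : ∀ t ∈ Icc 0 T, u b t = g₁ t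
  left_slope : ∀ t ∈ Icc 0 T, derivWithin (fun y => u y t) (Icc a b) a = g₂ t
  right_slope : ∀ t ∈ Icc 0 T, derivWithin (fun y => u y t) (Icc a b) b = g₃ t

/-- The second order Taylor polynomial in time at `t = 0`, with `u_tt(x, 0)` expressed by means of
the differential equation:
`f₀ + k f₁ + (k² / 2) (f(·, 0) - β² f₀ - 2 α f₁ + f₀'')`. -/
def taylorStart (a b α β : ℝ) (f : ℝ → ℝ → ℝ) (f₀ f₁ : ℝ → ℝ) (k x : ℝ) : ℝ :=
  f₀ x + k * f₁ x
    + k ^ 2 / 2 * (f x 0 - β ^ 2 * f₀ x - 2 * α * f₁ x + iteratedDerivWithin 2 f₀ (Icc a b) x)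

/-- `c n i` (`n k ≤ T`, `-2 ≤ i ≤ N + 2`) are the coefficients of a numerical solution
`Uⁿ = ∑ c n i B_i` produced by the quintic B-spline collocation method with `N` subintervals, time
step `k` and denominator `γ = Γ(k)`: each `Uⁿ` satisfies the four boundary conditions at
`t_n = n k`; `U⁰` interpolates the initial values and `U¹` the Taylor values at the nodes (at the
two end nodes the value is that of the boundary condition); and, for `n ≥ 1`, `Uⁿ⁺¹` satisfies
`v Uⁿ⁺¹ + w (Uⁿ⁺¹)'' = (2 - β² γ²) Uⁿ + (α γ - 1) Uⁿ⁻¹ + (γ² / 2) (Uⁿ⁻¹)'' + γ² f(·, t_n)`,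
`v = 1 + α γ`, `w = - γ² / 2`, at all nodes `x_0, …, x_N`. -/
structure IsCollocationSolution (a b T α β : ℝ) (f : ℝ → ℝ → ℝ)
    (f₀ f₁ g₀ g₁ g₂ g₃ : ℝ → ℝ) (N : ℕ) (k γ : ℝ) (c : ℕ → ℤ → ℝ) : Prop where
  left_value : ∀ n : ℕ, n * k ≤ T → quinticSpline a b N (c n) a = g₀ (n * k)
  right_value : ∀ n : ℕ, n * k ≤ T → quinticSpline a b N (c n) b = g₁ (n * k)
  left_slope : ∀ n : ℕ, n * k ≤ T → deriv (quinticSpline a b N (c n)) a = g₂ (n * k)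
  right_slope : ∀ n : ℕ, n * k ≤ T → deriv (quinticSpline a b N (c n)) b = g₃ (n * k)
  start_zero : ∀ i : ℕ, i ≤ N →
    quinticSpline a b N (c 0) (knot a b N i) = f₀ (knot a b N i)
  start_one : k ≤ T → ∀ i : ℕ, 0 < i → i < N →
    quinticSpline a b N (c 1) (knot a b N i) = taylorStart a b α β f f₀ f₁ k (knot a b N i)
  step : ∀ n : ℕ, 1 ≤ n → (n + 1) * k ≤ T → ∀ i : ℕ, i ≤ N →
    (1 + α * γ) * quinticSpline a b N (c (n + 1)) (knot a b N i)
        + (-(γ ^ 2 / 2)) * iteratedDeriv 2 (quinticSpline a b N (c (n + 1))) (knot a b N i)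
      = (2 - (β * γ) ^ 2) * quinticSpline a b N (c n) (knot a b N i)
        + (α * γ - 1) * quinticSpline a b N (c (n - 1)) (knot a b N i)
        + γ ^ 2 / 2 * iteratedDeriv 2 (quinticSpline a b N (c (n - 1))) (knot a b N i)
        + γ ^ 2 * f (knot a b N i) (n * k)

/-- Interpolation at the nodes and the boundary conditions leave two coefficients of each of the
two starting splines free; they are fixed by the second derivatives at the end points. This
says that these four numbers have absolute value at most `M`. -/
def StartBoundedBy (a b : ℝ) (N : ℕ) (c : ℕ → ℤ → ℝ) (M : ℝ) : Prop :=
  ∀ n : ℕ, n ≤ 1 →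
    |iteratedDeriv 2 (quinticSpline a b N (c n)) a| ≤ M ∧
    |iteratedDeriv 2 (quinticSpline a b N (c n)) b| ≤ M

end

/-! The proof is stability plus consistency, and each half has one difficulty, located at the ends
of the interval.

Stability. In terms of the coefficients, node values and scaled second derivatives at the nodes are
the stencils 120 + 30δ² + δ⁴ and 6δ² + δ⁴. For a spline whose value, slope and second derivative
vanish at both ends, these become polynomials in the Dirichlet second difference `T`, plus
corrections supported on the first and last interior nodes. In the form weighted with 12 + `T` the
corrections cancel: the pairing of second derivatives with node values is symmetric and dominates
the discrete Dirichlet form (`IsHomogeneous.stiffness_symm`, `IsHomogeneous.stiffness_coercive`).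
Testing the scheme with Uⁿ⁺¹ − Uⁿ⁻¹ then telescopes an energy without any relation between h and k
(`energy_step`, `energy_gronwall`), and the discrete Sobolev inequality `sq_le_neg_laplacian` turns
the energy bound into a pointwise one (`collocation_stability`). The same coercivity makes every
time step solvable (`exists_collocation`).

Consistency. At an end node the value is exact, so the collocation equation there is a two-step
recursion for the second derivative. Its error is only O(1), but it nearly changes sign from n − 1
to n + 1, so its sum over these two levels is O(k) (`boundary_curvature`). The scheme uses second
derivatives only through that sum. Hence Uⁿ is compared with splines gⁿ which share all its end
data, including the second derivative, and have nearly the node values of u (`exists_comparison`).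
An O(1) error in an end second derivative moves the coefficients by O(h²) only, by the diagonal
dominance in `abs_coeff_le`, while the two-level sums of the second derivatives of g are accurate to
O(h² + k); both are measured against a quasi-interpolant which is exact on cubics
(`exists_quasiInterpolant`). The difference Uⁿ − gⁿ satisfies the homogeneous end conditions,
vanishes at the nodes for n = 0, 1, and solves the scheme with source O(h² + k), so stability
applies (`exists_error_bound`). -/

/-! ### Cardinal splines as differences of truncated powers. -/

/-- The sixth central difference of the truncated power `s ↦ max s 0 ^ d`; for `d = 5` this is the
cardinal quintic B-spline with value `66` at `0`. -/
noncomputable def cardinalSpline (d : ℕ) (s : ℝ) : ℝ :=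
  max (s + 3) 0 ^ d - 6 * max (s + 2) 0 ^ d + 15 * max (s + 1) 0 ^ d - 20 * max s 0 ^ d
    + 15 * max (s - 1) 0 ^ d - 6 * max (s - 2) 0 ^ d + max (s - 3) 0 ^ d

/-- With exponent at least 2 both one-sided derivatives at 0 vanish, so the two halves glue. -/
theorem hasDerivAt_truncatedPower (n : ℕ) (s : ℝ) :
    HasDerivAt (fun x : ℝ => max x 0 ^ (n + 2)) ((n + 2 : ℕ) * max s 0 ^ (n + 1)) s := by
  have hl : ∀ x ≤ (0 : ℝ), HasDerivWithinAt (fun x : ℝ => max x 0 ^ (n + 2))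
      ((n + 2 : ℕ) * max x 0 ^ (n + 1)) (Iic 0) x := by
    intro x hx
    have h : HasDerivWithinAt (fun _ : ℝ => (0 : ℝ)) 0 (Iic 0) x := hasDerivWithinAt_const _ _ _
    have := h.congr (f₁ := fun x : ℝ => max x 0 ^ (n + 2))
      (fun y hy => by simp [max_eq_right (mem_Iic.1 hy)]) (by simp [max_eq_right hx])
    simpa [max_eq_right hx] using this
  have hr : ∀ x, 0 ≤ x → HasDerivWithinAt (fun x : ℝ => max x 0 ^ (n + 2))
      ((n + 2 : ℕ) * max x 0 ^ (n + 1)) (Ici 0) x := by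
    intro x hx
    have h : HasDerivWithinAt (fun x : ℝ => x ^ (n + 2)) ((n + 2 : ℕ) * x ^ (n + 1)) (Ici 0) x := by
      simpa using (hasDerivAt_pow (n + 2) x).hasDerivWithinAt
    have := h.congr (f₁ := fun x : ℝ => max x 0 ^ (n + 2))
      (fun y hy => by simp [max_eq_left (mem_Ici.1 hy)]) (by simp [max_eq_left hx])
    simpa [max_eq_left hx] using this
  rcases lt_trichotomy s 0 with h | h | h
  · exact (hl s h.le).hasDerivAt (Iic_mem_nhds h)
  · subst h
    have := (hl 0 le_rfl).union (hr 0 le_rfl)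
    rwa [Iic_union_Ici, hasDerivWithinAt_univ] at this
  · exact (hr s h.le).hasDerivAt (Ici_mem_nhds h)

theorem hasDerivAt_cardinalSpline (n : ℕ) (s : ℝ) :
    HasDerivAt (cardinalSpline (n + 2)) ((n + 2 : ℕ) * cardinalSpline (n + 1) s) s := by
  have hc : ∀ c : ℝ, HasDerivAt (fun x : ℝ => max (x + c) 0 ^ (n + 2))
      ((n + 2 : ℕ) * max (s + c) 0 ^ (n + 1)) s := fun c =>
    (hasDerivAt_truncatedPower n (s + c)).comp_add_const s c
  have hm : ∀ c : ℝ, HasDerivAt (fun x : ℝ => max (x - c) 0 ^ (n + 2))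
      ((n + 2 : ℕ) * max (s - c) 0 ^ (n + 1)) s := fun c =>
    (hasDerivAt_truncatedPower n (s - c)).comp_sub_const s c
  have := ((((((hc 3).sub ((hc 2).const_mul 6)).add ((hc 1).const_mul 15)).sub
    ((hasDerivAt_truncatedPower n s).const_mul 20)).add ((hm 1).const_mul 15)).sub
    ((hm 2).const_mul 6)).add (hm 3)
  refine HasDerivAt.congr_deriv this ?_
  simp only [cardinalSpline]
  ring

/-- A sixth difference annihilates polynomials of degree five, so on the right half the truncated
powers may be taken from the right instead of the left. -/
theorem cardinalSpline_five_eq (r : ℝ) : cardinalSpline 5 r =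
    if r < -3 then 0 else if r < -2 then (r + 3) ^ 5
    else if r < -1 then (r + 3) ^ 5 - 6 * (r + 2) ^ 5
    else if r < 0 then (r + 3) ^ 5 - 6 * (r + 2) ^ 5 + 15 * (r + 1) ^ 5
    else if r < 1 then (3 - r) ^ 5 - 6 * (2 - r) ^ 5 + 15 * (1 - r) ^ 5
    else if r < 2 then (3 - r) ^ 5 - 6 * (2 - r) ^ 5
    else if r < 3 then (3 - r) ^ 5 else 0 := by
  unfold cardinalSpline
  split_ifs <;>
  · first | rw [max_eq_left (show (0:ℝ) ≤ r + 3 by linarith)]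
          | rw [max_eq_right (show r + 3 ≤ 0 by linarith)]
    first | rw [max_eq_left (show (0:ℝ) ≤ r + 2 by linarith)]
          | rw [max_eq_right (show r + 2 ≤ 0 by linarith)]
    first | rw [max_eq_left (show (0:ℝ) ≤ r + 1 by linarith)]
          | rw [max_eq_right (show r + 1 ≤ 0 by linarith)]
    first | rw [max_eq_left (show (0:ℝ) ≤ r by linarith)]
          | rw [max_eq_right (show r ≤ 0 by linarith)]
    first | rw [max_eq_left (show (0:ℝ) ≤ r - 1 by linarith)]
          | rw [max_eq_right (show r - 1 ≤ 0 by linarith)]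
    first | rw [max_eq_left (show (0:ℝ) ≤ r - 2 by linarith)]
          | rw [max_eq_right (show r - 2 ≤ 0 by linarith)]
    first | rw [max_eq_left (show (0:ℝ) ≤ r - 3 by linarith)]
          | rw [max_eq_right (show r - 3 ≤ 0 by linarith)]
    ring

theorem cardinalSpline_eq_zero_of_le (d : ℕ) {r : ℝ} (h : r ≤ -3) :
    cardinalSpline d r = 0 := by
  unfold cardinalSpline
  rw [max_eq_right, max_eq_right, max_eq_right, max_eq_right, max_eq_right, max_eq_right,
    max_eq_right] <;> linarith

/-- No truncation is active here, and the sixth difference of a polynomial of degree at most five is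
zero. -/
theorem cardinalSpline_eq_zero_of_ge {d : ℕ} (hd : d = 3 ∨ d = 4 ∨ d = 5) {r : ℝ} (h : 3 ≤ r) :
    cardinalSpline d r = 0 := by
  unfold cardinalSpline
  rw [max_eq_left, max_eq_left, max_eq_left, max_eq_left, max_eq_left, max_eq_left,
    max_eq_left]
  any_goals linarith
  rcases hd with rfl | rfl | rfl <;> ring

theorem quinticBSpline_eq {a b : ℝ} {N : ℕ} (hab : a < b) (hN : 1 ≤ N) (i : ℤ) (x : ℝ) :
    quinticBSpline a b N i x = cardinalSpline 5 ((x - a) / ((b - a) / N) - i) := by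
  have hN0 : (0 : ℝ) < N := by exact_mod_cast hN
  have hh : 0 < (b - a) / N := div_pos (by linarith) hN0
  unfold quinticBSpline knot
  set h := (b - a) / N with hdef
  set r := (x - a) / h - i with hr
  have hx : x = a + (r + i) * h := by rw [hr]; field_simp; ring
  have hlt : ∀ (e : ℤ) , (x < a + (e : ℝ) * h) ↔ r < (e : ℝ) - i := by
    intro e
    rw [hx, add_lt_add_iff_left, mul_lt_mul_iff_of_pos_right hh]
    constructor <;> intro h <;> linarith
  simp only [hlt]
  push_cast
  rw [cardinalSpline_five_eq]
  have e1 : (i : ℝ) - 3 - i = -3 := by ring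
  have e2 : (i : ℝ) - 2 - i = -2 := by ring
  have e3 : (i : ℝ) - 1 - i = -1 := by ring
  have e4 : (i : ℝ) + 3 - i = 3 := by ring
  have e5 : (i : ℝ) + 2 - i = 2 := by ring
  have e6 : (i : ℝ) + 1 - i = 1 := by ring
  simp only [e1, e2, e3, e4, e5, e6, sub_self]
  have l3 : x - (a + (i - 3) * h) = (r + 3) * h := by rw [hx]; ring
  have l2 : x - (a + (i - 2) * h) = (r + 2) * h := by rw [hx]; ring
  have l1 : x - (a + (i - 1) * h) = (r + 1) * h := by rw [hx]; ring
  have r3 : a + (i + 3) * h - x = (3 - r) * h := by rw [hx]; ring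
  have r2 : a + (i + 2) * h - x = (2 - r) * h := by rw [hx]; ring
  have r1 : a + (i + 1) * h - x = (1 - r) * h := by rw [hx]; ring
  have hh5 : h ^ 5 ≠ 0 := by positivity
  rw [one_div, inv_mul_eq_iff_eq_mul₀ hh5]
  simp only [l3, l2, l1, r3, r2, r1, mul_pow, mul_ite, mul_zero]
  repeat refine if_congr Iff.rfl (by ring) ?_
  rfl

/-! ### Values, slopes and second derivatives of splines at the nodes. -/

/-- `U(x_i)` in terms of the B-spline coefficients. -/
def nodeValue (c : ℤ → ℝ) (i : ℤ) : ℝ :=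
  c (i - 2) + 26 * c (i - 1) + 66 * c i + 26 * c (i + 1) + c (i + 2)

/-- `h U'(x_i) / 5` in terms of the B-spline coefficients. -/
def nodeSlope (c : ℤ → ℝ) (i : ℤ) : ℝ :=
  c (i + 2) + 10 * c (i + 1) - 10 * c (i - 1) - c (i - 2)

/-- `h² U''(x_i) / 20` in terms of the B-spline coefficients. -/
def nodeCurv (c : ℤ → ℝ) (i : ℤ) : ℝ :=
  c (i - 2) + 2 * c (i - 1) - 6 * c i + 2 * c (i + 1) + c (i + 2)

/-- The sum `∑ c_i β_d(s - i)` of translated cardinal splines. -/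
noncomputable def cardinalSum (d N : ℕ) (c : ℤ → ℝ) (s : ℝ) : ℝ :=
  ∑ i ∈ Finset.Icc (-2 : ℤ) (N + 2), c i * cardinalSpline d (s - i)

theorem quinticSpline_eq {a b : ℝ} {N : ℕ} (hab : a < b) (hN : 1 ≤ N) (c : ℤ → ℝ) :
    quinticSpline a b N c = fun x => cardinalSum 5 N c ((x - a) / ((b - a) / N)) := by
  funext x
  simp only [quinticSpline, cardinalSum, quinticBSpline_eq hab hN]

theorem hasDerivAt_cardinalSum (n N : ℕ) (c : ℤ → ℝ) (s : ℝ) :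
    HasDerivAt (cardinalSum (n + 2) N c) ((n + 2 : ℕ) * cardinalSum (n + 1) N c s) s := by
  unfold cardinalSum
  rw [Finset.mul_sum]
  have : ∀ i ∈ Finset.Icc (-2 : ℤ) (N + 2),
      HasDerivAt (fun s : ℝ => c i * cardinalSpline (n + 2) (s - i))
        ((n + 2 : ℕ) * (c i * cardinalSpline (n + 1) (s - i))) s := fun i _ => by
    have := ((hasDerivAt_cardinalSpline n (s - i)).comp_sub_const s (i : ℝ)).const_mul (c i)
    exact this.congr_deriv (by ring)
  exact HasDerivAt.fun_sum this

theorem deriv_quinticSpline {a b : ℝ} {N : ℕ} (hab : a < b) (hN : 1 ≤ N) (c : ℤ → ℝ) :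
    deriv (quinticSpline a b N c) =
      fun x => 5 / ((b - a) / N) * cardinalSum 4 N c ((x - a) / ((b - a) / N)) := by
  funext x
  rw [quinticSpline_eq hab hN]
  have h1 : HasDerivAt (fun x : ℝ => (x - a) / ((b - a) / N)) (1 / ((b - a) / N)) x :=
    ((hasDerivAt_id x).sub_const a).div_const _
  have := (hasDerivAt_cardinalSum 3 N c ((x - a) / ((b - a) / N))).comp x h1
  refine HasDerivAt.deriv (this.congr_deriv ?_)
  push_cast
  ring

theorem iteratedDeriv_two_quinticSpline {a b : ℝ} {N : ℕ} (hab : a < b) (hN : 1 ≤ N)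
    (c : ℤ → ℝ) : iteratedDeriv 2 (quinticSpline a b N c) =
      fun x => 20 / ((b - a) / N) ^ 2 * cardinalSum 3 N c ((x - a) / ((b - a) / N)) := by
  funext x
  rw [iteratedDeriv_succ, iteratedDeriv_one, deriv_quinticSpline hab hN]
  have h1 : HasDerivAt (fun x : ℝ => (x - a) / ((b - a) / N)) (1 / ((b - a) / N)) x :=
    ((hasDerivAt_id x).sub_const a).div_const _
  have := ((hasDerivAt_cardinalSum 2 N c ((x - a) / ((b - a) / N))).comp x h1).const_mul
    (5 / ((b - a) / N))
  refine HasDerivAt.deriv (this.congr_deriv ?_)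
  generalize (b - a) / N = h
  push_cast
  ring

/-- Only the six splines around the mesh interval `[l, l + 1]` contribute there. -/
theorem cardinalSum_eq_six {d N : ℕ} (hd : d = 3 ∨ d = 4 ∨ d = 5) (c : ℤ → ℝ) {l : ℤ} (hl : 0 ≤ l)
    (hl' : l + 1 ≤ N) {θ : ℝ} (h0 : 0 ≤ θ) (h1 : θ ≤ 1) :
    cardinalSum d N c (l + θ) = c (l - 2) * cardinalSpline d (θ + 2)
      + c (l - 1) * cardinalSpline d (θ + 1) + c l * cardinalSpline d θ
      + c (l + 1) * cardinalSpline d (θ - 1) + c (l + 2) * cardinalSpline d (θ - 2)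
      + c (l + 3) * cardinalSpline d (θ - 3) := by
  unfold cardinalSum
  have hsub : ({l - 2, l - 1, l, l + 1, l + 2, l + 3} : Finset ℤ) ⊆ Finset.Icc (-2 : ℤ) (N + 2) := by
    intro i hi
    simp only [Finset.mem_insert, Finset.mem_singleton] at hi
    rw [Finset.mem_Icc]
    omega
  rw [← Finset.sum_subset hsub]
  · rw [Finset.sum_insert, Finset.sum_insert, Finset.sum_insert, Finset.sum_insert,
      Finset.sum_insert, Finset.sum_singleton]
    · push_cast
      rw [show (l : ℝ) + θ - (l - 2) = θ + 2 by ring, show (l : ℝ) + θ - (l - 1) = θ + 1 by ring,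
        show (l : ℝ) + θ - l = θ by ring, show (l : ℝ) + θ - (l + 1) = θ - 1 by ring,
        show (l : ℝ) + θ - (l + 2) = θ - 2 by ring, show (l : ℝ) + θ - (l + 3) = θ - 3 by ring]
      ring
    all_goals simp only [Finset.mem_insert, Finset.mem_singleton]; omega
  · intro i _ hi
    simp only [Finset.mem_insert, Finset.mem_singleton] at hi
    have : i ≤ l - 3 ∨ l + 4 ≤ i := by omega
    rcases this with h | h
    · have : (i : ℝ) ≤ l - 3 := by exact_mod_cast h
      rw [cardinalSpline_eq_zero_of_ge hd (by linarith), mul_zero]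
    · have : (l : ℝ) + 4 ≤ i := by exact_mod_cast h
      rw [cardinalSpline_eq_zero_of_le d (by linarith), mul_zero]

theorem cardinalSum_node {d N : ℕ} (hN : 1 ≤ N) (hd : d = 3 ∨ d = 4 ∨ d = 5) (c : ℤ → ℝ) {i : ℤ}
    (h0 : 0 ≤ i) (h1 : i ≤ N) : cardinalSum d N c i =
      c (i - 2) * cardinalSpline d 2 + c (i - 1) * cardinalSpline d 1 + c i * cardinalSpline d 0
      + c (i + 1) * cardinalSpline d (-1) + c (i + 2) * cardinalSpline d (-2) := by
  rcases lt_or_eq_of_le h1 with h | h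
  · have := cardinalSum_eq_six hd c h0 (by omega : i + 1 ≤ N) (le_refl (0 : ℝ)) zero_le_one
    rw [add_zero] at this
    rw [this, cardinalSpline_eq_zero_of_le d (r := 0 - 3) (by norm_num)]
    norm_num
  -- The last node has no mesh interval to its right; it is reached as the right end of the interval
  -- before it.
  · have := cardinalSum_eq_six hd c (by omega : 0 ≤ i - 1) (by omega : i - 1 + 1 ≤ N)
      zero_le_one (le_refl (1 : ℝ))
    have e : ((i - 1 : ℤ) : ℝ) + 1 = i := by push_cast; ring
    rw [e] at this
    rw [this, cardinalSpline_eq_zero_of_ge (r := 1 + 2) hd (by norm_num),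
      show i - 1 - 1 = i - 2 by ring, show i - 1 + 1 = i by ring, show i - 1 + 2 = i + 1 by ring,
      show i - 1 + 3 = i + 2 by ring]
    norm_num

theorem cardinalSum_five_node {N : ℕ} (hN : 1 ≤ N) (c : ℤ → ℝ) {i : ℤ} (h0 : 0 ≤ i) (h1 : i ≤ N) :
    cardinalSum 5 N c i = nodeValue c i := by
  rw [cardinalSum_node hN (by simp) c h0 h1]
  unfold nodeValue cardinalSpline
  norm_num
  ring

theorem cardinalSum_four_node {N : ℕ} (hN : 1 ≤ N) (c : ℤ → ℝ) {i : ℤ} (h0 : 0 ≤ i) (h1 : i ≤ N) :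
    cardinalSum 4 N c i = nodeSlope c i := by
  rw [cardinalSum_node hN (by simp) c h0 h1]
  unfold nodeSlope cardinalSpline
  norm_num
  ring

theorem cardinalSum_three_node {N : ℕ} (hN : 1 ≤ N) (c : ℤ → ℝ) {i : ℤ} (h0 : 0 ≤ i) (h1 : i ≤ N) :
    cardinalSum 3 N c i = nodeCurv c i := by
  rw [cardinalSum_node hN (by simp) c h0 h1]
  unfold nodeCurv cardinalSpline
  norm_num
  ring

section knots

variable {a b : ℝ} {N : ℕ}

theorem knot_scaled (hab : a < b) (hN : 1 ≤ N) (i : ℤ) :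
    (knot a b N i - a) / ((b - a) / N) = i := by
  have hN0 : (0 : ℝ) < N := by exact_mod_cast hN
  have hh : 0 < b - a := by linarith
  unfold knot
  field_simp
  ring

theorem knot_zero : knot a b N 0 = a := by simp [knot]

theorem knot_last (hN : 1 ≤ N) : knot a b N N = b := by
  have hN0 : (N : ℝ) ≠ 0 := by positivity
  unfold knot
  push_cast
  field_simp
  ring

theorem knot_mem_Icc (hab : a < b) (hN : 1 ≤ N) {i : ℤ} (h0 : 0 ≤ i) (h1 : i ≤ N) :
    knot a b N i ∈ Icc a b := by
  have hN0 : (0 : ℝ) < N := by exact_mod_cast hN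
  have hh : 0 < (b - a) / N := div_pos (by linarith) hN0
  have h0' : (0 : ℝ) ≤ i := by exact_mod_cast h0
  have h1' : (i : ℝ) ≤ N := by exact_mod_cast h1
  have hl := knot_last (a := a) (b := b) hN
  unfold knot at *
  push_cast at hl
  constructor
  · nlinarith
  · nlinarith

theorem quinticSpline_knot (hab : a < b) (hN : 1 ≤ N) (c : ℤ → ℝ) {i : ℤ} (h0 : 0 ≤ i)
    (h1 : i ≤ N) : quinticSpline a b N c (knot a b N i) = nodeValue c i := by
  rw [quinticSpline_eq hab hN]
  simp only [knot_scaled hab hN]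
  exact cardinalSum_five_node hN c h0 h1

theorem deriv_quinticSpline_knot (hab : a < b) (hN : 1 ≤ N) (c : ℤ → ℝ) {i : ℤ} (h0 : 0 ≤ i)
    (h1 : i ≤ N) :
    deriv (quinticSpline a b N c) (knot a b N i) = 5 / ((b - a) / N) * nodeSlope c i := by
  rw [deriv_quinticSpline hab hN]
  simp only [knot_scaled hab hN]
  rw [cardinalSum_four_node hN c h0 h1]

theorem iteratedDeriv_quinticSpline_knot (hab : a < b) (hN : 1 ≤ N) (c : ℤ → ℝ) {i : ℤ}
    (h0 : 0 ≤ i) (h1 : i ≤ N) :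
    iteratedDeriv 2 (quinticSpline a b N c) (knot a b N i)
      = 20 / ((b - a) / N) ^ 2 * nodeCurv c i := by
  rw [iteratedDeriv_two_quinticSpline hab hN]
  simp only [knot_scaled hab hN]
  rw [cardinalSum_three_node hN c h0 h1]

/-- The point of the mesh interval and the local coordinate of a point of `[a, b]`. -/
theorem exists_mesh_interval (hab : a < b) (hN : 1 ≤ N) {x : ℝ} (hx : x ∈ Icc a b) :
    ∃ l : ℤ, 0 ≤ l ∧ l + 1 ≤ N ∧ ∃ θ : ℝ, 0 ≤ θ ∧ θ ≤ 1 ∧ (x - a) / ((b - a) / N) = l + θ := by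
  have hN0 : (0 : ℝ) < N := by exact_mod_cast hN
  have hh : 0 < (b - a) / N := div_pos (by linarith) hN0
  set s := (x - a) / ((b - a) / N) with hs
  have hs0 : 0 ≤ s := div_nonneg (by linarith [hx.1]) hh.le
  have hsN : s ≤ N := by
    rw [hs, div_le_iff₀ hh, mul_div_cancel₀ _ hN0.ne']
    linarith [hx.2]
  rcases lt_or_eq_of_le hsN with h | h
  · refine ⟨⌊s⌋, Int.floor_nonneg.2 hs0, ?_, Int.fract s, Int.fract_nonneg s,
      (Int.fract_lt_one s).le, (Int.floor_add_fract s).symm⟩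
    have : ⌊s⌋ < (N : ℤ) := Int.floor_lt.2 (by exact_mod_cast h)
    omega
  -- At x = b the floor would be N, which is not the left end of a mesh interval.
  · refine ⟨N - 1, by omega, by omega, 1, zero_le_one, le_rfl, ?_⟩
    push_cast
    linarith

end knots

/-! ### From coefficients to function values. -/

theorem abs_cardinalSpline_le {s : ℝ} (h : |s| ≤ 3) : |cardinalSpline 5 s| ≤ 500000 := by
  obtain ⟨h1, h2⟩ := abs_le.1 h
  have key : ∀ x : ℝ, x ≤ 6 → 0 ≤ max x 0 ^ 5 ∧ max x 0 ^ 5 ≤ 7776 := fun x hx =>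
    ⟨by positivity, by
      calc max x 0 ^ 5 ≤ 6 ^ 5 := pow_le_pow_left₀ (le_max_right _ _) (max_le hx (by norm_num)) 5
        _ = 7776 := by norm_num⟩
  have a1 := key (s + 3) (by linarith)
  have a2 := key (s + 2) (by linarith)
  have a3 := key (s + 1) (by linarith)
  have a4 := key s (by linarith)
  have a5 := key (s - 1) (by linarith)
  have a6 := key (s - 2) (by linarith)
  have a7 := key (s - 3) (by linarith)
  unfold cardinalSpline
  rw [abs_le]
  constructor <;> linarith [a1.1, a1.2, a2.1, a2.2, a3.1, a3.2, a4.1, a4.2, a5.1, a5.2, a6.1, a6.2,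
    a7.1, a7.2]

/-- Translated splines reproduce linear functions. -/
theorem cardinalSpline_reproduces {θ : ℝ} (h0 : 0 ≤ θ) (h1 : θ ≤ 1) (A B : ℝ) :
    (A + B * (-2 - θ)) * cardinalSpline 5 (θ + 2) + (A + B * (-1 - θ)) * cardinalSpline 5 (θ + 1)
      + (A + B * (0 - θ)) * cardinalSpline 5 θ + (A + B * (1 - θ)) * cardinalSpline 5 (θ - 1)
      + (A + B * (2 - θ)) * cardinalSpline 5 (θ - 2) + (A + B * (3 - θ)) * cardinalSpline 5 (θ - 3)
      = 120 * A := by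
  have hp : ∀ n : ℝ, 0 ≤ n → max (θ + n) 0 = θ + n := fun n hn => max_eq_left (by linarith)
  have hm : ∀ n : ℝ, 1 ≤ n → max (θ - n) 0 = 0 := fun n hn => max_eq_right (by linarith)
  have hp0 : max θ 0 = θ := max_eq_left h0
  have e : ∀ m n : ℝ, θ + m - n = θ - (n - m) := fun m n => by ring
  have e' : ∀ m n : ℝ, θ - m + n = θ - (m - n) := fun m n => by ring
  have hq : ∀ n : ℝ, n ≤ 0 → max (θ - n) 0 = θ - n := fun n hn => max_eq_left (by linarith)
  unfold cardinalSpline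
  simp only [e, e', add_assoc, sub_sub]
  norm_num [hp, hm, hq, hp0]
  ring

/-- Comparison of a spline with a number `A`, when the coefficients close to the point are close
to those of a linear function with value `A` there. -/
theorem abs_quinticSpline_sub_le {a b : ℝ} {N : ℕ} (hab : a < b) (hN : 1 ≤ N) (c : ℤ → ℝ) {x : ℝ}
    (hx : x ∈ Icc a b) (A B η : ℝ)
    (hc : ∀ i : ℤ, -2 ≤ i → i ≤ N + 2 → |i - (x - a) / ((b - a) / N)| ≤ 3 →
      |c i - (A + B * (i - (x - a) / ((b - a) / N))) / 120| ≤ η) :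
    |quinticSpline a b N c x - A| ≤ 3000000 * η := by
  rw [quinticSpline_eq hab hN]
  obtain ⟨l, hl0, hl1, θ, h0, h1, hs⟩ := exists_mesh_interval hab hN hx
  simp only [hs] at hc ⊢
  rw [cardinalSum_eq_six (by simp) c hl0 hl1 h0 h1]
  have hrep := cardinalSpline_reproduces h0 h1 (A / 120) (B / 120)
  have key : ∀ m : ℤ, -2 ≤ m → m ≤ 3 → |(c (l + m) - (A / 120 + B / 120 * (m - θ))) *
      cardinalSpline 5 (θ - m)| ≤ η * 500000 := by
    intro m hm1 hm2
    have hm1' : (-2 : ℝ) ≤ m := by exact_mod_cast hm1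
    have hm2' : (m : ℝ) ≤ 3 := by exact_mod_cast hm2
    rw [abs_mul]
    have hb : |(m : ℝ) - θ| ≤ 3 := by rw [abs_le]; constructor <;> linarith
    have h2 := hc (l + m) (by omega) (by omega) (by
      push_cast
      rw [show (l : ℝ) + m - (l + θ) = m - θ by ring]
      exact hb)
    push_cast at h2
    rw [show (l : ℝ) + m - (l + θ) = m - θ by ring] at h2
    have e : c (l + m) - (A / 120 + B / 120 * (m - θ))
        = c (l + m) - (A + B * (m - θ)) / 120 := by ring
    rw [e]
    refine mul_le_mul h2 (abs_cardinalSpline_le (by rwa [abs_sub_comm])) (abs_nonneg _)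
      ((abs_nonneg _).trans h2)
  have k1 := key (-2) (by norm_num) (by norm_num)
  have k2 := key (-1) (by norm_num) (by norm_num)
  have k3 := key 0 (by norm_num) (by norm_num)
  have k4 := key 1 (by norm_num) (by norm_num)
  have k5 := key 2 (by norm_num) (by norm_num)
  have k6 := key 3 (by norm_num) (by norm_num)
  push_cast at k1 k2 k3 k4 k5 k6
  rw [← sub_eq_add_neg] at k1 k2
  simp only [add_zero, sub_zero, sub_neg_eq_add] at k1 k2 k3 k4 k5 k6
  rw [abs_le] at *
  constructor <;> linarith [k1.1, k1.2, k2.1, k2.2, k3.1, k3.2, k4.1, k4.2, k5.1, k5.2, k6.1, k6.2]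

/-! ### Symmetry and coercivity for an abstract discrete Laplacian. -/

/-- A symmetric positive semidefinite form and a self-adjoint operator with spectrum in
`[-4, 0]`. -/
structure IsDiscreteLaplacian {M : Type*} [AddCommGroup M] [Module ℝ M] (p : M →ₗ[ℝ] M →ₗ[ℝ] ℝ)
    (T : M →ₗ[ℝ] M) : Prop where
  symm : ∀ x y, p x y = p y x
  selfAdjoint : ∀ x y, p (T x) y = p x (T y)
  nonneg : ∀ x, 0 ≤ p x x
  nonpos : ∀ x, p (T x) x ≤ 0
  lower : ∀ x, 0 ≤ p (T x) x + 4 * p x x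

namespace IsDiscreteLaplacian

variable {M : Type*} [AddCommGroup M] [Module ℝ M] {p : M →ₗ[ℝ] M →ₗ[ℝ] ℝ} {T : M →ₗ[ℝ] M}

theorem swap_one (S : IsDiscreteLaplacian p T) (x y : M) : p y (T x) = p x (T y) := by
  rw [S.symm, S.selfAdjoint]

theorem swap_two (S : IsDiscreteLaplacian p T) (x y : M) :
    p y (T (T x)) = p x (T (T y)) := by
  rw [S.symm, S.selfAdjoint, S.selfAdjoint]

theorem swap_three (S : IsDiscreteLaplacian p T) (x y : M) :
    p y (T (T (T x))) = p x (T (T (T y))) := by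
  rw [S.symm, S.selfAdjoint, S.selfAdjoint, S.selfAdjoint]

theorem swap_four (S : IsDiscreteLaplacian p T) (x y : M) :
    p y (T (T (T (T x)))) = p x (T (T (T (T y)))) := by
  rw [S.symm, S.selfAdjoint, S.selfAdjoint, S.selfAdjoint, S.selfAdjoint]

theorem swap_five (S : IsDiscreteLaplacian p T) (x y : M) :
    p y (T (T (T (T (T x))))) = p x (T (T (T (T (T y))))) := by
  rw [S.symm, S.selfAdjoint, S.selfAdjoint, S.selfAdjoint, S.selfAdjoint, S.selfAdjoint]

/-- Polynomials in `T` are self-adjoint, so only the cross terms with the end corrections `y`, `z`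
can be asymmetric. What remains of them is 120 times the difference of the left sides of `hc` and
`hd`, and the right sides agree. -/
theorem stiffness_symm (S : IsDiscreteLaplacian p T) {c d y z : M}
    (hc : p ((12 : ℝ) • y + T y) d = -9 * p y z) (hd : p ((12 : ℝ) • z + T z) c = -9 * p z y) :
    p ((6 : ℝ) • T d + T (T d) + z + T z)
        ((12 : ℝ) • ((120 : ℝ) • c + (30 : ℝ) • T c + T (T c) + (25 : ℝ) • y + T y)
          + T ((120 : ℝ) • c + (30 : ℝ) • T c + T (T c) + (25 : ℝ) • y + T y))
      = p ((6 : ℝ) • T c + T (T c) + y + T y)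
        ((12 : ℝ) • ((120 : ℝ) • d + (30 : ℝ) • T d + T (T d) + (25 : ℝ) • z + T z)
          + T ((120 : ℝ) • d + (30 : ℝ) • T d + T (T d) + (25 : ℝ) • z + T z)) := by
  simp only [map_add, map_smul, LinearMap.add_apply, LinearMap.smul_apply, smul_eq_mul,
    S.selfAdjoint] at hc hd ⊢
  rw [S.symm z y] at hd
  rw [S.symm y d, S.swap_one d y] at hc
  rw [S.symm z c, S.swap_one c z] at hd
  simp only [S.symm y d, S.swap_one d y, S.swap_two d y, S.swap_three d y, S.swap_four d y,
    S.symm z c, S.swap_one c z, S.swap_two c z, S.swap_three c z, S.swap_four c z,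
    S.swap_one d c, S.swap_two d c, S.swap_three d c, S.swap_four d c, S.swap_five d c,
    S.symm z y, S.swap_one y z, S.swap_two y z, S.swap_three y z]
  linear_combination (120 : ℝ) * hd - 120 * hc

/-- On the spectrum this is t(104 + 30t + t²) = 13/2 · t(t + 4)² − 11/2 · t²(t + 4), which is
nonpositive on [−4, 0]. -/
theorem product_nonneg (S : IsDiscreteLaplacian p T) (w : M) :
    0 ≤ -(104 * p w (T w) + 30 * p w (T (T w)) + p w (T (T (T w)))) := by
  have h1 := S.nonpos (T w + (4 : ℝ) • w)
  have h2 := S.lower (T w)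
  simp only [map_add, map_smul, LinearMap.add_apply, LinearMap.smul_apply, smul_eq_mul,
    S.selfAdjoint] at h1 h2
  linarith

/-- Without end corrections, with P = 120 + 30t + t², the identity (6 + t)(12 + t) = 72 + 18t + t² =
3/5 · P + 2/5 · t² leaves the gap 2/5 · (−t³)P ≥ 0. This is the origin of 3/5. Of the 120 in P, 104
suffices for `product_nonneg`; the remaining 16 completes a square with `y`. -/
theorem stiffness_coercive (S : IsDiscreteLaplacian p T) {c y : M}
    (hc : p ((12 : ℝ) • y + T y) c = -9 * p y y) (h1 : p y (T y) = -2 * p y y)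
    (h2 : p y (T (T y)) = 5 * p y y) (h3 : p y (T (T (T y))) = -14 * p y y)
    (h4 : p y (T (T (T (T y)))) = 42 * p y y) {v : M}
    (hv : v = (120 : ℝ) • c + (30 : ℝ) • T c + T (T c) + (25 : ℝ) • y + T y) :
    3 / 5 * (-p (T v) v) ≤
      -p ((6 : ℝ) • T c + T (T c) + y + T y) ((12 : ℝ) • v + T v) := by
  have f1 := S.product_nonneg (T c)
  -- The cross terms of `c` and `y` add up to −120(12 + t) − 4/5 · t³(25 + t). The first part is
  -- known by `hc`; the second is that of this inequality, taken with weight 1/40.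
  have f2 := S.nonpos (T ((16 : ℝ) • c + (25 : ℝ) • y + T y))
  -- The completed square brings in the fifth moment of `T` at `y`, which the hypotheses do not
  -- give; this bounds it from below through the lower ones.
  have f3 := S.lower ((25 : ℝ) • T y + T (T y))
  have f4 := S.nonneg y
  subst hv
  simp only [map_add, map_smul, LinearMap.add_apply, LinearMap.smul_apply, smul_eq_mul,
    S.selfAdjoint] at hc f1 f2 f3 ⊢
  rw [S.symm y c, S.swap_one c y] at hc
  simp only [S.symm y c, S.swap_one c y, S.swap_two c y, S.swap_three c y, S.swap_four c y]
    at f1 f2 f3 ⊢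
  linarith

end IsDiscreteLaplacian

/-! ### The Dirichlet second difference on the interior nodes. -/

/-- The function which agrees with `x` on `1, …, m` and vanishes elsewhere. -/
def interiorPart (m : ℕ) (x : ℤ → ℝ) (i : ℤ) : ℝ := if 1 ≤ i ∧ i ≤ m then x i else 0

/-- The second difference with zero boundary values at `0` and `m + 1`. -/
def dirichletLaplacian (m : ℕ) : (ℤ → ℝ) →ₗ[ℝ] (ℤ → ℝ) where
  toFun x i := interiorPart m x (i - 1) - 2 * interiorPart m x i + interiorPart m x (i + 1)
  map_add' x y := by
    funext i
    have h : ∀ j, interiorPart m (x + y) j = interiorPart m x j + interiorPart m y j := fun j => by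
      unfold interiorPart; split_ifs <;> simp
    simp only [h, Pi.add_apply]
    ring
  map_smul' r x := by
    funext i
    have h : ∀ j, interiorPart m (r • x) j = r * interiorPart m x j := fun j => by
      unfold interiorPart; split_ifs <;> simp
    simp only [h, Pi.smul_apply, smul_eq_mul, RingHom.id_apply]
    ring

/-- The sum `∑ x_i y_i` over the interior nodes `1, …, m`. -/
def interiorForm (m : ℕ) : (ℤ → ℝ) →ₗ[ℝ] (ℤ → ℝ) →ₗ[ℝ] ℝ :=
  LinearMap.mk₂ ℝ (fun x y => ∑ i ∈ Finset.range m, x (i + 1) * y (i + 1))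
    (fun x x' y => by simp [add_mul, Finset.sum_add_distrib])
    (fun r x y => by simp [mul_assoc, Finset.mul_sum])
    (fun x y y' => by simp [mul_add, Finset.sum_add_distrib])
    (fun r x y => by simp [mul_left_comm, Finset.mul_sum])

theorem interiorForm_apply (m : ℕ) (x y : ℤ → ℝ) :
    interiorForm m x y = ∑ i ∈ Finset.range m, x (i + 1) * y (i + 1) := rfl

theorem dirichletLaplacian_apply (m : ℕ) (x : ℤ → ℝ) (i : ℤ) : dirichletLaplacian m x i =
    interiorPart m x (i - 1) - 2 * interiorPart m x i + interiorPart m x (i + 1) := rfl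

theorem interiorPart_of_mem {m : ℕ} {x : ℤ → ℝ} {i : ℤ} (h0 : 1 ≤ i) (h1 : i ≤ m) :
    interiorPart m x i = x i := if_pos ⟨h0, h1⟩

theorem interiorPart_of_notMem {m : ℕ} {x : ℤ → ℝ} {i : ℤ} (h : i < 1 ∨ (m : ℤ) < i) :
    interiorPart m x i = 0 := if_neg (by omega)

theorem dirichletLaplacian_first {m : ℕ} (hm : 2 ≤ m) (x : ℤ → ℝ) :
    dirichletLaplacian m x 1 = -2 * x 1 + x 2 := by
  rw [dirichletLaplacian_apply, interiorPart_of_notMem (by omega), interiorPart_of_mem (by omega)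
    (by omega), interiorPart_of_mem (by omega) (by omega), show (1 : ℤ) + 1 = 2 by norm_num]
  ring

theorem dirichletLaplacian_last {m : ℕ} (hm : 2 ≤ m) (x : ℤ → ℝ) :
    dirichletLaplacian m x m = -2 * x m + x (m - 1) := by
  rw [dirichletLaplacian_apply, interiorPart_of_notMem (i := (m : ℤ) + 1) (by omega),
    interiorPart_of_mem (by omega) (by omega), interiorPart_of_mem (by omega) (by omega)]
  ring

theorem dirichletLaplacian_middle {m : ℕ} (x : ℤ → ℝ) {i : ℤ} (h0 : 2 ≤ i) (h1 : i + 1 ≤ m) :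
    dirichletLaplacian m x i = x (i - 1) - 2 * x i + x (i + 1) := by
  rw [dirichletLaplacian_apply, interiorPart_of_mem (by omega) (by omega),
    interiorPart_of_mem (by omega) (by omega), interiorPart_of_mem (by omega) (by omega)]

theorem interiorForm_congr {m : ℕ} {x x' y y' : ℤ → ℝ}
    (hx : ∀ i : ℤ, 1 ≤ i → i ≤ m → x i = x' i) (hy : ∀ i : ℤ, 1 ≤ i → i ≤ m → y i = y' i) :
    interiorForm m x y = interiorForm m x' y' := by
  rw [interiorForm_apply, interiorForm_apply]
  refine Finset.sum_congr rfl fun i hi => ?_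
  have := Finset.mem_range.1 hi
  rw [hx _ (by omega) (by omega), hy _ (by omega) (by omega)]

theorem interiorForm_interiorPart (m : ℕ) (x y : ℤ → ℝ) :
    interiorForm m (interiorPart m x) (interiorPart m y) = interiorForm m x y :=
  interiorForm_congr (fun _ h0 h1 => interiorPart_of_mem h0 h1)
    (fun _ h0 h1 => interiorPart_of_mem h0 h1)

theorem dirichletLaplacian_congr {m : ℕ} {x x' : ℤ → ℝ}
    (hx : ∀ i : ℤ, 1 ≤ i → i ≤ m → x i = x' i) :
    dirichletLaplacian m x = dirichletLaplacian m x' := by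
  have : interiorPart m x = interiorPart m x' := by
    funext i
    unfold interiorPart
    split_ifs with h
    · exact hx i h.1 h.2
    · rfl
  funext i
  rw [dirichletLaplacian_apply, dirichletLaplacian_apply, this]

theorem sum_secondDiff_mul (z : ℕ → ℝ) (m : ℕ) :
    ∑ i ∈ Finset.range m, (z i - 2 * z (i + 1) + z (i + 2)) * z (i + 1) =
      -∑ i ∈ Finset.range (m + 1), (z (i + 1) - z i) ^ 2 + (z (m + 1) - z m) * z (m + 1)
        - (z 1 - z 0) * z 0 := by
  induction m with
  | zero => simp; ring
  | succ m ih => rw [Finset.sum_range_succ, ih, Finset.sum_range_succ _ (m + 1)]; ring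

/-- The companion of summation by parts with sums in place of differences; it exhibits 4 + δ² as a
sum of squares and so bounds the spectrum by −4 from below. -/
theorem sum_secondSum_mul (z : ℕ → ℝ) (m : ℕ) :
    ∑ i ∈ Finset.range m, (z i + 2 * z (i + 1) + z (i + 2)) * z (i + 1) =
      ∑ i ∈ Finset.range (m + 1), (z (i + 1) + z i) ^ 2 - (z (m + 1) + z m) * z (m + 1)
        - (z 1 + z 0) * z 0 := by
  induction m with
  | zero => simp; ring
  | succ m ih => rw [Finset.sum_range_succ, ih, Finset.sum_range_succ _ (m + 1)]; ring

theorem interiorForm_laplacian_eq (m : ℕ) (x : ℤ → ℝ) :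
    interiorForm m (dirichletLaplacian m x) x =
      -∑ i ∈ Finset.range (m + 1), (interiorPart m x (i + 1) - interiorPart m x i) ^ 2 := by
  have h := sum_secondDiff_mul (fun i : ℕ => interiorPart m x i) m
  have e1 : interiorPart m x ((m + 1 : ℕ) : ℤ) = 0 := interiorPart_of_notMem (by push_cast; omega)
  have e0 : interiorPart m x ((0 : ℕ) : ℤ) = 0 := interiorPart_of_notMem (by simp)
  simp only [e1, e0, mul_zero, sub_zero, add_zero] at h
  push_cast at h
  rw [← h, interiorForm_apply]
  refine Finset.sum_congr rfl fun i hi => ?_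
  have := Finset.mem_range.1 hi
  rw [dirichletLaplacian_apply, interiorPart_of_mem (i := (i : ℤ) + 1) (by omega) (by omega),
    show (i : ℤ) + 1 - 1 = i by ring, show (i : ℤ) + 1 + 1 = i + 2 by ring]

theorem interiorForm_laplacian_add (m : ℕ) (x : ℤ → ℝ) :
    interiorForm m (dirichletLaplacian m x) x + 4 * interiorForm m x x =
      ∑ i ∈ Finset.range (m + 1), (interiorPart m x (i + 1) + interiorPart m x i) ^ 2 := by
  have h := sum_secondSum_mul (fun i : ℕ => interiorPart m x i) m
  have e1 : interiorPart m x ((m + 1 : ℕ) : ℤ) = 0 := interiorPart_of_notMem (by push_cast; omega)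
  have e0 : interiorPart m x ((0 : ℕ) : ℤ) = 0 := interiorPart_of_notMem (by simp)
  simp only [e1, e0, mul_zero, sub_zero] at h
  push_cast at h
  rw [← h, interiorForm_apply, interiorForm_apply, Finset.mul_sum, ← Finset.sum_add_distrib]
  refine Finset.sum_congr rfl fun i hi => ?_
  have := Finset.mem_range.1 hi
  rw [dirichletLaplacian_apply, interiorPart_of_mem (i := (i : ℤ) + 1) (by omega) (by omega),
    show (i : ℤ) + 1 - 1 = i by ring, show (i : ℤ) + 1 + 1 = i + 2 by ring]
  ring

theorem interiorForm_laplacian_comm (m : ℕ) (x y : ℤ → ℝ) :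
    interiorForm m (dirichletLaplacian m x) y = interiorForm m x (dirichletLaplacian m y) := by
  set X : ℕ → ℝ := fun i => interiorPart m x i with hX
  set Y : ℕ → ℝ := fun i => interiorPart m y i with hY
  have h := Finset.sum_range_sub' (fun i => X i * Y (i + 1) - X (i + 1) * Y i) m
  have e1 : X (m + 1) = 0 := interiorPart_of_notMem (by push_cast; omega)
  have e0 : X 0 = 0 := interiorPart_of_notMem (by simp)
  have f1 : Y (m + 1) = 0 := interiorPart_of_notMem (by push_cast; omega)
  have f0 : Y 0 = 0 := interiorPart_of_notMem (by simp)
  simp only [e1, e0, f1, f0, mul_zero, zero_mul, sub_zero] at h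
  rw [← sub_eq_zero, ← h, interiorForm_apply, interiorForm_apply, ← Finset.sum_sub_distrib]
  refine Finset.sum_congr rfl fun i hi => ?_
  have := Finset.mem_range.1 hi
  simp only [hX, hY]
  push_cast
  rw [dirichletLaplacian_apply, dirichletLaplacian_apply,
    interiorPart_of_mem (i := (i : ℤ) + 1) (by omega) (by omega),
    interiorPart_of_mem (i := (i : ℤ) + 1) (by omega) (by omega),
    show (i : ℤ) + 1 - 1 = i by ring]
  ring

theorem isDiscreteLaplacian (m : ℕ) :
    IsDiscreteLaplacian (interiorForm m) (dirichletLaplacian m) where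
  symm x y := by simp only [interiorForm_apply, mul_comm]
  selfAdjoint := interiorForm_laplacian_comm m
  nonneg x := by
    rw [interiorForm_apply]
    exact Finset.sum_nonneg fun i _ => mul_self_nonneg _
  nonpos x := by
    rw [interiorForm_laplacian_eq, neg_nonpos]
    exact Finset.sum_nonneg fun i _ => sq_nonneg _
  lower x := by
    rw [interiorForm_laplacian_add]
    exact Finset.sum_nonneg fun i _ => sq_nonneg _

/-- The discrete Sobolev inequality in one dimension. -/
theorem sq_le_neg_laplacian (m : ℕ) (x : ℤ → ℝ) {i : ℤ} (h0 : 1 ≤ i) (h1 : i ≤ m) :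
    x i ^ 2 ≤ (m + 1) * -interiorForm m (dirichletLaplacian m x) x := by
  rw [interiorForm_laplacian_eq, neg_neg]
  set X : ℕ → ℝ := fun i => interiorPart m x i with hX
  obtain ⟨k, rfl⟩ : ∃ k : ℕ, i = k := ⟨i.toNat, by omega⟩
  have hx : x k = ∑ j ∈ Finset.range k, (X (j + 1) - X j) := by
    rw [Finset.sum_range_sub]
    have e0 : X 0 = 0 := interiorPart_of_notMem (by simp)
    rw [e0, sub_zero]
    exact (interiorPart_of_mem h0 h1).symm
  have hk : k ≤ m + 1 := by omega
  have hk' : (k : ℝ) ≤ m + 1 := by exact_mod_cast hk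
  calc x k ^ 2 ≤ (Finset.range k).card * ∑ j ∈ Finset.range k, (X (j + 1) - X j) ^ 2 := by
        rw [hx]; exact sq_sum_le_card_mul_sum_sq
    _ ≤ (m + 1) * ∑ j ∈ Finset.range (m + 1), (X (j + 1) - X j) ^ 2 := by
        rw [Finset.card_range]
        refine mul_le_mul hk' ?_ (Finset.sum_nonneg fun _ _ => sq_nonneg _) (by positivity)
        exact Finset.sum_le_sum_of_subset_of_nonneg (Finset.range_subset_range.2 hk)
          fun _ _ _ => sq_nonneg _
    _ = _ := by simp [hX]

/-! ### Splines with homogeneous end conditions. -/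

/-- The spline with coefficients `e` vanishes to second order at both end points. -/
structure IsHomogeneous (N : ℕ) (e : ℤ → ℝ) : Prop where
  value_left : nodeValue e 0 = 0
  value_right : nodeValue e N = 0
  slope_left : nodeSlope e 0 = 0
  slope_right : nodeSlope e N = 0
  curv_left : nodeCurv e 0 = 0
  curv_right : nodeCurv e N = 0

/-- The part of the node values which is due to the coefficients at the two end nodes. -/
def boundaryPart (m : ℕ) (e : ℤ → ℝ) (i : ℤ) : ℝ :=
  if i = 1 then e 0 else if i = m then e (m + 1) else 0

namespace IsHomogeneous

variable {m : ℕ} {e : ℤ → ℝ}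

/-- The three end conditions determine the coefficients at −2, −1 and 0 from those at 1 and 2. -/
theorem left_zero (h : IsHomogeneous (m + 1) e) : 9 * e 0 = -(10 * e 1 + e 2) := by
  have h1 := h.value_left
  have h2 := h.slope_left
  have h3 := h.curv_left
  simp only [nodeValue, nodeSlope, nodeCurv] at h1 h2 h3
  norm_num at h1 h2 h3
  linarith

theorem left_neg_one (h : IsHomogeneous (m + 1) e) : e (-1) = -3 * e 0 - e 1 := by
  have h1 := h.value_left
  have h3 := h.curv_left
  simp only [nodeValue, nodeCurv] at h1 h3
  norm_num at h1 h3
  linarith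

theorem right_zero (h : IsHomogeneous (m + 1) e) :
    9 * e (m + 1) = -(10 * e m + e (m - 1)) := by
  have h1 := h.value_right
  have h2 := h.slope_right
  have h3 := h.curv_right
  simp only [nodeValue, nodeSlope, nodeCurv] at h1 h2 h3
  push_cast at h1 h2 h3
  rw [show (m : ℤ) + 1 - 2 = m - 1 by ring, show (m : ℤ) + 1 - 1 = m by ring] at h1 h2 h3
  linarith

theorem right_one (h : IsHomogeneous (m + 1) e) : e (m + 2) = -3 * e (m + 1) - e m := by
  have h1 := h.value_right
  have h3 := h.curv_right
  simp only [nodeValue, nodeCurv] at h1 h3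
  push_cast at h1 h3
  rw [show (m : ℤ) + 1 - 2 = m - 1 by ring, show (m : ℤ) + 1 - 1 = m by ring,
    show (m : ℤ) + 1 + 1 = m + 2 by ring] at h1 h3
  linarith

theorem interior_cases {m : ℕ} {i : ℤ} (h0 : 1 ≤ i) (h1 : i ≤ m) :
    i = 1 ∨ i = 2 ∨ i = m ∨ i = m - 1 ∨ (3 ≤ i ∧ i + 2 ≤ m) := by omega

theorem boundaryPart_first (m : ℕ) (e : ℤ → ℝ) : boundaryPart m e 1 = e 0 := by
  simp [boundaryPart]

theorem boundaryPart_last {m : ℕ} (hm : 2 ≤ m) (e : ℤ → ℝ) :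
    boundaryPart m e m = e (m + 1) := by
  simp [boundaryPart, show (m : ℤ) ≠ 1 by omega]

theorem boundaryPart_middle {m : ℕ} {i : ℤ} (h1 : i ≠ 1) (hm : i ≠ m) (e : ℤ → ℝ) :
    boundaryPart m e i = 0 := by
  simp [boundaryPart, h1, hm]

/-- The stencil is 120 + 30δ² + δ⁴. Near the ends the Dirichlet operator drops the coefficients at
0, −1 and their mirror images; expressing the outer one by `left_neg_one` or `right_one`, what was
dropped is 25 + `T` applied to the boundary part. -/
theorem nodeValue_eq (hm : 6 ≤ m) (h : IsHomogeneous (m + 1) e) {i : ℤ} (h0 : 1 ≤ i)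
    (h1 : i ≤ m) : nodeValue e i = ((120 : ℝ) • e + (30 : ℝ) • dirichletLaplacian m e
      + dirichletLaplacian m (dirichletLaplacian m e) + (25 : ℝ) • boundaryPart m e
      + dirichletLaplacian m (boundaryPart m e)) i := by
  have hm2 : 2 ≤ m := by omega
  simp only [Pi.add_apply, Pi.smul_apply, smul_eq_mul, nodeValue]
  rcases interior_cases h0 h1 with rfl | rfl | rfl | rfl | ⟨h0, h1⟩
  · rw [dirichletLaplacian_first hm2, dirichletLaplacian_first hm2, dirichletLaplacian_first hm2,
      dirichletLaplacian_first hm2, dirichletLaplacian_middle e (i := 2) (by omega) (by omega), boundaryPart_first,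
      boundaryPart_middle (by omega) (by omega)]
    norm_num
    linarith [h.left_neg_one]
  · rw [dirichletLaplacian_middle e (i := 2) (by omega) (by omega),
      dirichletLaplacian_middle _ (i := 2) (by omega) (by omega),
      dirichletLaplacian_middle (boundaryPart m e) (i := 2) (by omega) (by omega)]
    norm_num
    rw [dirichletLaplacian_first hm2, dirichletLaplacian_middle e (i := 2) (by omega) (by omega),
      dirichletLaplacian_middle e (i := 3) (by omega) (by omega), boundaryPart_first,
      boundaryPart_middle (by omega) (by omega), boundaryPart_middle (by omega) (by omega)]
    norm_num
    ring
  · rw [dirichletLaplacian_last hm2, dirichletLaplacian_last hm2, dirichletLaplacian_last hm2,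
      dirichletLaplacian_last hm2, dirichletLaplacian_middle e (i := (m : ℤ) - 1) (by omega) (by omega), boundaryPart_last hm2,
      boundaryPart_middle (by omega) (by omega), h.right_one]
    ring_nf
  · rw [dirichletLaplacian_middle e (i := (m : ℤ) - 1) (by omega) (by omega),
      dirichletLaplacian_middle _ (i := (m : ℤ) - 1) (by omega) (by omega),
      dirichletLaplacian_middle (boundaryPart m e) (i := (m : ℤ) - 1) (by omega) (by omega),
      sub_add_cancel,
      dirichletLaplacian_last hm2,
      dirichletLaplacian_middle e (i := (m : ℤ) - 1) (by omega) (by omega),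
      dirichletLaplacian_middle e (i := (m : ℤ) - 1 - 1) (by omega) (by omega),
      boundaryPart_last hm2,
      boundaryPart_middle (by omega) (by omega), boundaryPart_middle (by omega) (by omega)]
    ring_nf
  · rw [dirichletLaplacian_middle e (i := i) (by omega) (by omega),
      dirichletLaplacian_middle _ (i := i) (by omega) (by omega),
      dirichletLaplacian_middle (boundaryPart m e) (i := i) (by omega) (by omega),
      dirichletLaplacian_middle e (i := i) (by omega) (by omega),
      dirichletLaplacian_middle e (i := i - 1) (by omega) (by omega),
      dirichletLaplacian_middle e (i := i + 1) (by omega) (by omega),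
      boundaryPart_middle (by omega) (by omega), boundaryPart_middle (by omega) (by omega),
      boundaryPart_middle (by omega) (by omega)]
    ring_nf

theorem nodeCurv_eq (hm : 6 ≤ m) (h : IsHomogeneous (m + 1) e) {i : ℤ} (h0 : 1 ≤ i)
    (h1 : i ≤ m) : nodeCurv e i = ((6 : ℝ) • dirichletLaplacian m e
      + dirichletLaplacian m (dirichletLaplacian m e) + boundaryPart m e
      + dirichletLaplacian m (boundaryPart m e)) i := by
  have hm2 : 2 ≤ m := by omega
  have hv := h.nodeValue_eq hm h0 h1
  -- The fourth difference cancels in this difference of stencils, which leaves a three-point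
  -- formula that is much easier to check near the ends.
  have hd : nodeValue e i - nodeCurv e i
      = 120 * e i + 24 * dirichletLaplacian m e i + 24 * boundaryPart m e i := by
    simp only [nodeValue, nodeCurv]
    have : i = 1 ∨ i = m ∨ (2 ≤ i ∧ i + 1 ≤ m) := by omega
    rcases this with rfl | rfl | ⟨h0, h1⟩
    · rw [dirichletLaplacian_first hm2, boundaryPart_first]
      norm_num
      ring
    · rw [dirichletLaplacian_last hm2, boundaryPart_last hm2]
      ring
    · rw [dirichletLaplacian_middle e h0 h1, boundaryPart_middle (by omega) (by omega)]
      ring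
  simp only [Pi.add_apply, Pi.smul_apply, smul_eq_mul] at hv ⊢
  linarith

theorem interiorForm_boundaryPart (hm : 2 ≤ m) (e x : ℤ → ℝ) :
    interiorForm m (boundaryPart m e) x = e 0 * x 1 + e (m + 1) * x m := by
  rw [interiorForm_apply, Finset.sum_eq_add_of_mem (0 : ℕ) (m - 1) (by simp; omega)
    (by simp; omega) (by omega)]
  · rw [show ((m - 1 : ℕ) : ℤ) + 1 = m by omega, boundaryPart_last hm, Nat.cast_zero, zero_add,
      boundaryPart_first]
  · intro i _ hi
    rw [boundaryPart_middle (by omega) (by omega), zero_mul]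

/-- The operator `12 + δ²` with zero boundary values. -/
def weight (m : ℕ) (x : ℤ → ℝ) : ℤ → ℝ := (12 : ℝ) • x + dirichletLaplacian m x

/-- The reason for the weight 12 + δ²: applied to a unit mass at an end interior node it has the
entries 10 and 1, exactly the coefficients in `left_zero` and `right_zero`. -/
theorem weight_boundaryPart (hm : 6 ≤ m) (h : IsHomogeneous (m + 1) e) (e' : ℤ → ℝ) :
    interiorForm m ((12 : ℝ) • boundaryPart m e' + dirichletLaplacian m (boundaryPart m e')) e
      = -9 * interiorForm m (boundaryPart m e') (boundaryPart m e) := by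
  have hm2 : 2 ≤ m := by omega
  rw [map_add, map_smul, LinearMap.add_apply, LinearMap.smul_apply, interiorForm_laplacian_comm,
    interiorForm_boundaryPart hm2, interiorForm_boundaryPart hm2, interiorForm_boundaryPart hm2,
    dirichletLaplacian_first hm2, dirichletLaplacian_last hm2, boundaryPart_first,
    boundaryPart_last hm2, smul_eq_mul]
  linear_combination e' 0 * h.left_zero + e' (m + 1) * h.right_zero

theorem weight_congr {x x' : ℤ → ℝ} (hx : ∀ i : ℤ, 1 ≤ i → i ≤ m → x i = x' i) :
    ∀ i : ℤ, 1 ≤ i → i ≤ m → weight m x i = weight m x' i := by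
  intro i h0 h1
  simp only [weight, Pi.add_apply, Pi.smul_apply, hx i h0 h1, dirichletLaplacian_congr hx]

theorem stiffness_symm (hm : 6 ≤ m) {e e' : ℤ → ℝ} (h : IsHomogeneous (m + 1) e)
    (h' : IsHomogeneous (m + 1) e') :
    interiorForm m (nodeCurv e') (weight m (nodeValue e))
      = interiorForm m (nodeCurv e) (weight m (nodeValue e')) := by
  rw [interiorForm_congr (fun i => h'.nodeCurv_eq hm) (weight_congr fun i => h.nodeValue_eq hm),
    interiorForm_congr (fun i => h.nodeCurv_eq hm) (weight_congr fun i => h'.nodeValue_eq hm)]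
  exact (isDiscreteLaplacian m).stiffness_symm (h'.weight_boundaryPart hm e)
    (h.weight_boundaryPart hm e')

theorem stiffness_coercive (hm : 8 ≤ m) (h : IsHomogeneous (m + 1) e) :
    3 / 5 * (-interiorForm m (dirichletLaplacian m (nodeValue e)) (nodeValue e)) ≤
      -interiorForm m (nodeCurv e) (weight m (nodeValue e)) := by
  have hm6 : 6 ≤ m := by omega
  have hm2 : 2 ≤ m := by omega
  rw [interiorForm_congr (fun i => h.nodeCurv_eq hm6) (weight_congr fun i => h.nodeValue_eq hm6),
    dirichletLaplacian_congr (fun i => h.nodeValue_eq hm6),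
    interiorForm_congr (fun _ _ _ => rfl) (fun i => h.nodeValue_eq hm6)]
  set y := boundaryPart m e with hy
  set T := dirichletLaplacian m with hT
  have y1 : y 1 = e 0 := boundaryPart_first m e
  have ym : y m = e (m + 1) := boundaryPart_last hm2 e
  have y0 : ∀ i : ℤ, 2 ≤ i → i + 1 ≤ m → y i = 0 := fun i h0 h1 =>
    boundaryPart_middle (by omega) (by omega) e
  have l1 : ∀ x : ℤ → ℝ, T x 1 = -2 * x 1 + x 2 := dirichletLaplacian_first hm2
  have l2 : ∀ x : ℤ → ℝ, T x 2 = x 1 - 2 * x 2 + x 3 := fun x =>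
    dirichletLaplacian_middle x le_rfl (by omega)
  have l3 : ∀ x : ℤ → ℝ, T x 3 = x 2 - 2 * x 3 + x 4 := fun x =>
    dirichletLaplacian_middle x (by norm_num) (by omega)
  have l4 : ∀ x : ℤ → ℝ, T x 4 = x 3 - 2 * x 4 + x 5 := fun x =>
    dirichletLaplacian_middle x (by norm_num) (by omega)
  have r1 : ∀ x : ℤ → ℝ, T x m = -2 * x m + x (m - 1) := dirichletLaplacian_last hm2
  have r2 : ∀ x : ℤ → ℝ, T x (m - 1) = x (m - 2) - 2 * x (m - 1) + x m := fun x => by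
    rw [dirichletLaplacian_middle x (by omega) (by omega), show (m : ℤ) - 1 - 1 = m - 2 by ring,
      show (m : ℤ) - 1 + 1 = m by ring]
  have r3 : ∀ x : ℤ → ℝ, T x (m - 2) = x (m - 3) - 2 * x (m - 2) + x (m - 1) := fun x => by
    rw [dirichletLaplacian_middle x (by omega) (by omega), show (m : ℤ) - 2 - 1 = m - 3 by ring,
      show (m : ℤ) - 2 + 1 = m - 1 by ring]
  have r4 : ∀ x : ℤ → ℝ, T x (m - 3) = x (m - 4) - 2 * x (m - 3) + x (m - 2) := fun x => by
    rw [dirichletLaplacian_middle x (by omega) (by omega), show (m : ℤ) - 3 - 1 = m - 4 by ring,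
      show (m : ℤ) - 3 + 1 = m - 2 by ring]
  have v2 := y0 2 le_rfl (by omega)
  have v3 := y0 3 (by omega) (by omega)
  have v4 := y0 4 (by omega) (by omega)
  have v5 := y0 5 (by omega) (by omega)
  have w2 := y0 (m - 1) (by omega) (by omega)
  have w3 := y0 (m - 2) (by omega) (by omega)
  have w4 := y0 (m - 3) (by omega) (by omega)
  have w5 := y0 (m - 4) (by omega) (by omega)
  have hp : ∀ x, interiorForm m y x = e 0 * x 1 + e (m + 1) * x m :=
    interiorForm_boundaryPart hm2 e
  -- The moments of `T` at the end of a long chain are the Catalan numbers 2, 5, 14, 42 with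
  -- alternating signs. Four applications read at most five nodes from an end, so the two ends do
  -- not interact.
  refine (isDiscreteLaplacian m).stiffness_coercive (h.weight_boundaryPart hm6 e) ?_ ?_ ?_ ?_ rfl
  all_goals
    rw [← hy, ← hT, hp, hp]
    simp only [l1, l2, l3, l4, r1, r2, r3, r4, v2, v3, v4, v5, w2, w3, w4, w5, y1, ym]
    ring

end IsHomogeneous

/-! ### Bounding coefficients by node data. -/

/-- Diagonal dominance: a spline is bounded by its node values and its boundary values. -/
theorem abs_coeff_le {m : ℕ} (hm : 6 ≤ m) {c : ℤ → ℝ} {η : ℝ}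
    (hv : ∀ i : ℤ, 0 ≤ i → i ≤ m + 1 → |nodeValue c i| ≤ η) (hs0 : |nodeSlope c 0| ≤ η)
    (hc0 : |nodeCurv c 0| ≤ η) (hs1 : |nodeSlope c (m + 1)| ≤ η)
    (hc1 : |nodeCurv c (m + 1)| ≤ η) :
    ∀ i : ℤ, -2 ≤ i → i ≤ m + 3 → |c i| ≤ 30 * η := by
  obtain ⟨j, hj, hmax⟩ := Finset.exists_max_image (Finset.Icc (1 : ℤ) m) (fun i => |c i|)
    ⟨1, by simp; omega⟩
  rw [Finset.mem_Icc] at hj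
  have hle : ∀ i : ℤ, 1 ≤ i → i ≤ m → -|c j| ≤ c i ∧ c i ≤ |c j| := fun i h0 h1 =>
    abs_le.1 (hmax i (Finset.mem_Icc.2 ⟨h0, h1⟩))
  have hη : 0 ≤ η := (abs_nonneg _).trans hs0
  have v0 := hv 0 le_rfl (by omega)
  have v1 := hv (m + 1) (by omega) le_rfl
  rw [show (m : ℤ) + 1 = m + 1 from rfl] at v1
  simp only [nodeValue, nodeSlope, nodeCurv, abs_le] at v0 v1 hs0 hs1 hc0 hc1
  norm_num at v0 hs0 hc0
  rw [show (m : ℤ) + 1 - 2 = m - 1 by ring, show (m : ℤ) + 1 - 1 = m by ring,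
    show (m : ℤ) + 1 + 1 = m + 2 by ring, show (m : ℤ) + 1 + 2 = m + 3 by ring] at v1 hs1 hc1
  obtain ⟨v0l, v0r⟩ := v0
  obtain ⟨v1l, v1r⟩ := v1
  obtain ⟨s0l, s0r⟩ := hs0
  obtain ⟨s1l, s1r⟩ := hs1
  obtain ⟨c0l, c0r⟩ := hc0
  obtain ⟨c1l, c1r⟩ := hc1
  obtain ⟨e1l, e1r⟩ := hle 1 le_rfl (by omega)
  obtain ⟨e2l, e2r⟩ := hle 2 (by omega) (by omega)
  obtain ⟨f1l, f1r⟩ := hle m (by omega) (by omega)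
  obtain ⟨f2l, f2r⟩ := hle (m - 1) (by omega) (by omega)
  -- At an interior row 66 exceeds 26 + 26 + 1 + 1 = 54 by 12. In the rows next to an end, the end
  -- data first eliminate the coefficients at and beyond the end node, and dominance persists.
  have hmu : |c j| ≤ η := by
    obtain ⟨vl, vr⟩ := abs_le.1 (hv j (by omega) (by omega))
    simp only [nodeValue] at vl vr
    obtain ⟨e3l, e3r⟩ := hle 3 (by omega) (by omega)
    obtain ⟨e4l, e4r⟩ := hle 4 (by omega) (by omega)
    obtain ⟨f3l, f3r⟩ := hle (m - 2) (by omega) (by omega)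
    obtain ⟨f4l, f4r⟩ := hle (m - 3) (by omega) (by omega)
    rcases IsHomogeneous.interior_cases hj.1 hj.2 with rfl | rfl | rfl | rfl | ⟨h0, h1⟩
    · norm_num at vl vr
      rcases abs_cases (c 1) with ⟨h, _⟩ | ⟨h, _⟩ <;> linarith
    · norm_num at vl vr
      rcases abs_cases (c 2) with ⟨h, _⟩ | ⟨h, _⟩ <;> linarith
    · rcases abs_cases (c m) with ⟨h, _⟩ | ⟨h, _⟩ <;> linarith
    · rw [show (m : ℤ) - 1 - 2 = m - 3 by ring, show (m : ℤ) - 1 - 1 = m - 2 by ring,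
        show (m : ℤ) - 1 + 1 = m by ring, show (m : ℤ) - 1 + 2 = m + 1 by ring] at vl vr
      rcases abs_cases (c (m - 1)) with ⟨h, _⟩ | ⟨h, _⟩ <;> linarith
    · obtain ⟨g1l, g1r⟩ := hle (j - 2) (by omega) (by omega)
      obtain ⟨g2l, g2r⟩ := hle (j - 1) (by omega) (by omega)
      obtain ⟨g3l, g3r⟩ := hle (j + 1) (by omega) (by omega)
      obtain ⟨g4l, g4r⟩ := hle (j + 2) (by omega) (by omega)
      rcases abs_cases (c j) with ⟨h, _⟩ | ⟨h, _⟩ <;> linarith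
  intro i h0 h1
  rw [abs_le]
  have : i = -2 ∨ i = -1 ∨ i = 0 ∨ i = m + 1 ∨ i = m + 2 ∨ i = m + 3 ∨ (1 ≤ i ∧ i ≤ m) := by omega
  rcases this with rfl | rfl | rfl | rfl | rfl | rfl | ⟨h0, h1⟩
  any_goals constructor <;> linarith
  obtain ⟨hl, hr⟩ := hle i h0 h1
  constructor <;> linarith

/-! ### Solvability of the spline collocation problems -/

/-- The node values weighted with `12 + δ²`. -/
noncomputable def weightForm (m : ℕ) : (ℤ → ℝ) →ₗ[ℝ] (ℤ → ℝ) →ₗ[ℝ] ℝ :=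
  (12 : ℝ) • interiorForm m + (interiorForm m).compl₂ (dirichletLaplacian m)

theorem weightForm_apply (m : ℕ) (x y : ℤ → ℝ) : weightForm m x y =
    12 * interiorForm m x y + interiorForm m x (dirichletLaplacian m y) := rfl

theorem weightForm_eq (m : ℕ) (x y : ℤ → ℝ) :
    weightForm m x y = interiorForm m x (IsHomogeneous.weight m y) := by
  rw [weightForm_apply, IsHomogeneous.weight, map_add, map_smul, smul_eq_mul]

theorem weightForm_comm (m : ℕ) (x y : ℤ → ℝ) : weightForm m x y = weightForm m y x := by
  rw [weightForm_apply, weightForm_apply, (isDiscreteLaplacian m).symm x y,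
    (isDiscreteLaplacian m).swap_one y x]

theorem le_weightForm (m : ℕ) (x : ℤ → ℝ) : 8 * interiorForm m x x ≤ weightForm m x x := by
  have := (isDiscreteLaplacian m).lower x
  rw [(isDiscreteLaplacian m).selfAdjoint] at this
  rw [weightForm_apply]
  linarith

theorem weightForm_le (m : ℕ) (x : ℤ → ℝ) : weightForm m x x ≤ 12 * interiorForm m x x := by
  have := (isDiscreteLaplacian m).nonpos x
  rw [(isDiscreteLaplacian m).selfAdjoint] at this
  rw [weightForm_apply]
  linarith

theorem weightForm_nonneg (m : ℕ) (x : ℤ → ℝ) : 0 ≤ weightForm m x x := by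
  linarith [le_weightForm m x, (isDiscreteLaplacian m).nonneg x]

theorem weightForm_congr {m : ℕ} {x x' y y' : ℤ → ℝ}
    (hx : ∀ i : ℤ, 1 ≤ i → i ≤ m → x i = x' i) (hy : ∀ i : ℤ, 1 ≤ i → i ≤ m → y i = y' i) :
    weightForm m x y = weightForm m x' y' := by
  rw [weightForm_apply, weightForm_apply, interiorForm_congr hx hy, dirichletLaplacian_congr hy,
    interiorForm_congr hx fun _ _ _ => rfl]

theorem interiorForm_self_le {m : ℕ} {x : ℤ → ℝ} {C : ℝ}
    (hx : ∀ i : ℤ, 1 ≤ i → i ≤ m → x i ^ 2 ≤ C) : interiorForm m x x ≤ m * C := by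
  rw [interiorForm_apply]
  calc ∑ i ∈ Finset.range m, x (i + 1) * x (i + 1) ≤ ∑ _i ∈ Finset.range m, C := by
        refine Finset.sum_le_sum fun i hi => ?_
        have := Finset.mem_range.1 hi
        rw [← sq]
        exact hx _ (by omega) (by omega)
    _ = m * C := by simp

theorem eq_zero_of_interiorForm_self {m : ℕ} {x : ℤ → ℝ} (hx : interiorForm m x x ≤ 0) {i : ℤ}
    (h0 : 1 ≤ i) (h1 : i ≤ m) : x i = 0 := by
  rw [interiorForm_apply] at hx
  have h := (Finset.sum_eq_zero_iff_of_nonneg fun j (_ : j ∈ Finset.range m) =>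
    mul_self_nonneg (x (j + 1))).1 (le_antisymm hx (Finset.sum_nonneg fun _ _ => mul_self_nonneg _))
    (i - 1).toNat (Finset.mem_range.2 (by omega))
  rw [show (((i - 1).toNat : ℕ) : ℤ) + 1 = i by omega] at h
  exact mul_self_eq_zero.1 h

/-- The left-hand sides of the collocation equations with parameter `l`, indexed in the same way
as the coefficients. -/
def collocationSystem (m : ℕ) (l : ℝ) (c : ℤ → ℝ) (i : ℤ) : ℝ :=
  if i = -2 then nodeSlope c 0 else if i = -1 then nodeCurv c 0
  else if i = m + 2 then nodeCurv c (m + 1) else if i = m + 3 then nodeSlope c (m + 1)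
  else if i = 0 ∨ i = m + 1 then nodeValue c i else nodeValue c i - l * nodeCurv c i

/-- Extension by zero of a coefficient vector. -/
noncomputable def extendCoeff (m : ℕ) (f : Finset.Icc (-2 : ℤ) (m + 3) → ℝ) (i : ℤ) : ℝ :=
  if h : i ∈ Finset.Icc (-2 : ℤ) (m + 3) then f ⟨i, h⟩ else 0

noncomputable def collocationMap (m : ℕ) (l : ℝ) :
    (Finset.Icc (-2 : ℤ) (m + 3) → ℝ) →ₗ[ℝ] (Finset.Icc (-2 : ℤ) (m + 3) → ℝ) where
  toFun f i := collocationSystem m l (extendCoeff m f) i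
  map_add' f g := by
    funext i
    have h : ∀ j, extendCoeff m (f + g) j = extendCoeff m f j + extendCoeff m g j := fun j => by
      unfold extendCoeff; split_ifs <;> simp
    simp only [Pi.add_apply, collocationSystem, nodeSlope, nodeCurv, nodeValue, h]
    split_ifs <;> ring
  map_smul' r f := by
    funext i
    have h : ∀ j, extendCoeff m (r • f) j = r * extendCoeff m f j := fun j => by
      unfold extendCoeff; split_ifs <;> simp
    simp only [Pi.smul_apply, smul_eq_mul, RingHom.id_apply, collocationSystem, nodeSlope,
      nodeCurv, nodeValue, h]
    split_ifs <;> ring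

theorem collocationMap_injective {m : ℕ} (hm : 8 ≤ m) {l : ℝ} (hl : 0 ≤ l) :
    Function.Injective (collocationMap m l) := by
  rw [← LinearMap.ker_eq_bot, LinearMap.ker_eq_bot']
  intro f hf
  set c := extendCoeff m f with hc
  have h : ∀ i : ℤ, -2 ≤ i → i ≤ m + 3 → collocationSystem m l c i = 0 := fun i h0 h1 =>
    congrFun hf ⟨i, Finset.mem_Icc.2 ⟨h0, h1⟩⟩
  have a1 := h (-2) (by omega) (by omega)
  have a2 := h (-1) (by omega) (by omega)
  have a3 := h 0 (by omega) (by omega)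
  have b1 := h (m + 3) (by omega) (by omega)
  have b2 := h (m + 2) (by omega) (by omega)
  have b3 := h (m + 1) (by omega) (by omega)
  unfold collocationSystem at a1 a2 a3 b1 b2 b3
  rw [if_pos rfl] at a1
  rw [if_neg (by omega), if_pos rfl] at a2
  rw [if_neg (by omega), if_neg (by omega), if_neg (by omega), if_neg (by omega),
    if_pos (Or.inl rfl)] at a3
  rw [if_neg (by omega), if_neg (by omega), if_neg (by omega), if_pos rfl] at b1
  rw [if_neg (by omega), if_neg (by omega), if_pos rfl] at b2
  rw [if_neg (by omega), if_neg (by omega), if_neg (by omega), if_neg (by omega),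
    if_pos (Or.inr rfl)] at b3
  have hhom : IsHomogeneous (m + 1) c := by
    constructor <;> push_cast <;> assumption
  have hint : ∀ i : ℤ, 1 ≤ i → i ≤ m → nodeValue c i = (l • nodeCurv c) i := fun i h0 h1 => by
    have := h i (by omega) (by omega)
    unfold collocationSystem at this
    rw [if_neg (by omega), if_neg (by omega), if_neg (by omega), if_neg (by omega),
      if_neg (by omega)] at this
    rw [Pi.smul_apply, smul_eq_mul]
    linarith
  have hcoer := hhom.stiffness_coercive hm
  rw [← weightForm_eq] at hcoer
  have hneg := (isDiscreteLaplacian m).nonpos (nodeValue c)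
  have hle := le_weightForm m (nodeValue c)
  rw [weightForm_congr hint (fun _ _ _ => rfl), map_smul, LinearMap.smul_apply, smul_eq_mul] at hle
  -- In the kernel the node values are `l` times the second differences, so their weighted square is
  -- `l` times a pairing that coercivity makes nonpositive.
  have hz : interiorForm m (nodeValue c) (nodeValue c) ≤ 0 := by
    have : l * weightForm m (nodeCurv c) (nodeValue c) ≤ 0 :=
      mul_nonpos_of_nonneg_of_nonpos hl (by linarith)
    linarith
  have hv : ∀ i : ℤ, 0 ≤ i → i ≤ m + 1 → |nodeValue c i| ≤ 0 := fun i h0 h1 => by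
    have : i = 0 ∨ i = m + 1 ∨ (1 ≤ i ∧ i ≤ m) := by omega
    rcases this with rfl | rfl | ⟨h0, h1⟩
    · rw [a3, abs_zero]
    · rw [b3, abs_zero]
    · rw [eq_zero_of_interiorForm_self hz h0 h1, abs_zero]
  have hzero := abs_coeff_le (by omega) hv (by rw [a1, abs_zero]) (by rw [a2, abs_zero])
    (by rw [b1, abs_zero]) (by rw [b2, abs_zero])
  funext ⟨i, hi⟩
  have := hzero i (Finset.mem_Icc.1 hi).1 (Finset.mem_Icc.1 hi).2
  rw [mul_zero, abs_nonpos_iff, hc, extendCoeff, dif_pos hi] at this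
  exact this

/-- Unique solvability of the collocation equations; `l = 0` is interpolation. -/
theorem exists_collocation {m : ℕ} (hm : 8 ≤ m) {l : ℝ} (hl : 0 ≤ l) (v : ℤ → ℝ)
    (s₀ s₁ w₀ w₁ : ℝ) : ∃ c : ℤ → ℝ, nodeSlope c 0 = s₀ ∧ nodeSlope c (m + 1) = s₁ ∧
      nodeCurv c 0 = w₀ ∧ nodeCurv c (m + 1) = w₁ ∧ nodeValue c 0 = v 0 ∧
      nodeValue c (m + 1) = v (m + 1) ∧
      ∀ i : ℤ, 1 ≤ i → i ≤ m → nodeValue c i - l * nodeCurv c i = v i := by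
  obtain ⟨f, hf⟩ := LinearMap.injective_iff_surjective.1 (collocationMap_injective hm hl)
    (fun i => if (i : ℤ) = -2 then s₀ else if (i : ℤ) = -1 then w₀ else
      if (i : ℤ) = m + 2 then w₁ else if (i : ℤ) = m + 3 then s₁ else v i)
  have h : ∀ i : ℤ, -2 ≤ i → i ≤ m + 3 → collocationSystem m l (extendCoeff m f) i =
      if i = -2 then s₀ else if i = -1 then w₀ else if i = m + 2 then w₁ else
      if i = m + 3 then s₁ else v i := fun i h0 h1 =>
    congrFun hf ⟨i, Finset.mem_Icc.2 ⟨h0, h1⟩⟩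
  have a1 := h (-2) (by omega) (by omega)
  have a2 := h (-1) (by omega) (by omega)
  have a3 := h 0 (by omega) (by omega)
  have b1 := h (m + 3) (by omega) (by omega)
  have b2 := h (m + 2) (by omega) (by omega)
  have b3 := h (m + 1) (by omega) (by omega)
  unfold collocationSystem at a1 a2 a3 b1 b2 b3
  rw [if_pos rfl, if_pos rfl] at a1
  rw [if_neg (by omega), if_pos rfl, if_neg (by omega), if_pos rfl] at a2
  rw [if_neg (by omega), if_neg (by omega), if_neg (by omega), if_neg (by omega),
    if_pos (Or.inl rfl), if_neg (by omega), if_neg (by omega), if_neg (by omega),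
    if_neg (by omega)] at a3
  rw [if_neg (by omega), if_neg (by omega), if_neg (by omega), if_pos rfl, if_neg (by omega),
    if_neg (by omega), if_neg (by omega), if_pos rfl] at b1
  rw [if_neg (by omega), if_neg (by omega), if_pos rfl, if_neg (by omega), if_neg (by omega),
    if_pos rfl] at b2
  rw [if_neg (by omega), if_neg (by omega), if_neg (by omega), if_neg (by omega),
    if_pos (Or.inr rfl), if_neg (by omega), if_neg (by omega), if_neg (by omega),
    if_neg (by omega)] at b3
  refine ⟨extendCoeff m f, a1, b1, a2, b2, a3, b3, fun i h0 h1 => ?_⟩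
  have := h i (by omega) (by omega)
  unfold collocationSystem at this
  rwa [if_neg (by omega), if_neg (by omega), if_neg (by omega), if_neg (by omega),
    if_neg (by omega), if_neg (by omega), if_neg (by omega), if_neg (by omega),
    if_neg (by omega)] at this

/-! ### The energy estimate -/

/-- The estimate is implicit in the new energy. For x ≤ 1/2 one has (1 + x)/(1 − x) ≤ 1 + 4x and
1/(1 − x) ≤ 2, which makes it explicit. -/
theorem energy_gronwall {E : ℕ → ℝ} {x y : ℝ} (hx : 0 ≤ x) (hx' : x ≤ 1 / 2) (hy : 0 ≤ y)
    (h0 : E 0 ≤ 0) {n₀ : ℕ}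
    (hE : ∀ n, n + 1 ≤ n₀ → 0 ≤ E n)
    (h : ∀ n, n + 1 ≤ n₀ → E (n + 1) - E n ≤ x * (E (n + 1) + E n) + y) :
    ∀ n, n ≤ n₀ → E n ≤ n * (2 * y) * Real.exp (n * (4 * x)) := by
  have key : ∀ n, n ≤ n₀ → E n ≤ n * (2 * y) * (1 + 4 * x) ^ n := by
    intro n
    induction n with
    | zero => intro _; simpa using h0
    | succ n ih =>
      intro hn
      have h1 := h n hn
      have h2 := ih (by omega)
      have h3 : E (n + 1) ≤ (1 + 4 * x) * E n + 2 * y := by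
        have h4 : (1 - x) * E (n + 1) ≤ (1 - x) * ((1 + 4 * x) * E n + 2 * y) := by
          nlinarith [mul_nonneg (mul_nonneg hx (hE n hn)) (by linarith : 0 ≤ 1 - 2 * x),
            mul_nonneg hy (by linarith : 0 ≤ 1 - 2 * x)]
        exact le_of_mul_le_mul_left h4 (by linarith)
      have h5 : (1 : ℝ) ≤ (1 + 4 * x) ^ (n + 1) := one_le_pow₀ (by linarith)
      calc E (n + 1) ≤ (1 + 4 * x) * E n + 2 * y := h3
        _ ≤ (1 + 4 * x) * (n * (2 * y) * (1 + 4 * x) ^ n) + 2 * y * (1 + 4 * x) ^ (n + 1) := by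
            refine add_le_add (mul_le_mul_of_nonneg_left h2 (by linarith)) ?_
            nlinarith
        _ = _ := by push_cast; ring
  intro n hn
  refine (key n hn).trans (mul_le_mul_of_nonneg_left ?_ (by positivity))
  rw [Real.exp_nat_mul]
  exact pow_le_pow_left₀ (by linarith) (by linarith [Real.add_one_le_exp (4 * x)]) n

section energy

variable {M : Type*} [AddCommGroup M] [Module ℝ M] {B : M →ₗ[ℝ] M →ₗ[ℝ] ℝ}

theorem two_mul_form_le (hs : ∀ x y, B x y = B y x) (hn : ∀ x, 0 ≤ B x x) (x y : M) :
    2 * B x y ≤ B x x + B y y := by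
  have := hn (x - y)
  simp only [map_sub, LinearMap.sub_apply] at this
  linarith [hs x y]

theorem form_add_le (hs : ∀ x y, B x y = B y x) (hn : ∀ x, 0 ≤ B x x) (x y : M) :
    B (x + y) (x + y) ≤ 2 * (B x x + B y y) := by
  have := two_mul_form_le hs hn x y
  simp only [map_add, LinearMap.add_apply]
  linarith [hs x y]

/-- One step of the scheme: the energy balance and its consequence. -/
theorem energy_step (hs : ∀ x y, B x y = B y x) (hn : ∀ x, 0 ≤ B x x)
    {α β γ ν κ σ₀ : ℝ} (hγ : 0 < γ) (hν : 0 < ν) (hκ : 0 ≤ κ)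
    {V₀ V₁ V₂ C₀ C₁ C₂ σ : M} (hcross : B C₂ V₀ = B C₀ V₂)
    (hQ₀ : 0 ≤ -B C₀ V₀) (hQ₁ : 0 ≤ -B C₁ V₁) (hQ₂ : 0 ≤ -B C₂ V₂)
    (hV : B V₁ V₁ ≤ κ * (ν * -B C₁ V₁)) (hσ : B σ σ ≤ σ₀)
    (heq : (1 + α * γ) • V₂ - (γ ^ 2 / 2 * ν) • C₂
      = (2 - (β * γ) ^ 2) • V₁ + (α * γ - 1) • V₀ + (γ ^ 2 / 2 * ν) • C₀ + γ ^ 2 • σ) :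
    (B (V₂ - V₁) (V₂ - V₁) + γ ^ 2 / 2 * ν * (-B C₂ V₂ + -B C₁ V₁))
      - (B (V₁ - V₀) (V₁ - V₀) + γ ^ 2 / 2 * ν * (-B C₁ V₁ + -B C₀ V₀))
      ≤ (2 * |α| + 1 + 2 * κ * β ^ 4) * γ *
        ((B (V₂ - V₁) (V₂ - V₁) + γ ^ 2 / 2 * ν * (-B C₂ V₂ + -B C₁ V₁))
          + (B (V₁ - V₀) (V₁ - V₀) + γ ^ 2 / 2 * ν * (-B C₁ V₁ + -B C₀ V₀))) + γ ^ 3 * σ₀ := by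
  -- The test function. The second difference in time becomes a difference of squares, and `hcross`
  -- cancels the mixed terms of (`C₂` + `C₀`, `V₂` − `V₀`), so the whole principal part telescopes.
  set S := V₂ - V₀ with hS
  have hSS : B S S ≤ 2 * (B (V₂ - V₁) (V₂ - V₁) + B (V₁ - V₀) (V₁ - V₀)) := by
    have := form_add_le hs hn (V₂ - V₁) (V₁ - V₀)
    rwa [sub_add_sub_cancel] at this
  have hbal : (B (V₂ - V₁) (V₂ - V₁) + γ ^ 2 / 2 * ν * (-B C₂ V₂ + -B C₁ V₁))
      - (B (V₁ - V₀) (V₁ - V₀) + γ ^ 2 / 2 * ν * (-B C₁ V₁ + -B C₀ V₀))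
      = -(α * γ) * B S S + γ ^ 2 * (B (σ - β ^ 2 • V₁) S) := by
    have h := congrArg (fun z => B z S) heq
    simp only [hS, map_add, map_sub, map_smul, LinearMap.add_apply, LinearMap.sub_apply,
      LinearMap.smul_apply, smul_eq_mul] at h ⊢
    linear_combination h - (γ ^ 2 / 2 * ν) * hcross - hs V₂ V₁ - hs V₁ V₀
      - (α * γ) * hs V₂ V₀ + (1 + α * γ) * hs V₂ V₀
  -- The zeroth order term is treated as a source; by `hV` it is controlled by the elastic part of
  -- the energy.
  have hY : γ ^ 2 * B (σ - β ^ 2 • V₁) S ≤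
      γ ^ 3 / 2 * B (σ - β ^ 2 • V₁) (σ - β ^ 2 • V₁) + γ / 2 * B S S := by
    have := two_mul_form_le hs hn (γ • (σ - β ^ 2 • V₁)) S
    simp only [map_smul, LinearMap.smul_apply, smul_eq_mul] at this
    nlinarith
  have hW : B (σ - β ^ 2 • V₁) (σ - β ^ 2 • V₁) ≤ 2 * (σ₀ + β ^ 4 * (κ * (ν * -B C₁ V₁))) := by
    have h1 := form_add_le hs hn σ (-(β ^ 2 • V₁))
    rw [← sub_eq_add_neg] at h1
    have h2 : B (-(β ^ 2 • V₁)) (-(β ^ 2 • V₁)) = β ^ 4 * B V₁ V₁ := by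
      simp only [map_neg, LinearMap.neg_apply, map_smul, LinearMap.smul_apply, smul_eq_mul]
      ring
    rw [h2] at h1
    have h3 := mul_le_mul_of_nonneg_left hV (by positivity : 0 ≤ β ^ 4)
    linarith
  rw [hbal]
  have hα : -(α * γ) * B S S ≤ |α| * γ * B S S := by
    refine mul_le_mul_of_nonneg_right ?_ (hn S)
    rw [← neg_mul]
    exact mul_le_mul_of_nonneg_right (neg_le_abs α) hγ.le
  have e0 : 0 ≤ γ ^ 2 / 2 * ν := by positivity
  have q0 := mul_nonneg e0 hQ₀
  have q1 := mul_nonneg e0 hQ₁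
  have q2 := mul_nonneg e0 hQ₂
  have d1 := hn (V₂ - V₁)
  have d0 := hn (V₁ - V₀)
  set d₁ := B (V₂ - V₁) (V₂ - V₁)
  set d₀ := B (V₁ - V₀) (V₁ - V₀)
  have hW' := mul_le_mul_of_nonneg_left hW (by positivity : 0 ≤ γ ^ 3 / 2)
  have hS1 := mul_le_mul_of_nonneg_left hSS (by positivity : 0 ≤ |α| * γ)
  have hS2 := mul_le_mul_of_nonneg_left hSS (by positivity : 0 ≤ γ / 2)
  have a0 : 0 ≤ (2 * |α| + 1) * γ := by positivity
  have k0 : 0 ≤ κ * β ^ 4 * γ := by positivity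
  have t1 := mul_nonneg a0 q0
  have t2 := mul_nonneg a0 q1
  have t3 := mul_nonneg a0 q2
  have s1 := mul_nonneg k0 q0
  have s2 := mul_nonneg k0 q1
  have s3 := mul_nonneg k0 q2
  have s4 := mul_nonneg k0 d0
  have s5 := mul_nonneg k0 d1
  linarith

end energy

/-- Stability of the collocation scheme with homogeneous boundary and initial conditions. -/
theorem collocation_stability {m : ℕ} (hm : 8 ≤ m) {α β γ h ℓ ε τ : ℝ} (hγ : 0 < γ) (hh : 0 < h)
    (hℓ : (m + 1) * h = ℓ)
    (hsmall : (2 * |α| + 1 + 2 * ℓ ^ 2 * β ^ 4) * γ ≤ 1 / 2) {n₀ : ℕ} (hτ : n₀ * γ ≤ τ)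
    {e : ℕ → ℤ → ℝ} (hom : ∀ n ≤ n₀, IsHomogeneous (m + 1) (e n))
    (hz0 : ∀ i : ℤ, 1 ≤ i → i ≤ m → nodeValue (e 0) i = 0)
    (hz1 : 1 ≤ n₀ → ∀ i : ℤ, 1 ≤ i → i ≤ m → nodeValue (e 1) i = 0)
    {σ : ℕ → ℤ → ℝ}
    (hσ : ∀ n, 1 ≤ n → n + 1 ≤ n₀ → ∀ i : ℤ, 1 ≤ i → i ≤ m → |σ n i| ≤ ε)
    (heq : ∀ n, 1 ≤ n → n + 1 ≤ n₀ → ∀ i : ℤ, 1 ≤ i → i ≤ m →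
      (1 + α * γ) * nodeValue (e (n + 1)) i
          - γ ^ 2 / 2 * (20 / h ^ 2) * nodeCurv (e (n + 1)) i
        = (2 - (β * γ) ^ 2) * nodeValue (e n) i + (α * γ - 1) * nodeValue (e (n - 1)) i
          + γ ^ 2 / 2 * (20 / h ^ 2) * nodeCurv (e (n - 1)) i + γ ^ 2 * σ n i) :
    ∀ n ≤ n₀, ∀ i : ℤ, 1 ≤ i → i ≤ m → nodeValue (e n) i ^ 2 ≤
      4 * ℓ ^ 2 * τ * Real.exp (4 * (2 * |α| + 1 + 2 * ℓ ^ 2 * β ^ 4) * τ) * ε ^ 2 := by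
  set V : ℕ → ℤ → ℝ := fun n => interiorPart m (nodeValue (e n)) with hVdef
  set C : ℕ → ℤ → ℝ := fun n => interiorPart m (nodeCurv (e n)) with hCdef
  set B := weightForm m with hB
  set ν := 20 / h ^ 2 with hν
  set K := 2 * |α| + 1 + 2 * ℓ ^ 2 * β ^ 4 with hK
  have hν0 : 0 < ν := by positivity
  have hm0 : (0 : ℝ) < m + 1 := by positivity
  have hBC : ∀ n n', B (C n) (V n') = weightForm m (nodeCurv (e n)) (nodeValue (e n')) := fun n n' =>
    weightForm_congr (fun _ h0 h1 => interiorPart_of_mem h0 h1)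
      (fun _ h0 h1 => interiorPart_of_mem h0 h1)
  have hcoer : ∀ n ≤ n₀, 3 / 5 * (-interiorForm m (dirichletLaplacian m (nodeValue (e n)))
      (nodeValue (e n))) ≤ -B (C n) (V n) := fun n hn => by
    rw [hBC, weightForm_eq]
    exact (hom n hn).stiffness_coercive hm
  have hsob : ∀ n ≤ n₀, ∀ i : ℤ, 1 ≤ i → i ≤ m →
      nodeValue (e n) i ^ 2 ≤ (m + 1) * (5 / 3 * -B (C n) (V n)) := fun n hn i h0 h1 =>
    (sq_le_neg_laplacian m (nodeValue (e n)) h0 h1).trans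
      (mul_le_mul_of_nonneg_left (by linarith [hcoer n hn]) hm0.le)
  have hQ : ∀ n ≤ n₀, 0 ≤ -B (C n) (V n) := fun n hn => by
    linarith [hcoer n hn, (isDiscreteLaplacian m).nonpos (nodeValue (e n))]
  -- A Poincaré inequality whose constant depends only on the length of the interval: the m(m + 1)
  -- from summing the Sobolev bound is absorbed by 1/h² in `ν`.
  have hBV : ∀ n ≤ n₀, B (V n) (V n) ≤ ℓ ^ 2 * (ν * -B (C n) (V n)) := fun n hn => by
    have h1 : interiorForm m (V n) (V n) ≤ m * ((m + 1) * (5 / 3 * -B (C n) (V n))) := by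
      rw [hVdef, interiorForm_interiorPart]
      exact interiorForm_self_le (hsob n hn)
    have h2 := weightForm_le m (V n)
    have h3 : ℓ ^ 2 * (ν * -B (C n) (V n)) = 20 * (m + 1) ^ 2 * -B (C n) (V n) := by
      rw [← hℓ, hν]
      field_simp
    rw [h3]
    have h4 := hQ n hn
    nlinarith
  have hs0 : ∀ z : ℤ → ℝ, interiorPart m z = 0 ↔ ∀ i : ℤ, 1 ≤ i → i ≤ m → z i = 0 := fun z => by
    constructor
    · intro hz i h0 h1
      rw [← interiorPart_of_mem h0 h1 (x := z), hz, Pi.zero_apply]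
    · intro hz
      funext i
      unfold interiorPart
      split_ifs with hi
      · exact hz i hi.1 hi.2
      · rfl
  have hV0 : V 0 = 0 := (hs0 _).2 hz0
  have hB0 : ∀ n x, V n = 0 → B x (V n) = 0 := fun n x hn => by rw [hn, map_zero]
  set E : ℕ → ℝ := fun n => B (V (n + 1) - V n) (V (n + 1) - V n)
    + γ ^ 2 / 2 * ν * (-B (C (n + 1)) (V (n + 1)) + -B (C n) (V n)) with hE
  intro n hn i h0 h1
  have hτ0 : 0 ≤ τ := le_trans (by positivity) hτ
  rcases n with _ | n
  · rw [hz0 i h0 h1, zero_pow two_ne_zero]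
    positivity
  have hV1 : V 1 = 0 := (hs0 _).2 (hz1 (by omega))
  have hE0 : E 0 ≤ 0 := by
    simp only [hE, zero_add]
    rw [hB0 0 _ hV0, hB0 1 _ hV1, hV0, hV1]
    simp
  have hEn : ∀ k, k + 1 ≤ n₀ → 0 ≤ E k := fun k hk => by
    have h1 := hQ (k + 1) hk
    have h2 := hQ k (by omega)
    exact add_nonneg (weightForm_nonneg m _) (mul_nonneg (by positivity) (by linarith))
  -- The energy with index k involves levels k and k + 1, so a step between energies uses three
  -- levels and the last index is n₀ − 1.
  have hstep : ∀ k, k + 1 ≤ n₀ - 1 →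
      E (k + 1) - E k ≤ K * γ * (E (k + 1) + E k) + γ ^ 3 * (12 * (m * ε ^ 2)) := by
    intro k hk
    refine energy_step (C₀ := C k) (C₁ := C (k + 1)) (C₂ := C (k + 2)) (V₀ := V k)
      (σ := interiorPart m (σ (k + 1)))
      (weightForm_comm m) (weightForm_nonneg m) hγ hν0 (sq_nonneg ℓ) ?_ (hQ k (by omega))
      (hQ (k + 1) (by omega)) (hQ (k + 2) (by omega)) (hBV (k + 1) (by omega)) ?_ ?_
    · rw [hBC, hBC, weightForm_eq, weightForm_eq]
      exact (hom k (by omega)).stiffness_symm (by omega) (hom (k + 2) (by omega))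
    · refine (weightForm_le m _).trans ?_
      rw [interiorForm_interiorPart]
      refine mul_le_mul_of_nonneg_left (interiorForm_self_le fun j h0 h1 => ?_) (by norm_num)
      have := hσ (k + 1) (by omega) (by omega) j h0 h1
      rw [← sq_abs]
      exact pow_le_pow_left₀ (abs_nonneg _) this 2
    · funext j
      simp only [Pi.add_apply, Pi.sub_apply, Pi.smul_apply, smul_eq_mul, hVdef, hCdef]
      by_cases hj : 1 ≤ j ∧ j ≤ m
      · simp only [interiorPart_of_mem hj.1 hj.2]
        have := heq (k + 1) (by omega) (by omega) j hj.1 hj.2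
        simpa using this
      · simp only [interiorPart_of_notMem (m := m) (i := j) (by omega)]
        ring
  have hgr := energy_gronwall (by positivity) hsmall (by positivity) hE0
    (fun k hk => hEn k (by omega)) hstep n (by omega)
  have hQn : γ ^ 2 / 2 * ν * -B (C (n + 1)) (V (n + 1)) ≤ E n := by
    have h1 := weightForm_nonneg m (V (n + 1) - V n)
    have h2 := mul_nonneg (by positivity : 0 ≤ γ ^ 2 / 2 * ν) (hQ n (by omega))
    simp only [hE]
    linarith
  have hnτ : n * γ ≤ τ := by
    refine le_trans (mul_le_mul_of_nonneg_right ?_ hγ.le) hτ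
    exact_mod_cast (by omega : n ≤ n₀)
  have hexp : Real.exp (n * (4 * (K * γ))) ≤ Real.exp (4 * K * τ) := by
    rw [Real.exp_le_exp]
    have hK0 : 0 ≤ K := by positivity
    nlinarith
  set X := Real.exp (4 * K * τ) with hX
  have hX0 : 0 < X := Real.exp_pos _
  have hfin : γ ^ 2 / 2 * ν * -B (C (n + 1)) (V (n + 1))
      ≤ γ ^ 2 / 2 * (48 * τ * m * ε ^ 2 * X) := by
    calc γ ^ 2 / 2 * ν * -B (C (n + 1)) (V (n + 1)) ≤ E n := hQn
      _ ≤ n * (2 * (γ ^ 3 * (12 * (m * ε ^ 2)))) * Real.exp (n * (4 * (K * γ))) := hgr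
      _ ≤ n * (2 * (γ ^ 3 * (12 * (m * ε ^ 2)))) * X :=
          mul_le_mul_of_nonneg_left hexp (by positivity)
      -- One factor `γ` of the cubic source term is spent on summing over the time steps; the other
      -- two match the γ² in front of the elastic energy.
      _ = (n * γ) * (24 * γ ^ 2 * m * ε ^ 2 * X) := by ring
      _ ≤ τ * (24 * γ ^ 2 * m * ε ^ 2 * X) := mul_le_mul_of_nonneg_right hnτ (by positivity)
      _ = _ := by ring
  have hfin' : ν * -B (C (n + 1)) (V (n + 1)) ≤ 48 * τ * m * ε ^ 2 * X := by
    rw [mul_assoc] at hfin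
    exact le_of_mul_le_mul_left hfin (by positivity)
  calc nodeValue (e (n + 1)) i ^ 2 ≤ (m + 1) * (5 / 3 * -B (C (n + 1)) (V (n + 1))) :=
        hsob (n + 1) hn i h0 h1
    _ = (m + 1) * h ^ 2 / 12 * (ν * -B (C (n + 1)) (V (n + 1))) := by
        rw [hν]; field_simp; ring
    _ ≤ (m + 1) * h ^ 2 / 12 * (48 * τ * (m + 1) * ε ^ 2 * X) := by
        refine mul_le_mul_of_nonneg_left (hfin'.trans ?_) (by positivity)
        have : (m : ℝ) ≤ m + 1 := by linarith
        gcongr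
    _ = 4 * ((m + 1) * h) ^ 2 * τ * X * ε ^ 2 := by ring
    _ = _ := by rw [hℓ]

/-! ### Extension to the line and Taylor's formula -/

/-- A function of class `Cⁿ` on `[a, b]` extends to the line together with its derivatives, in such
a way that the bound for the last one is preserved. -/
theorem exists_extension {a b : ℝ} (hab : a < b) (n : ℕ) :
    ∀ {φ : ℝ → ℝ} {K : ℝ}, ContDiffOn ℝ n φ (Icc a b) →
    (∀ x ∈ Icc a b, |iteratedDerivWithin n φ (Icc a b) x| ≤ K) →
    ∃ G : ℕ → ℝ → ℝ, Continuous (G 0) ∧ (∀ m < n, ∀ x, HasDerivAt (G m) (G (m + 1) x) x) ∧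
      (∀ m ≤ n, ∀ x ∈ Icc a b, G m x = iteratedDerivWithin m φ (Icc a b) x) ∧
      ∀ x, |G n x| ≤ K := by
  induction n with
  | zero =>
    intro φ K hφ hK
    have hc : ContinuousOn φ (Icc a b) := hφ.continuousOn
    -- The highest derivative is continued by its end values, which keeps its bound; the lower ones
    -- are recovered by integration in the induction step.
    refine ⟨fun _ => IccExtend hab.le ((Icc a b).domRestrict φ), hc.domRestrict.Icc_extend', ?_, ?_, ?_⟩
    · intro m hm
      omega
    · intro m hm x hx
      obtain rfl : m = 0 := by omega
      rw [iteratedDerivWithin_zero]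
      exact IccExtend_of_mem _ _ hx
    · intro x
      have := hK (projIcc a b hab.le x) (projIcc a b hab.le x).2
      rw [iteratedDerivWithin_zero] at this
      exact this
  | succ n ih =>
    intro φ K hφ hK
    have hu := uniqueDiffOn_Icc hab
    have hψ : ContDiffOn ℝ n (derivWithin φ (Icc a b)) (Icc a b) :=
      hφ.derivWithin hu (by push_cast; exact le_rfl)
    obtain ⟨G, hG0, hG1, hG2, hG3⟩ := ih hψ (fun x hx => by
      rw [← iteratedDerivWithin_succ']
      exact hK x hx)
    set F : ℝ → ℝ := fun x => φ a + ∫ y in a..x, G 0 y with hF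
    have hFd : ∀ x, HasDerivAt F (G 0 x) x := fun x =>
      ((hG0.integral_hasStrictDerivAt a x).hasDerivAt).const_add (φ a)
    refine ⟨fun m => Nat.casesOn m F G, ?_, ?_, ?_, ?_⟩
    · exact continuous_iff_continuousAt.2 fun x => (hFd x).continuousAt
    · intro m hm x
      rcases m with _ | m
      · exact hFd x
      · exact hG1 m (by omega) x
    · intro m hm x hx
      rcases m with _ | m
      · rw [iteratedDerivWithin_zero]
        refine eq_of_derivWithin_eq (fun y _ => (hFd y).differentiableAt.differentiableWithinAt)
          (hφ.differentiableOn (by simp)) ?_ (by simp [hF]) x hx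
        intro y hy
        have hy' := Ico_subset_Icc_self hy
        rw [(hFd y).hasDerivWithinAt.derivWithin (hu y hy'), hG2 0 (by omega) y hy',
          iteratedDerivWithin_zero]
      · rw [iteratedDerivWithin_succ']
        exact hG2 m (by omega) x hx
    · exact hG3

/-- Taylor's formula on the line, with a crude remainder. -/
theorem abs_taylor_remainder_le {K : ℝ} (n : ℕ) : ∀ {G : ℕ → ℝ → ℝ},
    (∀ m < n, ∀ x, HasDerivAt (G m) (G (m + 1) x) x) → (∀ x, |G n x| ≤ K) → ∀ x y : ℝ,
    |G 0 y - ∑ m ∈ Finset.range n, G m x / m.factorial * (y - x) ^ m| ≤ K * |y - x| ^ n := by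
  induction n with
  | zero =>
    intro G _ hK x y
    simpa using hK y
  | succ n ih =>
    intro G hG hK x y
    have hK0 : 0 ≤ K := (abs_nonneg _).trans (hK 0)
    have hder : ∀ z, HasDerivAt
        (fun z => G 0 z - ∑ m ∈ Finset.range (n + 1), G m x / m.factorial * (z - x) ^ m)
        (G 1 z - ∑ m ∈ Finset.range n, G (m + 1) x / m.factorial * (z - x) ^ m) z := by
      intro z
      refine (hG 0 (by omega) z).sub ?_
      have hs : ∀ m ∈ Finset.range (n + 1), HasDerivAt
          (fun z : ℝ => G m x / m.factorial * (z - x) ^ m)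
          (G m x / m.factorial * (m * (z - x) ^ (m - 1))) z := fun m _ => by
        have := (((hasDerivAt_id z).sub_const x).pow m).const_mul (G m x / m.factorial)
        simpa using this
      refine (HasDerivAt.fun_sum hs).congr_deriv ?_
      rw [Finset.sum_range_succ']
      simp only [Nat.cast_zero, zero_mul, mul_zero, add_zero]
      refine Finset.sum_congr rfl fun m _ => ?_
      rw [Nat.factorial_succ]
      push_cast
      have h1 : (m.factorial : ℝ) ≠ 0 := by positivity
      have h2 : (m : ℝ) + 1 ≠ 0 := by positivity
      field_simp
    have hb : ∀ z ∈ uIcc x y,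
        ‖G 1 z - ∑ m ∈ Finset.range n, G (m + 1) x / m.factorial * (z - x) ^ m‖
          ≤ K * |y - x| ^ n := fun z hz => by
      refine (ih (G := fun m => G (m + 1)) (fun m hm => hG (m + 1) (by omega)) hK x z).trans ?_
      exact mul_le_mul_of_nonneg_left
        (pow_le_pow_left₀ (abs_nonneg _) (abs_sub_left_of_mem_uIcc hz) n) hK0
    have := Convex.norm_image_sub_le_of_norm_hasDerivWithin_le
      (fun z _ => (hder z).hasDerivWithinAt) hb (convex_uIcc x y) left_mem_uIcc right_mem_uIcc
    have h0 : ∑ m ∈ Finset.range (n + 1), G m x / m.factorial * (x - x) ^ m = G 0 x := by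
      rw [Finset.sum_range_succ']
      simp
    rw [h0, sub_self, sub_zero, Real.norm_eq_abs, Real.norm_eq_abs] at this
    rw [pow_succ, ← mul_assoc]
    exact this

/-- Third order Taylor formula on an interval. -/
theorem abs_taylor_three_le {a b K : ℝ} (hab : a < b) {φ : ℝ → ℝ} (hφ : ContDiffOn ℝ 3 φ (Icc a b))
    (hK : ∀ x ∈ Icc a b, |iteratedDerivWithin 3 φ (Icc a b) x| ≤ K) {x y : ℝ} (hx : x ∈ Icc a b)
    (hy : y ∈ Icc a b) :
    |φ y - (φ x + derivWithin φ (Icc a b) x * (y - x)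
      + iteratedDerivWithin 2 φ (Icc a b) x / 2 * (y - x) ^ 2)| ≤ K * |y - x| ^ 3 := by
  obtain ⟨G, -, hG, hGφ, hGK⟩ := exists_extension hab 3 (by exact_mod_cast hφ) hK
  have := abs_taylor_remainder_le 3 hG hGK x y
  simp only [Finset.sum_range_succ, Finset.sum_range_zero] at this
  rw [hGφ 0 (by omega) y hy, hGφ 0 (by omega) x hx, hGφ 1 (by omega) x hx,
    hGφ 2 (by omega) x hx] at this
  simpa [Nat.factorial, iteratedDerivWithin_one] using this

/-- Fourth order Taylor formula at the points of an interval, for an extension to the line. -/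
theorem exists_extension_taylor_four {a b K : ℝ} (hab : a < b) {φ : ℝ → ℝ}
    (hφ : ContDiffOn ℝ 4 φ (Icc a b))
    (hK : ∀ x ∈ Icc a b, |iteratedDerivWithin 4 φ (Icc a b) x| ≤ K) :
    ∃ g : ℝ → ℝ, (∀ x ∈ Icc a b, g x = φ x) ∧ ∀ x ∈ Icc a b, ∀ y,
      |g y - (φ x + derivWithin φ (Icc a b) x * (y - x)
        + iteratedDerivWithin 2 φ (Icc a b) x / 2 * (y - x) ^ 2
        + iteratedDerivWithin 3 φ (Icc a b) x / 6 * (y - x) ^ 3)| ≤ K * |y - x| ^ 4 := by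
  obtain ⟨G, -, hG, hGφ, hGK⟩ := exists_extension hab 4 (by exact_mod_cast hφ) hK
  refine ⟨G 0, fun x hx => by rw [hGφ 0 (by omega) x hx, iteratedDerivWithin_zero],
    fun x hx y => ?_⟩
  have := abs_taylor_remainder_le 4 hG hGK x y
  simp only [Finset.sum_range_succ, Finset.sum_range_zero] at this
  rw [hGφ 0 (by omega) x hx, hGφ 1 (by omega) x hx, hGφ 2 (by omega) x hx,
    hGφ 3 (by omega) x hx] at this
  simpa [Nat.factorial, iteratedDerivWithin_one] using this

/-- The fourth derivative is bounded in terms of the third and the fifth. -/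
theorem abs_fourth_deriv_le {a b K L : ℝ} (hab : a < b) {φ : ℝ → ℝ}
    (hφ : ContDiffOn ℝ 5 φ (Icc a b))
    (hK : ∀ x ∈ Icc a b, |iteratedDerivWithin 3 φ (Icc a b) x| ≤ K)
    (hL : ∀ x ∈ Icc a b, |iteratedDerivWithin 5 φ (Icc a b) x| ≤ L) :
    ∀ x ∈ Icc a b, |iteratedDerivWithin 4 φ (Icc a b) x| ≤ 2 * K / (b - a) + L * (b - a) := by
  obtain ⟨G, -, hG, hGφ, hGL⟩ := exists_extension hab 5 (by exact_mod_cast hφ) hL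
  have hba : 0 < b - a := by linarith
  have hL0 : 0 ≤ L := (abs_nonneg _).trans (hGL 0)
  -- The mean value theorem gives one point where the fourth derivative is controlled by the third;
  -- the bound on the fifth carries this to the whole interval.
  obtain ⟨ξ, hξ, he⟩ := exists_hasDerivAt_eq_slope (G 3) (G 4) hab
    (fun x _ => (hG 3 (by omega) x).continuousAt.continuousWithinAt)
    (fun x _ => hG 3 (by omega) x)
  have hξ4 : |G 4 ξ| ≤ 2 * K / (b - a) := by
    rw [he, abs_div, abs_of_pos hba, hGφ 3 (by omega) b (right_mem_Icc.2 hab.le),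
      hGφ 3 (by omega) a (left_mem_Icc.2 hab.le)]
    gcongr
    have h1 := hK b (right_mem_Icc.2 hab.le)
    have h2 := hK a (left_mem_Icc.2 hab.le)
    rw [abs_le] at *
    constructor <;> linarith [h1.1, h1.2, h2.1, h2.2]
  intro x hx
  rw [← hGφ 4 (by omega) x hx]
  have hlip := Convex.norm_image_sub_le_of_norm_hasDerivWithin_le (s := univ)
    (fun z _ => (hG 4 (by omega) z).hasDerivWithinAt) (fun z _ => hGL z) convex_univ
    (mem_univ ξ) (mem_univ x)
  rw [Real.norm_eq_abs, Real.norm_eq_abs] at hlip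
  have hd : |x - ξ| ≤ b - a := by
    rw [abs_le]
    constructor <;> linarith [hx.1, hx.2, hξ.1, hξ.2]
  have := abs_sub_abs_le_abs_sub (G 4 x) (G 4 ξ)
  nlinarith [mul_le_mul_of_nonneg_left hd hL0]

/-! ### Partial derivatives on a rectangle -/

section partialDeriv

variable {a b T : ℝ} {F : ℝ × ℝ → ℝ}

theorem exists_partial_space (hab : a < b) (hT : 0 < T) (n : ℕ)
    (hF : ContDiffOn ℝ (n + 1) F (Icc a b ×ˢ Icc 0 T)) : ∃ F' : ℝ × ℝ → ℝ,
      ContDiffOn ℝ n F' (Icc a b ×ˢ Icc 0 T) ∧ ∀ x ∈ Icc a b, ∀ t ∈ Icc 0 T,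
        HasDerivWithinAt (fun y => F (y, t)) (F' (x, t)) (Icc a b) x := by
  have hu : UniqueDiffOn ℝ (Icc a b ×ˢ Icc 0 T) :=
    (uniqueDiffOn_Icc hab).prod (uniqueDiffOn_Icc hT)
  refine ⟨fun p => fderivWithin ℝ F (Icc a b ×ˢ Icc 0 T) p (1, 0),
    (hF.fderivWithin hu le_rfl).clm_apply contDiffOn_const, fun x hx t ht => ?_⟩
  have hd := (hF.differentiableOn (by simp) (x, t) (mk_mem_prod hx ht)).hasFDerivWithinAt
  have hg : HasDerivWithinAt (fun y : ℝ => (y, t)) ((1 : ℝ), (0 : ℝ)) (Icc a b) x :=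
    (hasDerivWithinAt_id x _).prodMk (hasDerivWithinAt_const _ _ _)
  exact HasFDerivWithinAt.comp_hasDerivWithinAt (f := fun y : ℝ => (y, t)) x hd hg
    fun y hy => mk_mem_prod hy ht

theorem exists_partial_time (hab : a < b) (hT : 0 < T) (n : ℕ)
    (hF : ContDiffOn ℝ (n + 1) F (Icc a b ×ˢ Icc 0 T)) : ∃ F' : ℝ × ℝ → ℝ,
      ContDiffOn ℝ n F' (Icc a b ×ˢ Icc 0 T) ∧ ∀ x ∈ Icc a b, ∀ t ∈ Icc 0 T,
        HasDerivWithinAt (fun s => F (x, s)) (F' (x, t)) (Icc 0 T) t := by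
  have hu : UniqueDiffOn ℝ (Icc a b ×ˢ Icc 0 T) :=
    (uniqueDiffOn_Icc hab).prod (uniqueDiffOn_Icc hT)
  refine ⟨fun p => fderivWithin ℝ F (Icc a b ×ˢ Icc 0 T) p (0, 1),
    (hF.fderivWithin hu le_rfl).clm_apply contDiffOn_const, fun x hx t ht => ?_⟩
  have hd := (hF.differentiableOn (by simp) (x, t) (mk_mem_prod hx ht)).hasFDerivWithinAt
  have hg : HasDerivWithinAt (fun s : ℝ => (x, s)) ((0 : ℝ), (1 : ℝ)) (Icc 0 T) t :=
    (hasDerivWithinAt_const _ _ _).prodMk (hasDerivWithinAt_id t _)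
  exact HasFDerivWithinAt.comp_hasDerivWithinAt (f := fun s : ℝ => (x, s)) t hd hg
    fun s hs => mk_mem_prod hx hs

theorem exists_abs_le_of_continuousOn_rectangle
    (hF : ContinuousOn F (Icc a b ×ˢ Icc 0 T)) :
    ∃ K, 0 ≤ K ∧ ∀ x ∈ Icc a b, ∀ t ∈ Icc 0 T, |F (x, t)| ≤ K := by
  obtain ⟨K, hK⟩ := (isCompact_Icc.prod isCompact_Icc).exists_bound_of_continuousOn hF
  exact ⟨max K 0, le_max_right _ _, fun x hx t ht =>
    (hK (x, t) (mk_mem_prod hx ht)).trans (le_max_left _ _)⟩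

end partialDeriv

theorem iteratedDerivWithin_succ_eq {s : Set ℝ} (hs : UniqueDiffOn ℝ s) {n : ℕ} {φ g g' : ℝ → ℝ}
    (h : ∀ x ∈ s, iteratedDerivWithin n φ s x = g x)
    (hg : ∀ x ∈ s, HasDerivWithinAt g (g' x) s x) :
    ∀ x ∈ s, iteratedDerivWithin (n + 1) φ s x = g' x := fun x hx => by
  rw [iteratedDerivWithin_succ, derivWithin_congr (fun y hy => h y hy) (h x hx)]
  exact (hg x hx).derivWithin (hs x hx)

/-- The bounds for a smooth function on a rectangle which the consistency analysis uses. -/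
structure DerivBounds (a b T : ℝ) (u : ℝ → ℝ → ℝ) (K : ℝ) : Prop where
  nonneg : 0 ≤ K
  velocity : ∀ x ∈ Icc a b, ∀ t ∈ Icc 0 T, |derivWithin (fun s => u x s) (Icc 0 T) t| ≤ K
  acceleration : ∀ x ∈ Icc a b, ∀ t ∈ Icc 0 T,
    |iteratedDerivWithin 2 (fun s => u x s) (Icc 0 T) t| ≤ K
  time_taylor : ∀ x ∈ Icc a b, ∀ t ∈ Icc 0 T, ∀ s ∈ Icc 0 T,
    |u x s - (u x t + derivWithin (fun s => u x s) (Icc 0 T) t * (s - t)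
      + iteratedDerivWithin 2 (fun s => u x s) (Icc 0 T) t / 2 * (s - t) ^ 2)| ≤ K * |s - t| ^ 3
  curvature : ∀ x ∈ Icc a b, ∀ t ∈ Icc 0 T,
    |iteratedDerivWithin 2 (fun y => u y t) (Icc a b) x| ≤ K
  curvature_lipschitz : ∀ x ∈ Icc a b, ∀ t ∈ Icc 0 T, ∀ s ∈ Icc 0 T,
    |iteratedDerivWithin 2 (fun y => u y s) (Icc a b) x
      - iteratedDerivWithin 2 (fun y => u y t) (Icc a b) x| ≤ K * |s - t|
  third : ∀ x ∈ Icc a b, ∀ t ∈ Icc 0 T,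
    |iteratedDerivWithin 3 (fun y => u y t) (Icc a b) x| ≤ K
  space_taylor : ∀ t ∈ Icc 0 T, ∃ g : ℝ → ℝ, (∀ x ∈ Icc a b, g x = u x t) ∧
    ∀ x ∈ Icc a b, ∀ y, |g y - (u x t + derivWithin (fun y => u y t) (Icc a b) x * (y - x)
        + iteratedDerivWithin 2 (fun y => u y t) (Icc a b) x / 2 * (y - x) ^ 2
        + iteratedDerivWithin 3 (fun y => u y t) (Icc a b) x / 6 * (y - x) ^ 3)|
      ≤ K * |y - x| ^ 4

theorem exists_derivBounds {a b T L : ℝ} (hab : a < b) (hT : 0 < T) {u : ℝ → ℝ → ℝ}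
    (hu_joint : ContDiffOn ℝ 3 (fun p : ℝ × ℝ => u p.1 p.2) (Icc a b ×ˢ Icc 0 T))
    (hu_space : ∀ t ∈ Icc 0 T, ContDiffOn ℝ 5 (fun x => u x t) (Icc a b))
    (hL : ∀ t ∈ Icc 0 T, ∀ x ∈ Icc a b,
      |iteratedDerivWithin 5 (fun y => u y t) (Icc a b) x| ≤ L) :
    ∃ K, DerivBounds a b T u K := by
  have hux := uniqueDiffOn_Icc hab
  have hut := uniqueDiffOn_Icc hT
  obtain ⟨ut, hut1, dut⟩ := exists_partial_time hab hT 2 (by exact_mod_cast hu_joint)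
  obtain ⟨utt, hut2, dutt⟩ := exists_partial_time hab hT 1 (by exact_mod_cast hut1)
  obtain ⟨uttt, hut3, duttt⟩ := exists_partial_time hab hT 0 (by exact_mod_cast hut2)
  obtain ⟨ux, hux1, dux⟩ := exists_partial_space hab hT 2 (by exact_mod_cast hu_joint)
  obtain ⟨uxx, hux2, duxx⟩ := exists_partial_space hab hT 1 (by exact_mod_cast hux1)
  obtain ⟨uxxx, hux3, duxxx⟩ := exists_partial_space hab hT 0 (by exact_mod_cast hux2)
  obtain ⟨uxxt, hxxt, duxxt⟩ := exists_partial_time hab hT 0 (by exact_mod_cast hux2)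
  obtain ⟨K1, hK1, k1⟩ := exists_abs_le_of_continuousOn_rectangle hut1.continuousOn
  obtain ⟨K2, hK2, k2⟩ := exists_abs_le_of_continuousOn_rectangle hut2.continuousOn
  obtain ⟨K3, hK3, k3⟩ := exists_abs_le_of_continuousOn_rectangle hut3.continuousOn
  obtain ⟨K4, hK4, k4⟩ := exists_abs_le_of_continuousOn_rectangle hux2.continuousOn
  obtain ⟨K5, hK5, k5⟩ := exists_abs_le_of_continuousOn_rectangle hux3.continuousOn
  obtain ⟨K6, hK6, k6⟩ := exists_abs_le_of_continuousOn_rectangle hxxt.continuousOn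
  have et1 : ∀ x ∈ Icc a b, ∀ t ∈ Icc 0 T,
      iteratedDerivWithin 1 (fun s => u x s) (Icc 0 T) t = ut (x, t) := fun x hx =>
    iteratedDerivWithin_succ_eq hut (fun t _ => by rw [iteratedDerivWithin_zero]) (dut x hx)
  have et2 : ∀ x ∈ Icc a b, ∀ t ∈ Icc 0 T,
      iteratedDerivWithin 2 (fun s => u x s) (Icc 0 T) t = utt (x, t) := fun x hx =>
    iteratedDerivWithin_succ_eq hut (et1 x hx) (dutt x hx)
  have et3 : ∀ x ∈ Icc a b, ∀ t ∈ Icc 0 T,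
      iteratedDerivWithin 3 (fun s => u x s) (Icc 0 T) t = uttt (x, t) := fun x hx =>
    iteratedDerivWithin_succ_eq hut (et2 x hx) (duttt x hx)
  have ex1 : ∀ t ∈ Icc 0 T, ∀ x ∈ Icc a b,
      iteratedDerivWithin 1 (fun y => u y t) (Icc a b) x = ux (x, t) := fun t ht =>
    iteratedDerivWithin_succ_eq hux (fun t _ => by rw [iteratedDerivWithin_zero])
      (fun x hx => dux x hx t ht)
  have ex2 : ∀ t ∈ Icc 0 T, ∀ x ∈ Icc a b,
      iteratedDerivWithin 2 (fun y => u y t) (Icc a b) x = uxx (x, t) := fun t ht =>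
    iteratedDerivWithin_succ_eq hux (ex1 t ht) (fun x hx => duxx x hx t ht)
  have ex3 : ∀ t ∈ Icc 0 T, ∀ x ∈ Icc a b,
      iteratedDerivWithin 3 (fun y => u y t) (Icc a b) x = uxxx (x, t) := fun t ht =>
    iteratedDerivWithin_succ_eq hux (ex2 t ht) (fun x hx => duxxx x hx t ht)
  have hL0 : 0 ≤ L := (abs_nonneg _).trans
    (hL 0 (left_mem_Icc.2 hT.le) a (left_mem_Icc.2 hab.le))
  have hba : 0 < b - a := by linarith
  set K7 := 2 * K5 / (b - a) + L * (b - a) with hK7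
  have hK7' : 0 ≤ K7 := by positivity
  set K := K1 + K2 + K3 + K4 + K5 + K6 + K7 with hK
  have hsec : ∀ x ∈ Icc a b, ContDiffOn ℝ 3 (fun s => u x s) (Icc 0 T) := fun x hx =>
    hu_joint.comp (f := fun s : ℝ => (x, s)) (by fun_prop) fun s hs => mk_mem_prod hx hs
  refine ⟨K, by positivity, fun x hx t ht => ?_, fun x hx t ht => ?_, fun x hx t ht s hs => ?_, fun x hx t ht => ?_,
    fun x hx t ht s hs => ?_, fun x hx t ht => ?_, fun t ht => ?_⟩
  · rw [← iteratedDerivWithin_one, et1 x hx t ht]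
    exact (k1 x hx t ht).trans (by linarith)
  · rw [et2 x hx t ht]
    exact (k2 x hx t ht).trans (by linarith)
  · refine abs_taylor_three_le hT (hsec x hx) (fun t ht => ?_) ht hs
    rw [et3 x hx t ht]
    exact (k3 x hx t ht).trans (by linarith)
  · rw [ex2 t ht x hx]
    exact (k4 x hx t ht).trans (by linarith)
  · rw [ex2 t ht x hx, ex2 s hs x hx]
    refine (Convex.norm_image_sub_le_of_norm_hasDerivWithin_le (duxxt x hx) (k6 x hx)
      (convex_Icc 0 T) ht hs).trans ?_
    rw [Real.norm_eq_abs]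
    exact mul_le_mul_of_nonneg_right (by linarith) (abs_nonneg _)
  · rw [ex3 t ht x hx]
    exact (k5 x hx t ht).trans (by linarith)
  · refine exists_extension_taylor_four hab ((hu_space t ht).of_le (by norm_num)) fun x hx => ?_
    -- Joint smoothness stops at order three and the higher space regularity is separate for each t,
    -- so a fourth derivative bound uniform in t has to come from the third and the fifth.
    refine (abs_fourth_deriv_le (K := K5) hab (hu_space t ht) (fun x hx => ?_) (hL t ht) x
      hx).trans (by linarith)
    rw [ex3 t ht x hx]
    exact k5 x hx t ht

/-! ### The quasi-interpolant -/

/-- The coefficients `(1 - δ²/4) g / 120` of a quasi-interpolating spline. -/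
noncomputable def quasiCoeff (g : ℤ → ℝ) (j : ℤ) : ℝ := (6 * g j - g (j - 1) - g (j + 1)) / 480

/-- The product (120 + 30δ² + δ⁴)(1 − δ²/4)/120 has no δ² term and δ⁴ annihilates cubics, so values
are reproduced on cubics; the slope and curvature stencils are exact there as well. -/
theorem quasiCoeff_node {g : ℤ → ℝ} {i : ℤ} {A₀ A₁ A₂ A₃ η : ℝ}
    (hg : ∀ n : ℤ, |n| ≤ 3 → |g (i + n) - (A₀ + A₁ * n + A₂ * n ^ 2 + A₃ * n ^ 3)| ≤ η) :
    |nodeValue (quasiCoeff g) i - A₀| ≤ 2 * η ∧ |nodeSlope (quasiCoeff g) i - A₁ / 5| ≤ 2 * η ∧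
      |nodeCurv (quasiCoeff g) i - A₂ / 10| ≤ 2 * η := by
  obtain ⟨l1, r1⟩ := abs_le.1 (hg (-3) (by norm_num))
  obtain ⟨l2, r2⟩ := abs_le.1 (hg (-2) (by norm_num))
  obtain ⟨l3, r3⟩ := abs_le.1 (hg (-1) (by norm_num))
  obtain ⟨l4, r4⟩ := abs_le.1 (hg 0 (by norm_num))
  obtain ⟨l5, r5⟩ := abs_le.1 (hg 1 (by norm_num))
  obtain ⟨l6, r6⟩ := abs_le.1 (hg 2 (by norm_num))
  obtain ⟨l7, r7⟩ := abs_le.1 (hg 3 (by norm_num))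
  push_cast at l1 r1 l2 r2 l3 r3 l4 r4 l5 r5 l6 r6 l7 r7
  rw [← sub_eq_add_neg] at l1 r1 l2 r2 l3 r3
  rw [add_zero] at l4 r4
  unfold nodeValue nodeSlope nodeCurv quasiCoeff
  rw [show i - 2 - 1 = i - 3 by ring, show i - 2 + 1 = i - 1 by ring,
    show i - 1 - 1 = i - 2 by ring, show i - 1 + 1 = i by ring, show i + 1 - 1 = i by ring,
    show i + 1 + 1 = i + 2 by ring, show i + 2 - 1 = i + 1 by ring,
    show i + 2 + 1 = i + 3 by ring]
  simp only [abs_le]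
  refine ⟨⟨?_, ?_⟩, ⟨?_, ?_⟩, ⟨?_, ?_⟩⟩ <;> linarith

section

variable {a b T K : ℝ} {u : ℝ → ℝ → ℝ}

/-- The coefficients are built from the extension of u to the line, because they read knots outside
[a, b]. Exactness on cubics gives fourth order node data. The linear comparison has the slope of u
and costs only h², the final order of accuracy. -/
theorem exists_quasiInterpolant (hu : DerivBounds a b T u K) (hab : a < b) {N : ℕ} (hN : 1 ≤ N)
    (hh1 : (b - a) / N ≤ 1) {t : ℝ} (ht : t ∈ Icc 0 T) : ∃ q : ℤ → ℝ,
      (∀ i : ℤ, 0 ≤ i → i ≤ N → |nodeValue q i - u (knot a b N i) t| ≤ 162 * K * ((b - a) / N) ^ 4 ∧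
        |nodeSlope q i - (b - a) / N / 5 * derivWithin (fun y => u y t) (Icc a b) (knot a b N i)|
          ≤ 162 * K * ((b - a) / N) ^ 4 ∧
        |nodeCurv q i - ((b - a) / N) ^ 2 / 20 *
          iteratedDerivWithin 2 (fun y => u y t) (Icc a b) (knot a b N i)|
          ≤ 162 * K * ((b - a) / N) ^ 4) ∧
      ∀ x ∈ Icc a b, ∃ B : ℝ, ∀ j : ℤ, |j - (x - a) / ((b - a) / N)| ≤ 3 →
        |q j - (u x t + B * (j - (x - a) / ((b - a) / N))) / 120| ≤ 5 * K * ((b - a) / N) ^ 2 := by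
  have hN0 : (0 : ℝ) < N := by exact_mod_cast hN
  have hh : 0 < (b - a) / N := div_pos (by linarith) hN0
  set h := (b - a) / N with hdef
  have hK := hu.nonneg
  obtain ⟨g, hg, hgt⟩ := hu.space_taylor t ht
  refine ⟨quasiCoeff fun j => g (knot a b N j), fun i h0 h1 => ?_, fun x hx => ?_⟩
  · have hx := knot_mem_Icc hab hN h0 h1
    set x := knot a b N i with hxdef
    set u₁ := derivWithin (fun y => u y t) (Icc a b) x
    set u₂ := iteratedDerivWithin 2 (fun y => u y t) (Icc a b) x
    set u₃ := iteratedDerivWithin 3 (fun y => u y t) (Icc a b) x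
    have key : ∀ n : ℤ, |n| ≤ 3 → |g (knot a b N (i + n)) - (u x t + h * u₁ * n
        + h ^ 2 / 2 * u₂ * n ^ 2 + h ^ 3 / 6 * u₃ * n ^ 3)| ≤ 81 * K * h ^ 4 := fun n hn => by
      have hd : knot a b N (i + n) - x = n * h := by
        rw [hxdef]
        unfold knot
        push_cast
        ring
      have hn' : |(n : ℝ)| ≤ 3 := by exact_mod_cast hn
      have := hgt x hx (knot a b N (i + n))
      rw [hd, abs_mul, abs_of_pos hh] at this
      have e : u x t + u₁ * (n * h) + u₂ / 2 * (n * h) ^ 2 + u₃ / 6 * (n * h) ^ 3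
        = u x t + h * u₁ * n + h ^ 2 / 2 * u₂ * n ^ 2 + h ^ 3 / 6 * u₃ * n ^ 3 := by ring
      rw [e] at this
      refine this.trans ?_
      calc K * (|(n : ℝ)| * h) ^ 4 ≤ K * (3 * h) ^ 4 := by gcongr
        _ = 81 * K * h ^ 4 := by ring
    obtain ⟨a1, a2, a3⟩ :=
      quasiCoeff_node (g := fun j => g (knot a b N j)) (i := i) key
    have e1 : h * u₁ / 5 = h / 5 * u₁ := by ring
    have e2 : h ^ 2 / 2 * u₂ / 10 = h ^ 2 / 20 * u₂ := by ring
    rw [e1] at a2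
    rw [e2] at a3
    exact ⟨a1.trans_eq (by ring), a2.trans_eq (by ring), a3.trans_eq (by ring)⟩
  · set u₁ := derivWithin (fun y => u y t) (Icc a b) x
    set u₂ := iteratedDerivWithin 2 (fun y => u y t) (Icc a b) x with hu₂
    set u₃ := iteratedDerivWithin 3 (fun y => u y t) (Icc a b) x with hu₃
    refine ⟨h * u₁, fun j hj => ?_⟩
    set s := (x - a) / h with hs
    have hxs : x = a + s * h := by rw [hs]; field_simp; ring
    have key : ∀ n : ℤ, |n| ≤ 1 →
        |g (knot a b N (j + n)) - (u x t + h * u₁ * (j + n - s))| ≤ 275 * K * h ^ 2 := by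
      intro n hn
      set r : ℝ := j + n - s with hr
      have hd : knot a b N (j + n) - x = r * h := by
        rw [hxs, hr]
        unfold knot
        push_cast
        ring
      have hn' : |(n : ℝ)| ≤ 1 := by exact_mod_cast hn
      have hr4 : |r| ≤ 4 := by
        rw [abs_le] at *
        constructor <;> linarith [hj.1, hj.2, hn'.1, hn'.2]
      have hT := hgt x hx (knot a b N (j + n))
      rw [hd] at hT
      have h2 : |u₂ / 2 * (r * h) ^ 2| ≤ 8 * K * h ^ 2 := by
        rw [abs_mul, abs_div, abs_two, abs_of_nonneg (sq_nonneg (r * h)), mul_pow]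
        have h1 := hu.curvature x hx t ht
        have hr2 : r ^ 2 ≤ 16 := by
          rw [← sq_abs]
          calc |r| ^ 2 ≤ 4 ^ 2 := pow_le_pow_left₀ (abs_nonneg _) hr4 2
            _ = 16 := by norm_num
        calc |u₂| / 2 * (r ^ 2 * h ^ 2) ≤ K / 2 * (16 * h ^ 2) := by gcongr
          _ = 8 * K * h ^ 2 := by ring
      have h3 : |u₃ / 6 * (r * h) ^ 3| ≤ 11 * K * h ^ 2 := by
        rw [abs_mul, abs_div, abs_pow, abs_mul, abs_of_pos hh, abs_of_pos (by norm_num : (0:ℝ) < 6)]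
        have h1 := hu.third x hx t ht
        calc |u₃| / 6 * (|r| * h) ^ 3 ≤ K / 6 * (4 * h) ^ 3 := by gcongr
          _ = K * 64 / 6 * h ^ 2 * h := by ring
          _ ≤ K * 64 / 6 * h ^ 2 * 1 := by gcongr
          _ ≤ 11 * K * h ^ 2 := by nlinarith [mul_nonneg hK (sq_nonneg h)]
      have h4 : K * |r * h| ^ 4 ≤ 256 * K * h ^ 2 := by
        rw [abs_mul, abs_of_pos hh]
        calc K * (|r| * h) ^ 4 ≤ K * (4 * h) ^ 4 := by gcongr
          _ = 256 * K * h ^ 2 * h ^ 2 := by ring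
          _ ≤ 256 * K * h ^ 2 * 1 := by
              gcongr
              exact pow_le_one₀ hh.le hh1
          _ = 256 * K * h ^ 2 := by ring
      have h5 := hT.trans h4
      rw [abs_le] at *
      constructor <;> linarith [h2.1, h2.2, h3.1, h3.2, h5.1, h5.2]
    have k0 := key 0 (by norm_num)
    have k1 := key 1 (by norm_num)
    have k2 := key (-1) (by norm_num)
    push_cast at k0 k1 k2
    rw [add_zero, add_zero] at k0
    rw [← sub_eq_add_neg] at k2
    unfold quasiCoeff
    rw [abs_le] at *
    have hKh := mul_nonneg hK (sq_nonneg h)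
    constructor <;> linarith [k0.1, k0.2, k1.1, k1.2, k2.1, k2.2]

/-! ### Consistency in time -/

/-- The residual of the exact solution in the scheme, with the second space derivative at the
middle time level. -/
theorem abs_time_residual_le (hu : DerivBounds a b T u K) {x t k γ α β F G : ℝ} (hx : x ∈ Icc a b)
    (ht : t ∈ Icc 0 T) (htp : t + k ∈ Icc 0 T) (htm : t - k ∈ Icc 0 T) (hk : 0 < k) (hk1 : k ≤ 1)
    (hγ : 0 < γ) (hkγ : k ≤ 2 * γ) (hG : 0 ≤ G) (hγk : |γ ^ 2 - k ^ 2| ≤ G * k ^ 3)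
    (hpde : iteratedDerivWithin 2 (fun s => u x s) (Icc 0 T) t
        + 2 * α * derivWithin (fun s => u x s) (Icc 0 T) t + β ^ 2 * u x t
      = iteratedDerivWithin 2 (fun y => u y t) (Icc a b) x + F) :
    |(2 - (β * γ) ^ 2) * u x t + (α * γ - 1) * u x (t - k) + γ ^ 2 * F
      + γ ^ 2 * iteratedDerivWithin 2 (fun y => u y t) (Icc a b) x - (1 + α * γ) * u x (t + k)|
      ≤ (4 * K * (2 + G) + 4 * |α| * K * (1 + G)) * (γ ^ 2 * k) := by
  have hK := hu.nonneg
  have hp := hu.time_taylor x hx t ht (t + k) htp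
  have hm := hu.time_taylor x hx t ht (t - k) htm
  have hv := hu.velocity x hx t ht
  have ha := hu.acceleration x hx t ht
  set v := derivWithin (fun s => u x s) (Icc 0 T) t
  set w := iteratedDerivWithin 2 (fun s => u x s) (Icc 0 T) t
  rw [show t + k - t = k by ring, abs_of_pos hk] at hp
  rw [show t - k - t = -k by ring, abs_neg, abs_of_pos hk] at hm
  -- Divide γ² − k² = (γ − k)(γ + k) by γ + k ≥ k.
  have hγk1 : |γ - k| ≤ G * k ^ 2 := by
    have h1 : |γ ^ 2 - k ^ 2| = |γ - k| * (γ + k) := by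
      rw [← abs_of_pos (add_pos hγ hk), ← abs_mul]
      congr 1
      ring
    rw [h1] at hγk
    have h2 : |γ - k| * k ≤ G * k ^ 2 * k := by
      nlinarith [mul_nonneg (abs_nonneg (γ - k)) hγ.le]
    exact le_of_mul_le_mul_right h2 hk
  have e1 : |u x (t + k) - 2 * u x t + u x (t - k) - γ ^ 2 * w| ≤ K * (2 + G) * k ^ 3 := by
    have h1 : |(γ ^ 2 - k ^ 2) * w| ≤ G * k ^ 3 * K := by
      rw [abs_mul]
      exact mul_le_mul hγk ha (abs_nonneg _) (by positivity)
    rw [abs_le] at *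
    constructor <;> linarith [hp.1, hp.2, hm.1, hm.2, h1.1, h1.2]
  have e2 : |u x (t + k) - u x (t - k) - 2 * γ * v| ≤ 2 * K * (1 + G) * k ^ 2 := by
    have h1 : |(γ - k) * v| ≤ G * k ^ 2 * K := by
      rw [abs_mul]
      exact mul_le_mul hγk1 hv (abs_nonneg _) (by positivity)
    have h2 : K * k ^ 3 ≤ K * k ^ 2 :=
      mul_le_mul_of_nonneg_left (pow_le_pow_of_le_one hk.le hk1 (by norm_num)) hK
    rw [abs_le] at *
    constructor <;> linarith [hp.1, hp.2, hm.1, hm.2, h1.1, h1.2]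
  have e3 : (2 - (β * γ) ^ 2) * u x t + (α * γ - 1) * u x (t - k) + γ ^ 2 * F
      + γ ^ 2 * iteratedDerivWithin 2 (fun y => u y t) (Icc a b) x - (1 + α * γ) * u x (t + k)
      -- After inserting the differential equation, only the defects of the two central differences
      -- with denominators `γ ^ 2` and `2 * γ` remain.
      = -(u x (t + k) - 2 * u x t + u x (t - k) - γ ^ 2 * w)
        - α * γ * (u x (t + k) - u x (t - k) - 2 * γ * v) := by
    linear_combination -γ ^ 2 * hpde
  rw [e3]
  have hk2 : k ^ 2 ≤ 4 * γ ^ 2 := by nlinarith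
  have e4 : |α * γ * (u x (t + k) - u x (t - k) - 2 * γ * v)| ≤
      |α| * γ * (2 * K * (1 + G) * k ^ 2) := by
    rw [abs_mul, abs_mul, abs_of_pos hγ]
    exact mul_le_mul_of_nonneg_left e2 (by positivity)
  have e5 : |α| * γ * (2 * K * (1 + G) * k ^ 2) ≤ 4 * |α| * K * (1 + G) * (γ ^ 2 * k) := by
    calc |α| * γ * (2 * K * (1 + G) * k ^ 2) = |α| * γ * (2 * K * (1 + G) * k) * k := by ring
      _ ≤ |α| * γ * (2 * K * (1 + G) * k) * (2 * γ) := by gcongr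
      _ = _ := by ring
  have e6 : K * (2 + G) * k ^ 3 ≤ 4 * K * (2 + G) * (γ ^ 2 * k) := by
    calc K * (2 + G) * k ^ 3 = K * (2 + G) * k * k ^ 2 := by ring
      _ ≤ K * (2 + G) * k * (4 * γ ^ 2) := by gcongr
      _ = _ := by ring
  calc _ ≤ |-(u x (t + k) - 2 * u x t + u x (t - k) - γ ^ 2 * w)|
        + |α * γ * (u x (t + k) - u x (t - k) - 2 * γ * v)| := abs_sub _ _
    _ ≤ K * (2 + G) * k ^ 3 + |α| * γ * (2 * K * (1 + G) * k ^ 2) := by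
        rw [abs_neg]
        exact add_le_add e1 e4
    _ ≤ _ := by linarith

theorem abs_curvature_mean_le (hu : DerivBounds a b T u K) {x t k : ℝ} (hx : x ∈ Icc a b)
    (ht : t ∈ Icc 0 T) (htp : t + k ∈ Icc 0 T) (htm : t - k ∈ Icc 0 T) (hk : 0 < k) :
    |iteratedDerivWithin 2 (fun y => u y (t + k)) (Icc a b) x
      + iteratedDerivWithin 2 (fun y => u y (t - k)) (Icc a b) x
      - 2 * iteratedDerivWithin 2 (fun y => u y t) (Icc a b) x| ≤ 2 * K * k := by
  have hp := hu.curvature_lipschitz x hx t ht (t + k) htp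
  have hm := hu.curvature_lipschitz x hx t ht (t - k) htm
  rw [show t + k - t = k by ring, abs_of_pos hk] at hp
  rw [show t - k - t = -k by ring, abs_neg, abs_of_pos hk] at hm
  rw [abs_le] at *
  constructor <;> linarith [hp.1, hp.2, hm.1, hm.2]

end

/-- A sequence with `s_{n+1} ≈ -s_{n-1}` grows at most linearly. -/
theorem abs_le_of_alternating {s : ℕ → ℝ} {S η : ℝ} {n₀ : ℕ} (hη : 0 ≤ η) (h0 : |s 0| ≤ S)
    (h1 : 1 ≤ n₀ → |s 1| ≤ S)
    (h : ∀ n, 1 ≤ n → n + 1 ≤ n₀ → |s (n + 1) + s (n - 1)| ≤ η) :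
    ∀ n ≤ n₀, |s n| ≤ S + n * η := by
  intro n
  induction n using Nat.strong_induction_on with
  | _ n ih =>
    intro hn
    rcases n with _ | _ | n
    · simpa using h0
    · have := h1 hn
      push_cast
      linarith
    · have h2 := h (n + 1) (by omega) hn
      have h3 := ih n (by omega) (by omega)
      rw [Nat.add_sub_cancel] at h2
      have h4 : |s (n + 1 + 1)| ≤ |s (n + 1 + 1) + s n| + |s n| := by
        have := abs_sub (s (n + 1 + 1) + s n) (s n)
        rwa [add_sub_cancel_right] at this
      push_cast
      linarith

/-! ### Boundary values of splines -/

section boundary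

variable {a b : ℝ} {m : ℕ}

theorem quinticSpline_left (hab : a < b) (c : ℤ → ℝ) :
    quinticSpline a b (m + 1) c a = nodeValue c 0 := by
  have := quinticSpline_knot (N := m + 1) hab (by omega) c le_rfl (by omega)
  rwa [knot_zero] at this

theorem quinticSpline_right (hab : a < b) (c : ℤ → ℝ) :
    quinticSpline a b (m + 1) c b = nodeValue c (m + 1) := by
  have := quinticSpline_knot (N := m + 1) hab (by omega) c (i := (m + 1 : ℕ)) (by omega) le_rfl
  rw [knot_last (by omega)] at this
  exact_mod_cast this

theorem deriv_quinticSpline_left (hab : a < b) (c : ℤ → ℝ) :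
    deriv (quinticSpline a b (m + 1) c) a = 5 / ((b - a) / (m + 1 : ℕ)) * nodeSlope c 0 := by
  have := deriv_quinticSpline_knot (N := m + 1) hab (by omega) c le_rfl (by omega)
  rwa [knot_zero] at this

theorem deriv_quinticSpline_right (hab : a < b) (c : ℤ → ℝ) :
    deriv (quinticSpline a b (m + 1) c) b =
      5 / ((b - a) / (m + 1 : ℕ)) * nodeSlope c (m + 1) := by
  have := deriv_quinticSpline_knot (N := m + 1) hab (by omega) c (i := (m + 1 : ℕ)) (by omega) le_rfl
  rw [knot_last (by omega)] at this
  exact_mod_cast this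

theorem iteratedDeriv_quinticSpline_left (hab : a < b) (c : ℤ → ℝ) :
    iteratedDeriv 2 (quinticSpline a b (m + 1) c) a
      = 20 / ((b - a) / (m + 1 : ℕ)) ^ 2 * nodeCurv c 0 := by
  have := iteratedDeriv_quinticSpline_knot (N := m + 1) hab (by omega) c le_rfl (by omega)
  rwa [knot_zero] at this

theorem iteratedDeriv_quinticSpline_right (hab : a < b) (c : ℤ → ℝ) :
    iteratedDeriv 2 (quinticSpline a b (m + 1) c) b
      = 20 / ((b - a) / (m + 1 : ℕ)) ^ 2 * nodeCurv c (m + 1) := by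
  have := iteratedDeriv_quinticSpline_knot (N := m + 1) hab (by omega) c (i := (m + 1 : ℕ))
    (by omega) le_rfl
  rw [knot_last (by omega)] at this
  exact_mod_cast this

end boundary

/-! ### Existence of numerical solutions -/

/-- Every time step of the scheme is solvable. -/
theorem exists_collocation_step {a b α β γ : ℝ} (hab : a < b) {m : ℕ} (hm : 8 ≤ m) (hγ : 0 < γ)
    (hα : 0 < 1 + α * γ) (F : ℝ → ℝ) (v₀ v₁ s₀ s₁ : ℝ) (p q : ℤ → ℝ) : ∃ c : ℤ → ℝ,
      quinticSpline a b (m + 1) c a = v₀ ∧ quinticSpline a b (m + 1) c b = v₁ ∧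
      deriv (quinticSpline a b (m + 1) c) a = s₀ ∧ deriv (quinticSpline a b (m + 1) c) b = s₁ ∧
      ∀ i : ℕ, i ≤ m + 1 →
        (1 + α * γ) * quinticSpline a b (m + 1) c (knot a b (m + 1) i)
          + (-(γ ^ 2 / 2)) * iteratedDeriv 2 (quinticSpline a b (m + 1) c) (knot a b (m + 1) i)
        = (2 - (β * γ) ^ 2) * quinticSpline a b (m + 1) q (knot a b (m + 1) i)
          + (α * γ - 1) * quinticSpline a b (m + 1) p (knot a b (m + 1) i)
          + γ ^ 2 / 2 * iteratedDeriv 2 (quinticSpline a b (m + 1) p) (knot a b (m + 1) i)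
          + γ ^ 2 * F (knot a b (m + 1) i) := by
  have hN0 : (0 : ℝ) < (m + 1 : ℕ) := by positivity
  have hh : 0 < (b - a) / (m + 1 : ℕ) := div_pos (by linarith) hN0
  set R : ℤ → ℝ := fun i => (2 - (β * γ) ^ 2) * quinticSpline a b (m + 1) q (knot a b (m + 1) i)
    + (α * γ - 1) * quinticSpline a b (m + 1) p (knot a b (m + 1) i)
    + γ ^ 2 / 2 * iteratedDeriv 2 (quinticSpline a b (m + 1) p) (knot a b (m + 1) i)
    + γ ^ 2 * F (knot a b (m + 1) i) with hR
  set h := (b - a) / (m + 1 : ℕ) with hdef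
  set μ := γ ^ 2 / 2 * (20 / h ^ 2) with hμ
  have hμ0 : 0 < μ := by positivity
  obtain ⟨c, c1, c2, c3, c4, c5, c6, c7⟩ := exists_collocation hm
    (div_nonneg hμ0.le hα.le : 0 ≤ μ / (1 + α * γ))
    (fun i => if i = 0 then v₀ else if i = m + 1 then v₁ else R i / (1 + α * γ))
    -- At an end node the value is prescribed, so the collocation equation there is equivalent to
    -- prescribing the second derivative.
    (h / 5 * s₀) (h / 5 * s₁) (((1 + α * γ) * v₀ - R 0) / μ) (((1 + α * γ) * v₁ - R (m + 1)) / μ)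
  rw [if_pos rfl] at c5
  rw [if_neg (by omega), if_pos rfl] at c6
  refine ⟨c, ?_, ?_, ?_, ?_, fun i hi => ?_⟩
  · rw [quinticSpline_left hab, c5]
  · rw [quinticSpline_right hab, c6]
  · rw [deriv_quinticSpline_left hab, c1, ← hdef]
    field_simp
  · rw [deriv_quinticSpline_right hab, c2, ← hdef]
    field_simp
  · rw [quinticSpline_knot (N := m + 1) hab (by omega) c (by omega) (by omega),
      iteratedDeriv_quinticSpline_knot (N := m + 1) hab (by omega) c (by omega) (by omega), ← hdef]
    change _ = R i
    have e : (1 + α * γ) * nodeValue c i + -(γ ^ 2 / 2) * (20 / h ^ 2 * nodeCurv c i)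
        = (1 + α * γ) * nodeValue c i - μ * nodeCurv c i := by rw [hμ]; ring
    rw [e]
    have : (i : ℤ) = 0 ∨ (i : ℤ) = m + 1 ∨ (1 ≤ (i : ℤ) ∧ (i : ℤ) ≤ m) := by omega
    rcases this with h0 | h0 | ⟨h0, h1⟩
    · rw [h0, c5, c3]
      field_simp
      ring
    · rw [h0, c6, c4]
      field_simp
      ring
    · have := c7 i h0 h1
      rw [if_neg (by omega), if_neg (by omega)] at this
      field_simp at this
      linarith

/-- Interpolation with vanishing second derivatives at the end points. -/
theorem exists_interpolation_start {a b : ℝ} (hab : a < b) {m : ℕ} (hm : 8 ≤ m) (φ : ℝ → ℝ)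
    (v₀ v₁ s₀ s₁ : ℝ) : ∃ c : ℤ → ℝ,
      quinticSpline a b (m + 1) c a = v₀ ∧ quinticSpline a b (m + 1) c b = v₁ ∧
      deriv (quinticSpline a b (m + 1) c) a = s₀ ∧ deriv (quinticSpline a b (m + 1) c) b = s₁ ∧
      iteratedDeriv 2 (quinticSpline a b (m + 1) c) a = 0 ∧
      iteratedDeriv 2 (quinticSpline a b (m + 1) c) b = 0 ∧
      ∀ i : ℕ, 0 < i → i < m + 1 →
        quinticSpline a b (m + 1) c (knot a b (m + 1) i) = φ (knot a b (m + 1) i) := by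
  have hN0 : (0 : ℝ) < (m + 1 : ℕ) := by positivity
  have hh : 0 < (b - a) / (m + 1 : ℕ) := div_pos (by linarith) hN0
  set h := (b - a) / (m + 1 : ℕ) with hdef
  obtain ⟨c, c1, c2, c3, c4, c5, c6, c7⟩ := exists_collocation hm le_rfl
    (fun i => if i = 0 then v₀ else if i = m + 1 then v₁ else φ (knot a b (m + 1) i))
    (h / 5 * s₀) (h / 5 * s₁) 0 0
  rw [if_pos rfl] at c5
  rw [if_neg (by omega), if_pos rfl] at c6
  refine ⟨c, ?_, ?_, ?_, ?_, ?_, ?_, fun i h0 h1 => ?_⟩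
  · rw [quinticSpline_left hab, c5]
  · rw [quinticSpline_right hab, c6]
  · rw [deriv_quinticSpline_left hab, c1, ← hdef]
    field_simp
  · rw [deriv_quinticSpline_right hab, c2, ← hdef]
    field_simp
  · rw [iteratedDeriv_quinticSpline_left hab, c3, mul_zero]
  · rw [iteratedDeriv_quinticSpline_right hab, c4, mul_zero]
  · rw [quinticSpline_knot (N := m + 1) hab (by omega) c (by omega) (by omega)]
    have := c7 i (by omega) (by omega)
    rwa [if_neg (by omega), if_neg (by omega), zero_mul, sub_zero] at this

/-- Recursion on pairs of consecutive levels, started with zero end second derivatives. All levels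
are constructed, including those beyond T. -/
theorem exists_isCollocationSolution {a b T α β : ℝ} (hab : a < b) (hT : 0 < T)
    {f : ℝ → ℝ → ℝ} {f₀ f₁ g₀ g₁ g₂ g₃ : ℝ → ℝ} {u : ℝ → ℝ → ℝ}
    (hu : IsTelegraphSolution a b T α β f f₀ f₁ g₀ g₁ g₂ g₃ u) {m : ℕ} (hm : 8 ≤ m) {k γ M : ℝ}
    (hγ : 0 < γ) (hα : 0 < 1 + α * γ) (hM : 0 ≤ M) :
    ∃ c : ℕ → ℤ → ℝ, IsCollocationSolution a b T α β f f₀ f₁ g₀ g₁ g₂ g₃ (m + 1) k γ c ∧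
      StartBoundedBy a b (m + 1) c M := by
  obtain ⟨c₀, p1, p2, p3, p4, p5, p6, p7⟩ := exists_interpolation_start hab hm f₀
    (g₀ ((0 : ℕ) * k)) (g₁ ((0 : ℕ) * k)) (g₂ ((0 : ℕ) * k)) (g₃ ((0 : ℕ) * k))
  obtain ⟨c₁, q1, q2, q3, q4, q5, q6, q7⟩ := exists_interpolation_start hab hm
    (taylorStart a b α β f f₀ f₁ k)
    (g₀ ((1 : ℕ) * k)) (g₁ ((1 : ℕ) * k)) (g₂ ((1 : ℕ) * k)) (g₃ ((1 : ℕ) * k))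
  choose next r1 r2 r3 r4 r5 using fun (n : ℕ) (p q : ℤ → ℝ) =>
    exists_collocation_step (β := β) hab hm hγ hα (fun x => f x ((n + 1 : ℕ) * k))
      (g₀ ((n + 2 : ℕ) * k)) (g₁ ((n + 2 : ℕ) * k)) (g₂ ((n + 2 : ℕ) * k)) (g₃ ((n + 2 : ℕ) * k)) p q
  let S : ℕ → (ℤ → ℝ) × (ℤ → ℝ) := fun n =>
    Nat.rec (c₀, c₁) (fun n s => (s.2, next n s.1 s.2)) n
  let c : ℕ → ℤ → ℝ := fun n => (S n).1
  have hc : ∀ n, c (n + 2) = next n (c n) (c (n + 1)) := fun n => rfl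
  have hc0 : c 0 = c₀ := rfl
  have hc1 : c 1 = c₁ := rfl
  clear_value c
  have h00 : ((0 : ℕ) : ℝ) * k = 0 := by simp
  have hT0 : (0 : ℝ) ∈ Icc 0 T := left_mem_Icc.2 hT.le
  refine ⟨c, ⟨?_, ?_, ?_, ?_, ?_, ?_, ?_⟩, ?_⟩
  · rintro (_ | _ | n) _
    · rw [hc0, p1]
    · rw [hc1, q1]
    · rw [hc, r1]
  · rintro (_ | _ | n) _
    · rw [hc0, p2]
    · rw [hc1, q2]
    · rw [hc, r2]
  · rintro (_ | _ | n) _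
    · rw [hc0, p3]
    · rw [hc1, q3]
    · rw [hc, r3]
  · rintro (_ | _ | n) _
    · rw [hc0, p4]
    · rw [hc1, q4]
    · rw [hc, r4]
  · intro i hi
    rw [hc0]
    have : i = 0 ∨ i = m + 1 ∨ (0 < i ∧ i < m + 1) := by omega
    rcases this with rfl | rfl | ⟨h0, h1⟩
    -- Initial and boundary data agree at the corners because both are traces of u.
    · rw [Nat.cast_zero, knot_zero, p1, h00, ← hu.left_value 0 hT0,
        hu.initial_value a (left_mem_Icc.2 hab.le)]
    · rw [knot_last (by omega), p2, h00, ← hu.right_value 0 hT0,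
        hu.initial_value b (right_mem_Icc.2 hab.le)]
    · exact p7 i h0 h1
  · intro _ i h0 h1
    rw [hc1]
    exact q7 i h0 h1
  · intro n hn _ i hi
    obtain ⟨n, rfl⟩ : ∃ l, n = l + 1 := ⟨n - 1, by omega⟩
    rw [hc, r5 n (c n) (c (n + 1)) i hi]
    rfl
  · intro n hn
    have : n = 0 ∨ n = 1 := by omega
    rcases this with rfl | rfl
    · rw [hc0, p5, p6, abs_zero]
      exact ⟨hM, hM⟩
    · rw [hc1, q5, q6, abs_zero]
      exact ⟨hM, hM⟩

/-! ### Convergence -/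

theorem nodeValue_add (c d : ℤ → ℝ) (i : ℤ) :
    nodeValue (c + d) i = nodeValue c i + nodeValue d i := by
  simp only [nodeValue, Pi.add_apply]; ring

theorem nodeValue_sub (c d : ℤ → ℝ) (i : ℤ) :
    nodeValue (c - d) i = nodeValue c i - nodeValue d i := by
  simp only [nodeValue, Pi.sub_apply]; ring

theorem nodeSlope_add (c d : ℤ → ℝ) (i : ℤ) :
    nodeSlope (c + d) i = nodeSlope c i + nodeSlope d i := by
  simp only [nodeSlope, Pi.add_apply]; ring

theorem nodeSlope_sub (c d : ℤ → ℝ) (i : ℤ) :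
    nodeSlope (c - d) i = nodeSlope c i - nodeSlope d i := by
  simp only [nodeSlope, Pi.sub_apply]; ring

theorem nodeCurv_add (c d : ℤ → ℝ) (i : ℤ) :
    nodeCurv (c + d) i = nodeCurv c i + nodeCurv d i := by
  simp only [nodeCurv, Pi.add_apply]; ring

theorem nodeCurv_sub (c d : ℤ → ℝ) (i : ℤ) :
    nodeCurv (c - d) i = nodeCurv c i - nodeCurv d i := by
  simp only [nodeCurv, Pi.sub_apply]; ring

theorem abs_nodeCurv_le {c : ℤ → ℝ} {i : ℤ} {η : ℝ} (h : ∀ j, i - 2 ≤ j → j ≤ i + 2 → |c j| ≤ η) :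
    |nodeCurv c i| ≤ 12 * η := by
  obtain ⟨l1, r1⟩ := abs_le.1 (h (i - 2) (by omega) (by omega))
  obtain ⟨l2, r2⟩ := abs_le.1 (h (i - 1) (by omega) (by omega))
  obtain ⟨l3, r3⟩ := abs_le.1 (h i (by omega) (by omega))
  obtain ⟨l4, r4⟩ := abs_le.1 (h (i + 1) (by omega) (by omega))
  obtain ⟨l5, r5⟩ := abs_le.1 (h (i + 2) (by omega) (by omega))
  unfold nodeCurv
  rw [abs_le]
  constructor <;> linarith

/-- The sequence `0, 1, 0, -1, 0, 1, …`. -/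
def alternatingSign : ℕ → ℝ
  | 0 => 0
  | 1 => 1
  | n + 2 => -alternatingSign n

theorem abs_alternatingSign_le : ∀ n, |alternatingSign n| ≤ 1
  | 0 => by simp [alternatingSign]
  | 1 => by simp [alternatingSign]
  | n + 2 => by
    rw [alternatingSign, abs_neg]
    exact abs_alternatingSign_le n

theorem alternatingSign_succ {n : ℕ} (hn : 1 ≤ n) :
    alternatingSign (n + 1) = -alternatingSign (n - 1) := by
  obtain ⟨l, rfl⟩ : ∃ l, n = l + 1 := ⟨n - 1, by omega⟩
  rfl

/-- The second derivatives of the numerical solution at an end point stay within a bounded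
distance of those of the exact solution, and their means over two steps are accurate. -/
theorem boundary_curvature {a b T K α β k γ G M : ℝ} {u f : ℝ → ℝ → ℝ} {x : ℝ}
    (hb : DerivBounds a b T u K) (hx : x ∈ Icc a b) (hk : 0 < k) (hk1 : k ≤ 1) (hγ : 0 < γ)
    (hkγ : k ≤ 2 * γ) (hG : 0 ≤ G) (hγk : |γ ^ 2 - k ^ 2| ≤ G * k ^ 3) (hT : 0 < T)
    (hpde : ∀ t ∈ Icc 0 T, iteratedDerivWithin 2 (fun s => u x s) (Icc 0 T) t
        + 2 * α * derivWithin (fun s => u x s) (Icc 0 T) t + β ^ 2 * u x t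
      = iteratedDerivWithin 2 (fun y => u y t) (Icc a b) x + f x t)
    {V W : ℕ → ℝ} (hV : ∀ n : ℕ, n * k ≤ T → V n = u x (n * k))
    (hstep : ∀ n : ℕ, 1 ≤ n → (n + 1) * k ≤ T →
      (1 + α * γ) * V (n + 1) + (-(γ ^ 2 / 2)) * W (n + 1) = (2 - (β * γ) ^ 2) * V n
        + (α * γ - 1) * V (n - 1) + γ ^ 2 / 2 * W (n - 1) + γ ^ 2 * f x (n * k))
    (hW : ∀ n ≤ 1, |W n| ≤ M) {C₁ C₂ : ℝ}
    (hC₁ : C₁ = 4 * K * (2 + G) + 4 * |α| * K * (1 + G)) (hC₂ : C₂ = 2 * C₁ + 2 * K) :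
    (∀ n : ℕ, 1 ≤ n → (n + 1) * k ≤ T →
      |(W (n + 1) - iteratedDerivWithin 2 (fun y => u y (n * k + k)) (Icc a b) x)
        + (W (n - 1) - iteratedDerivWithin 2 (fun y => u y (n * k - k)) (Icc a b) x)| ≤ C₂ * k) ∧
    ∀ n : ℕ, n * k ≤ T →
      |W n - iteratedDerivWithin 2 (fun y => u y (n * k)) (Icc a b) x| ≤ M + K + C₂ * T := by
  have hK := hb.nonneg
  have hC₁0 : 0 ≤ C₁ := by rw [hC₁]; positivity
  have hC₂0 : 0 ≤ C₂ := by rw [hC₂]; positivity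
  have hpair : ∀ n : ℕ, 1 ≤ n → (n + 1) * k ≤ T →
      |(W (n + 1) - iteratedDerivWithin 2 (fun y => u y (n * k + k)) (Icc a b) x)
        + (W (n - 1) - iteratedDerivWithin 2 (fun y => u y (n * k - k)) (Icc a b) x)|
        ≤ C₂ * k := by
    intro n hn hnT
    have hn' : (1 : ℝ) ≤ n := by exact_mod_cast hn
    have hnk : k ≤ n * k := by nlinarith
    have ht : (n : ℝ) * k ∈ Icc 0 T := ⟨by linarith, by linarith⟩
    have htp : (n : ℝ) * k + k ∈ Icc 0 T := ⟨by linarith, by linarith⟩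
    have htm : (n : ℝ) * k - k ∈ Icc 0 T := ⟨by linarith, by linarith⟩
    have e1 : ((n + 1 : ℕ) : ℝ) * k = n * k + k := by push_cast; ring
    have e2 : ((n - 1 : ℕ) : ℝ) * k = n * k - k := by rw [Nat.cast_sub hn]; push_cast; ring
    have hres := abs_time_residual_le hb hx ht htp htm hk hk1 hγ hkγ hG hγk (hpde _ ht)
    have hmean := abs_curvature_mean_le hb hx ht htp htm hk
    have hst := hstep n hn hnT
    rw [hV (n + 1) (by rw [e1]; exact htp.2), hV n ht.2, hV (n - 1) (by rw [e2]; exact htm.2),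
      e1, e2] at hst
    rw [← hC₁] at hres
    set c := iteratedDerivWithin 2 (fun y => u y (n * k)) (Icc a b) x
    -- The node values are exact here, so subtracting the collocation equation from the time
    -- residual of u isolates the mean of `W` over the two outer levels.
    have hres' : γ ^ 2 * |c - (W (n + 1) + W (n - 1)) / 2| ≤ γ ^ 2 * (C₁ * k) := by
      rw [← abs_of_pos (by positivity : 0 < γ ^ 2), ← abs_mul, abs_of_pos (by positivity : 0 < γ ^ 2)]
      calc _ = _ := by
            congr 1
            linear_combination hst
        _ ≤ _ := hres
        _ = _ := by ring
    have h2 := le_of_mul_le_mul_left hres' (by positivity)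
    rw [hC₂]
    rw [abs_le] at *
    constructor <;> linarith [hmean.1, hmean.2, h2.1, h2.2]
  refine ⟨hpair, fun n hn => ?_⟩
  have hbound := abs_le_of_alternating (n₀ := n) (S := M + K) (η := C₂ * k)
    (s := fun n => W n - iteratedDerivWithin 2 (fun y => u y (n * k)) (Icc a b) x)
    (by positivity) ?_ ?_ ?_ n le_rfl
  · refine hbound.trans ?_
    nlinarith
  · have h0 := hb.curvature x hx 0 (left_mem_Icc.2 hT.le)
    have h1 := hW 0 (by omega)
    simp only [Nat.cast_zero, zero_mul]
    exact (abs_sub _ _).trans (add_le_add h1 h0)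
  · intro hn1
    have hn1' : (1 : ℝ) ≤ n := by exact_mod_cast hn1
    have hkT : k ∈ Icc 0 T := ⟨hk.le, by nlinarith⟩
    have h0 := hb.curvature x hx k hkT
    have h1 := hW 1 le_rfl
    simp only [Nat.cast_one, one_mul]
    exact (abs_sub _ _).trans (add_le_add h1 h0)
  · intro l hl hln
    have hln' : (l : ℝ) + 1 ≤ n := by exact_mod_cast hln
    have e1 : ((l + 1 : ℕ) : ℝ) * k = l * k + k := by push_cast; ring
    have e2 : ((l - 1 : ℕ) : ℝ) * k = l * k - k := by rw [Nat.cast_sub hl]; push_cast; ring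
    have := hpair l hl (by nlinarith)
    simp only [e1, e2]
    exact this

/-- The error in the nodes of the Taylor start. -/
theorem abs_taylorStart_sub_le {a b T α β K : ℝ} (hT : 0 < T)
    {f : ℝ → ℝ → ℝ} {f₀ f₁ g₀ g₁ g₂ g₃ : ℝ → ℝ} {u : ℝ → ℝ → ℝ}
    (hu : IsTelegraphSolution a b T α β f f₀ f₁ g₀ g₁ g₂ g₃ u) (hb : DerivBounds a b T u K)
    {k x : ℝ} (hk : 0 < k) (hkT : k ≤ T) (hx : x ∈ Icc a b) :
    |taylorStart a b α β f f₀ f₁ k x - u x k| ≤ K * k ^ 3 := by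
  have h0 : (0 : ℝ) ∈ Icc 0 T := left_mem_Icc.2 hT.le
  have ht := hb.time_taylor x hx 0 h0 k ⟨hk.le, hkT⟩
  have hp := hu.pde x hx 0 h0
  have hc : iteratedDerivWithin 2 f₀ (Icc a b) x
      = iteratedDerivWithin 2 (fun y => u y 0) (Icc a b) x :=
    iteratedDerivWithin_congr (fun y hy => (hu.initial_value y hy).symm) hx
  have e : taylorStart a b α β f f₀ f₁ k x = u x 0
      + derivWithin (fun s => u x s) (Icc 0 T) 0 * (k - 0)
      + iteratedDerivWithin 2 (fun s => u x s) (Icc 0 T) 0 / 2 * (k - 0) ^ 2 := by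
    unfold taylorStart
    rw [hc, ← hu.initial_value x hx, ← hu.initial_velocity x hx]
    linear_combination (-(k ^ 2) / 2) * hp
  rw [e, abs_sub_comm]
  simp only [sub_zero, abs_of_pos hk] at ht ⊢
  exact ht

/-- A sequence of splines with the end point data of the numerical solution and nearly the nodal
values of the exact solution approximates the latter well; so do, in the mean over two steps, the
second derivatives at the nodes. -/
theorem exists_comparison {a b T K k h C₂ S : ℝ} {u : ℝ → ℝ → ℝ} (hb : DerivBounds a b T u K)
    (hab : a < b) {m : ℕ} (hm : 8 ≤ m) (hh : h = (b - a) / (m + 1 : ℕ)) (hh1 : h ≤ 1) (hk : 0 < k)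
    (hk1 : k ≤ 1) (hS : 0 ≤ S) (hC₂ : 0 ≤ C₂) {c : ℕ → ℤ → ℝ}
    (hv : ∀ n : ℕ, n * k ≤ T → ∀ p : ℤ, p = 0 ∨ p = m + 1 →
      nodeValue (c n) p = u (knot a b (m + 1) p) (n * k))
    (hs : ∀ n : ℕ, n * k ≤ T → ∀ p : ℤ, p = 0 ∨ p = m + 1 → nodeSlope (c n) p
      = h / 5 * derivWithin (fun y => u y (n * k)) (Icc a b) (knot a b (m + 1) p))
    (hw : ∀ n : ℕ, n * k ≤ T → ∀ p : ℤ, p = 0 ∨ p = m + 1 → |nodeCurv (c n) p - h ^ 2 / 20 *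
      iteratedDerivWithin 2 (fun y => u y (n * k)) (Icc a b) (knot a b (m + 1) p)|
      ≤ h ^ 2 / 20 * S)
    (hpair : ∀ n : ℕ, 1 ≤ n → (n + 1 : ℕ) * k ≤ T → ∀ p : ℤ, p = 0 ∨ p = m + 1 →
      |(nodeCurv (c (n + 1)) p - h ^ 2 / 20 *
        iteratedDerivWithin 2 (fun y => u y ((n + 1 : ℕ) * k)) (Icc a b) (knot a b (m + 1) p))
      + (nodeCurv (c (n - 1)) p - h ^ 2 / 20 *
        iteratedDerivWithin 2 (fun y => u y ((n - 1 : ℕ) * k)) (Icc a b) (knot a b (m + 1) p))|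
      ≤ h ^ 2 / 20 * (C₂ * k))
    (h0 : ∀ i : ℤ, 1 ≤ i → i ≤ m → nodeValue (c 0) i = u (knot a b (m + 1) i) ((0 : ℕ) * k))
    (h1 : k ≤ T → ∀ i : ℤ, 1 ≤ i → i ≤ m →
      |nodeValue (c 1) i - u (knot a b (m + 1) i) ((1 : ℕ) * k)| ≤ K * k ^ 3) :
    ∃ g : ℕ → ℤ → ℝ,
      (∀ n : ℕ, n * k ≤ T → IsHomogeneous (m + 1) (c n - g n)) ∧
      (∀ n ≤ 1, ∀ i : ℤ, 1 ≤ i → i ≤ m → nodeValue (c n - g n) i = 0) ∧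
      (∀ n : ℕ, n * k ≤ T → ∀ i : ℤ, 1 ≤ i → i ≤ m →
        |nodeValue (g n) i - u (knot a b (m + 1) i) (n * k)| ≤ K * k ^ 3) ∧
      (∀ n : ℕ, 1 ≤ n → (n + 1 : ℕ) * k ≤ T → ∀ i : ℤ, 1 ≤ i → i ≤ m →
        |nodeCurv (g (n + 1)) i + nodeCurv (g (n - 1)) i - h ^ 2 / 20 *
          (iteratedDerivWithin 2 (fun y => u y ((n + 1 : ℕ) * k)) (Icc a b) (knot a b (m + 1) i)
          + iteratedDerivWithin 2 (fun y => u y ((n - 1 : ℕ) * k)) (Icc a b) (knot a b (m + 1) i))|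
        ≤ h ^ 2 / 20 * ((2400000 * K + 360 * C₂) * (h ^ 2 + k))) ∧
      ∀ n : ℕ, n * k ≤ T → ∀ x ∈ Icc a b, ∃ B : ℝ, ∀ j : ℤ, -2 ≤ j → j ≤ m + 3 →
        |j - (x - a) / h| ≤ 3 → |g n j - (u x (n * k) + B * (j - (x - a) / h)) / 120|
          ≤ (5000 * K + 30 * S) * (h ^ 2 + k) := by
  have hK := hb.nonneg
  have hN0 : (0 : ℝ) < (m + 1 : ℕ) := by positivity
  have hh0 : 0 < h := by rw [hh]; exact div_pos (by linarith) hN0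
  set U : ℕ → ℤ → ℝ := fun n i => u (knot a b (m + 1) i) (n * k) with hU
  set X : ℕ → ℤ → ℝ := fun n i =>
    iteratedDerivWithin 2 (fun y => u y (n * k)) (Icc a b) (knot a b (m + 1) i) with hX
  set Y : ℕ → ℤ → ℝ := fun n i =>
    derivWithin (fun y => u y (n * k)) (Icc a b) (knot a b (m + 1) i) with hY
  -- The O(k³) defect of the Taylor start at the interior nodes.
  set w : ℤ → ℝ := interiorPart m fun i => nodeValue (c 1) i - U 1 i with hwdef
  have hend : ∀ p : ℤ, p = 0 ∨ p = m + 1 → w p = 0 := fun p hp =>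
    interiorPart_of_notMem (by omega)
  have haw : ∀ n : ℕ, n * k ≤ T → ∀ i, |alternatingSign n * w i| ≤ K * k ^ 3 := by
    intro n hn i
    rcases Nat.eq_zero_or_pos n with rfl | hn0
    · simp only [alternatingSign, zero_mul, abs_zero]; positivity
    have hn1 : (1 : ℝ) ≤ n := by exact_mod_cast hn0
    have hkT : k ≤ T := by nlinarith
    have hwi : |w i| ≤ K * k ^ 3 := by
      by_cases hi : 1 ≤ i ∧ i ≤ m
      · rw [hwdef, interiorPart_of_mem hi.1 hi.2]
        exact h1 hkT i hi.1 hi.2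
      · rw [hwdef, interiorPart_of_notMem (by omega), abs_zero]; positivity
    rw [abs_mul]
    exact (mul_le_of_le_one_left (abs_nonneg _) (abs_alternatingSign_le n)).trans hwi
  -- The signs 0, 1, 0, −1, … make `g 0` and `g 1` match the starting values, and cancel `w` in the
  -- sum of the levels n + 1 and n − 1. A defect left in the second derivatives would be amplified
  -- to k³/h², which is not controlled when h and k are independent.
  choose g gs0 gs1 gc0 gc1 gv0 gv1 gv using fun n : ℕ => exists_collocation hm le_rfl
    (fun i => U n i + alternatingSign n * w i) (h / 5 * Y n 0) (h / 5 * Y n (m + 1))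
    (nodeCurv (c n) 0) (nodeCurv (c n) (m + 1))
  have hgv : ∀ n, ∀ i : ℤ, 0 ≤ i → i ≤ m + 1 → nodeValue (g n) i = U n i + alternatingSign n * w i := by
    intro n i hi0 hi1
    have : i = 0 ∨ i = m + 1 ∨ (1 ≤ i ∧ i ≤ m) := by omega
    rcases this with rfl | rfl | ⟨h0, h1⟩
    · exact gv0 n
    · exact gv1 n
    · have := gv n i h0 h1
      rwa [zero_mul, sub_zero] at this
  have hgs : ∀ n, ∀ p : ℤ, p = 0 ∨ p = m + 1 → nodeSlope (g n) p = h / 5 * Y n p := by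
    rintro n p (rfl | rfl)
    exacts [gs0 n, gs1 n]
  have hgc : ∀ n, ∀ p : ℤ, p = 0 ∨ p = m + 1 → nodeCurv (g n) p = nodeCurv (c n) p := by
    rintro n p (rfl | rfl)
    exacts [gc0 n, gc1 n]
  have hgU : ∀ n : ℕ, n * k ≤ T → ∀ i : ℤ, 0 ≤ i → i ≤ m + 1 →
      |nodeValue (g n) i - U n i| ≤ K * k ^ 3 := fun n hn i hi0 hi1 => by
    rw [hgv n i hi0 hi1, add_sub_cancel_left]
    exact haw n hn i
  have hq : ∀ n : ℕ, ∃ q : ℤ → ℝ, n * k ≤ T →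
      (∀ i : ℤ, 0 ≤ i → i ≤ m + 1 → |nodeValue q i - U n i| ≤ 162 * K * h ^ 4 ∧
        |nodeSlope q i - h / 5 * Y n i| ≤ 162 * K * h ^ 4 ∧
        |nodeCurv q i - h ^ 2 / 20 * X n i| ≤ 162 * K * h ^ 4) ∧
      ∀ x ∈ Icc a b, ∃ B : ℝ, ∀ j : ℤ, |j - (x - a) / h| ≤ 3 →
        |q j - (u x (n * k) + B * (j - (x - a) / h)) / 120| ≤ 5 * K * h ^ 2 := by
    intro n
    by_cases hn : n * k ≤ T
    · obtain ⟨q, q1, q2⟩ := exists_quasiInterpolant hb hab (N := m + 1) (by omega)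
        (by rw [← hh]; exact hh1) (t := n * k) ⟨by positivity, hn⟩
      rw [← hh] at q1 q2
      exact ⟨q, fun _ => ⟨fun i hi0 hi1 => q1 i hi0 (by push_cast; exact hi1), q2⟩⟩
    · exact ⟨0, fun h => absurd h hn⟩
  choose q hq using hq
  have hh2 : 0 < h ^ 2 := by positivity
  have hh4 : h ^ 4 ≤ h ^ 2 := pow_le_pow_of_le_one hh0.le hh1 (by norm_num)
  have hk3 : k ^ 3 ≤ k := by simpa using pow_le_pow_of_le_one hk.le hk1 (show 1 ≤ 3 by norm_num)
  refine ⟨g, fun n hn => ⟨?_, ?_, ?_, ?_, ?_, ?_⟩, fun n hn i hi0 hi1 => ?_,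
    fun n hn i hi0 hi1 => hgU n hn i (by omega) (by omega), fun n hn hnT i hi0 hi1 => ?_,
    fun n hn x hx => ?_⟩
  · rw [nodeValue_sub, hv n hn 0 (by simp), hgv n 0 le_rfl (by omega), hend 0 (by simp)]
    simp [hU]
  · push_cast
    rw [nodeValue_sub, hv n hn (m + 1) (by simp), hgv n (m + 1) (by omega) le_rfl,
      hend (m + 1) (by simp)]
    simp [hU]
  · rw [nodeSlope_sub, hs n hn 0 (by simp), hgs n 0 (by simp), sub_self]
  · push_cast
    rw [nodeSlope_sub, hs n hn (m + 1) (by simp), hgs n (m + 1) (by simp), sub_self]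
  · rw [nodeCurv_sub, hgc n 0 (by simp), sub_self]
  · push_cast
    rw [nodeCurv_sub, hgc n (m + 1) (by simp), sub_self]
  · rw [nodeValue_sub, hgv n i (by omega) (by omega)]
    have : n = 0 ∨ n = 1 := by omega
    rcases this with rfl | rfl
    · rw [h0 i hi0 hi1]
      simp [alternatingSign, hU]
    · rw [hwdef, interiorPart_of_mem hi0 hi1]
      simp [alternatingSign]
  · have hnk : ((n + 1 : ℕ) : ℝ) * k ≤ T := hnT
    have hnk' : ((n - 1 : ℕ) : ℝ) * k ≤ T := le_trans
      (mul_le_mul_of_nonneg_right (by exact_mod_cast (by omega : n - 1 ≤ n + 1)) hk.le) hnT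
    obtain ⟨qp, -⟩ := hq (n + 1) hnk
    obtain ⟨qm, -⟩ := hq (n - 1) hnk'
    -- Only the sum is good: its end curvature data are accurate to h⁴ + h²k, whereas those of a
    -- single level are guaranteed only to h². All data of `z` then have this size, hence so do its
    -- coefficients.
    set z : ℤ → ℝ := (g (n + 1) + g (n - 1)) - (q (n + 1) + q (n - 1)) with hz
    set η := 324 * K * h ^ 4 + h ^ 2 / 20 * (C₂ * k) with hη
    have hη0 : 0 ≤ h ^ 2 / 20 * (C₂ * k) := by positivity
    have hzc : ∀ p : ℤ, p = 0 ∨ p = m + 1 → |nodeCurv z p| ≤ η := by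
      intro p hp
      rw [hz, nodeCurv_sub, nodeCurv_add, nodeCurv_add, hgc _ p hp, hgc _ p hp]
      have e1 := abs_le.1 (qp p (by omega) (by omega)).2.2
      have e2 := abs_le.1 (qm p (by omega) (by omega)).2.2
      have e3 := abs_le.1 (hpair n hn hnT p hp)
      rw [abs_le]
      constructor <;> linarith [e1.1, e1.2, e2.1, e2.2, e3.1, e3.2]
    have hzs : ∀ p : ℤ, p = 0 ∨ p = m + 1 → |nodeSlope z p| ≤ η := by
      intro p hp
      rw [hz, nodeSlope_sub, nodeSlope_add, nodeSlope_add, hgs _ p hp, hgs _ p hp]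
      have e1 := abs_le.1 (qp p (by omega) (by omega)).2.1
      have e2 := abs_le.1 (qm p (by omega) (by omega)).2.1
      rw [abs_le]
      constructor <;> linarith [e1.1, e1.2, e2.1, e2.2]
    have hzb : ∀ j : ℤ, -2 ≤ j → j ≤ m + 3 → |z j| ≤ 30 * η := by
      refine abs_coeff_le (by omega) (fun i hi0 hi1 => ?_) (hzs 0 (by simp)) (hzc 0 (by simp))
        (hzs _ (by simp)) (hzc _ (by simp))
      rw [hz, nodeValue_sub, nodeValue_add, nodeValue_add, hgv _ i hi0 hi1, hgv _ i hi0 hi1,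
        alternatingSign_succ hn]
      have e1 := abs_le.1 (qp i (by omega) (by omega)).1
      have e2 := abs_le.1 (qm i (by omega) (by omega)).1
      rw [abs_le]
      constructor <;> linarith [e1.1, e1.2, e2.1, e2.2]
    have hzi := abs_le.1 (abs_nodeCurv_le (c := z) (i := i) fun j hj0 hj1 =>
      hzb j (by omega) (by omega))
    rw [hz, nodeCurv_sub, nodeCurv_add, nodeCurv_add] at hzi
    have e1 := abs_le.1 (qp i (by omega) (by omega)).2.2
    have e2 := abs_le.1 (qm i (by omega) (by omega)).2.2
    have key : 12 * (30 * η) + 324 * K * h ^ 4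
        ≤ h ^ 2 / 20 * ((2400000 * K + 360 * C₂) * (h ^ 2 + k)) := by
      have t1 : 0 ≤ h ^ 2 * (K * k) := by positivity
      have t2 : 0 ≤ h ^ 2 * (C₂ * h ^ 2) := by positivity
      have t3 : 0 ≤ K * h ^ 4 := by positivity
      rw [hη]
      nlinarith
    refine le_trans ?_ key
    rw [abs_le]
    constructor <;> linarith [e1.1, e1.2, e2.1, e2.2, hzi.1, hzi.2]
  · obtain ⟨q1, q2⟩ := hq n hn
    obtain ⟨B, hB⟩ := q2 x hx
    refine ⟨B, fun j hj0 hj1 hj => ?_⟩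
    -- For a single level the O(1) error of the end second derivative enters with the factor h²,
    -- which is enough for the coefficients themselves.
    set η := 162 * K * h ^ 4 + K * k ^ 3 + h ^ 2 / 20 * S with hη
    have t1 : 0 ≤ 162 * K * h ^ 4 := by positivity
    have t2 : 0 ≤ K * k ^ 3 := by positivity
    have t3 : 0 ≤ h ^ 2 / 20 * S := by positivity
    have hz : |(g n - q n) j| ≤ 30 * η := by
      have hsl : ∀ p : ℤ, p = 0 ∨ p = m + 1 → |nodeSlope (g n - q n) p| ≤ η := by
        intro p hp
        rw [nodeSlope_sub, hgs n p hp, abs_sub_comm]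
        exact (q1 p (by omega) (by omega)).2.1.trans (by linarith)
      have hcu : ∀ p : ℤ, p = 0 ∨ p = m + 1 → |nodeCurv (g n - q n) p| ≤ η := by
        intro p hp
        rw [nodeCurv_sub, hgc n p hp]
        have e1 := abs_le.1 (q1 p (by omega) (by omega)).2.2
        have e2 := abs_le.1 (hw n hn p hp)
        rw [abs_le]
        constructor <;> linarith [e1.1, e1.2, e2.1, e2.2]
      refine abs_coeff_le (by omega) (fun i hi0 hi1 => ?_) (hsl 0 (by simp)) (hcu 0 (by simp))
        (hsl _ (by simp)) (hcu _ (by simp)) j hj0 hj1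
      rw [nodeValue_sub]
      have e1 := abs_le.1 (q1 i (by omega) (by omega)).1
      have e2 := abs_le.1 (hgU n hn i hi0 hi1)
      rw [abs_le]
      constructor <;> linarith [e1.1, e1.2, e2.1, e2.2]
    have e1 := abs_le.1 hz
    have e2 := abs_le.1 (hB j hj)
    rw [Pi.sub_apply] at e1
    have key : 30 * η + 5 * K * h ^ 2 ≤ (5000 * K + 30 * S) * (h ^ 2 + k) := by
      have s1 := mul_le_mul_of_nonneg_left hh4 hK
      have s2 := mul_le_mul_of_nonneg_left hk3 hK
      have s3 : 0 ≤ S * k := by positivity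
      have s4 : 0 ≤ K * k := by positivity
      have s5 : 0 ≤ K * h ^ 2 := by positivity
      have s6 : 0 ≤ S * h ^ 2 := by positivity
      rw [hη]
      linarith
    refine le_trans ?_ key
    rw [abs_le]
    constructor <;> linarith [e1.1, e1.2, e2.1, e2.2]

/-- Collects the residual of the comparison splines: `A` is the time residual of u, `r` the error of
their two-level second derivatives, `μ` the mean of u_xx over the outer levels against the middle
one, and `d`, `dp`, `dm` their node defects. The latter are O(k³) and remain O(k) after division by
γ². -/
theorem abs_consistency_le {α β γ k K C₁ C₃ ε A r μ d dp dm : ℝ} (hK : 0 ≤ K) (hC₁ : 0 ≤ C₁)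
    (hk : 0 < k) (hγ : 0 < γ) (hγ2 : γ ≤ 2) (hkγ : k ≤ 2 * γ) (hkε : k ≤ ε)
    (hA : |A| ≤ C₁ * (γ ^ 2 * k)) (hr : |r| ≤ C₃ * ε) (hμ : |μ| ≤ 2 * K * k)
    (hd : |d| ≤ K * k ^ 3) (hdp : |dp| ≤ K * k ^ 3) (hdm : |dm| ≤ K * k ^ 3) :
    |A + γ ^ 2 / 2 * r + γ ^ 2 / 2 * μ + (2 - (β * γ) ^ 2) * d + (α * γ - 1) * dm
      - (1 + α * γ) * dp|
      ≤ γ ^ 2 * ((C₁ + C₃ + K + (4 + 4 * β ^ 2 + 4 * |α|) * (4 * K)) * ε) := by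
  have hε : 0 < ε := by linarith
  have hγ0 : 0 < γ ^ 2 := by positivity
  have hγ4 : γ ^ 2 ≤ 4 := by nlinarith
  have hk3 : K * k ^ 3 ≤ 4 * K * ε * γ ^ 2 := by
    have h2 : k ^ 2 ≤ 4 * γ ^ 2 := by nlinarith
    calc K * k ^ 3 = K * k * k ^ 2 := by ring
      _ ≤ K * ε * (4 * γ ^ 2) := by gcongr
      _ = _ := by ring
  have hD0 : 0 ≤ 4 * K * ε * γ ^ 2 := by positivity
  have a1 : |A| ≤ C₁ * (γ ^ 2 * ε) := hA.trans (by gcongr)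
  have a2 : |γ ^ 2 / 2 * r| ≤ γ ^ 2 * (C₃ * ε) := by
    rw [abs_mul, abs_of_pos (by positivity)]
    have := mul_le_mul_of_nonneg_left hr hγ0.le
    have := mul_nonneg hγ0.le (abs_nonneg r)
    linarith
  have a3 : |γ ^ 2 / 2 * μ| ≤ γ ^ 2 * (K * ε) := by
    rw [abs_mul, abs_of_pos (by positivity)]
    have h1 : |μ| ≤ 2 * K * ε := hμ.trans (by gcongr)
    have := mul_le_mul_of_nonneg_left h1 hγ0.le
    linarith
  have hαγ : |α * γ| ≤ 2 * |α| := by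
    rw [abs_mul, abs_of_pos hγ, mul_comm]
    gcongr
  have a4 : |(2 - (β * γ) ^ 2) * d| ≤ (2 + 4 * β ^ 2) * (4 * K * ε * γ ^ 2) := by
    rw [abs_mul]
    refine mul_le_mul ?_ (hd.trans hk3) (abs_nonneg _) (by positivity)
    have : (β * γ) ^ 2 ≤ 4 * β ^ 2 := by
      rw [mul_pow, mul_comm]
      gcongr
    rw [abs_le]
    constructor <;> nlinarith [sq_nonneg (β * γ), sq_nonneg β]
  have a5 : |(α * γ - 1) * dm| ≤ (1 + 2 * |α|) * (4 * K * ε * γ ^ 2) := by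
    rw [abs_mul]
    refine mul_le_mul ?_ (hdm.trans hk3) (abs_nonneg _) (by positivity)
    rw [abs_le] at hαγ ⊢
    constructor <;> linarith
  have a6 : |(1 + α * γ) * dp| ≤ (1 + 2 * |α|) * (4 * K * ε * γ ^ 2) := by
    rw [abs_mul]
    refine mul_le_mul ?_ (hdp.trans hk3) (abs_nonneg _) (by positivity)
    rw [abs_le] at hαγ ⊢
    constructor <;> linarith
  rw [abs_le] at a1 a2 a3 a4 a5 a6 ⊢
  constructor <;> linarith

section convergence

variable {a b T α β K G M : ℝ} {f : ℝ → ℝ → ℝ} {f₀ f₁ g₀ g₁ g₂ g₃ : ℝ → ℝ} {u : ℝ → ℝ → ℝ}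

theorem exists_error_bound (hab : a < b) (hT : 0 < T)
    (hu : IsTelegraphSolution a b T α β f f₀ f₁ g₀ g₁ g₂ g₃ u) (hb : DerivBounds a b T u K)
    (hG : 0 ≤ G) (hM : 0 ≤ M) : ∃ C > 0, ∀ (m : ℕ) (k γ : ℝ) (c : ℕ → ℤ → ℝ), 8 ≤ m →
      (b - a) / (m + 1 : ℕ) ≤ 1 → 0 < k → k ≤ 1 → 0 < γ → k ≤ 2 * γ → γ ≤ 2 * k →
      |γ ^ 2 - k ^ 2| ≤ G * k ^ 3 → (2 * |α| + 1 + 2 * (b - a) ^ 2 * β ^ 4) * γ ≤ 1 / 2 →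
      IsCollocationSolution a b T α β f f₀ f₁ g₀ g₁ g₂ g₃ (m + 1) k γ c →
      StartBoundedBy a b (m + 1) c M →
      ∀ n : ℕ, n * k ≤ T → ∀ x ∈ Icc a b,
        |u x (n * k) - quinticSpline a b (m + 1) (c n) x|
          ≤ C * (((b - a) / (m + 1 : ℕ)) ^ 2 + k) := by
  have hK := hb.nonneg
  set C₁ := 4 * K * (2 + G) + 4 * |α| * K * (1 + G) with hC₁
  have hC₁0 : 0 ≤ C₁ := by rw [hC₁]; positivity
  set C₂ := 2 * C₁ + 2 * K with hC₂
  have hC₂0 : 0 ≤ C₂ := by rw [hC₂]; positivity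
  set S := M + K + C₂ * T with hS
  have hS0 : 0 ≤ S := by rw [hS]; positivity
  set C₄ := C₁ + (2400000 * K + 360 * C₂) + K + (4 + 4 * β ^ 2 + 4 * |α|) * (4 * K) with hC₄
  have hC₄0 : 0 ≤ C₄ := by rw [hC₄]; positivity
  set Q := 4 * (b - a) ^ 2 * (2 * T) *
    Real.exp (4 * (2 * |α| + 1 + 2 * (b - a) ^ 2 * β ^ 4) * (2 * T)) with hQ
  have hQ0 : 0 ≤ Q := by rw [hQ]; positivity
  -- The added 1 only makes the constant positive.
  refine ⟨3000000 * (5000 * K + 30 * S + 30 * (√Q * C₄)) + 1, by positivity,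
    fun m k γ c hm hh1 hk hk1 hγ hkγ hγk2 hγk hsmall hc hst n hn x hx => ?_⟩
  set h := (b - a) / (m + 1 : ℕ) with hh
  have hN0 : (0 : ℝ) < (m + 1 : ℕ) := by positivity
  have hh0 : 0 < h := by rw [hh]; exact div_pos (by linarith) hN0
  have hkn : knot a b (m + 1) ((m : ℤ) + 1) = b := by
    have := knot_last (a := a) (b := b) (N := m + 1) (by omega)
    exact_mod_cast this
  have hmem : ∀ i : ℤ, 0 ≤ i → i ≤ m + 1 → knot a b (m + 1) i ∈ Icc a b := fun i h0 h1 =>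
    knot_mem_Icc hab (by omega) h0 (by push_cast; exact h1)
  have htime : ∀ n : ℕ, n * k ≤ T → (n : ℝ) * k ∈ Icc 0 T := fun n hn => ⟨by positivity, hn⟩
  have hmono : ∀ n n' : ℕ, n' * k ≤ T → n ≤ n' → (n : ℝ) * k ≤ T := fun n n' hn hle =>
    le_trans (mul_le_mul_of_nonneg_right (by exact_mod_cast hle) hk.le) hn
  have hsucc : ∀ n : ℕ, ((n + 1 : ℕ) : ℝ) * k = n * k + k := fun n => by push_cast; ring
  have hpred : ∀ n : ℕ, 1 ≤ n → ((n - 1 : ℕ) : ℝ) * k = n * k - k := fun n hn => by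
    rw [Nat.cast_sub hn]; push_cast; ring
  have hv : ∀ n : ℕ, n * k ≤ T → ∀ p : ℤ, p = 0 ∨ p = m + 1 →
      nodeValue (c n) p = u (knot a b (m + 1) p) (n * k) := by
    rintro n hn p (rfl | rfl)
    · rw [knot_zero, hu.left_value _ (htime n hn), ← hc.left_value n hn, quinticSpline_left hab]
    · rw [hkn, hu.right_value _ (htime n hn), ← hc.right_value n hn, quinticSpline_right hab]
  have hs : ∀ n : ℕ, n * k ≤ T → ∀ p : ℤ, p = 0 ∨ p = m + 1 → nodeSlope (c n) p
      = h / 5 * derivWithin (fun y => u y (n * k)) (Icc a b) (knot a b (m + 1) p) := by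
    rintro n hn p (rfl | rfl)
    · rw [knot_zero, hu.left_slope _ (htime n hn), ← hc.left_slope n hn,
        deriv_quinticSpline_left hab, ← hh]
      field_simp
    · rw [hkn, hu.right_slope _ (htime n hn), ← hc.right_slope n hn,
        deriv_quinticSpline_right hab, ← hh]
      field_simp
  have hstep : ∀ n : ℕ, 1 ≤ n → (n + 1) * k ≤ T → ∀ i : ℤ, 0 ≤ i → i ≤ m + 1 →
      (1 + α * γ) * nodeValue (c (n + 1)) i
          + (-(γ ^ 2 / 2)) * (20 / h ^ 2 * nodeCurv (c (n + 1)) i)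
        = (2 - (β * γ) ^ 2) * nodeValue (c n) i + (α * γ - 1) * nodeValue (c (n - 1)) i
          + γ ^ 2 / 2 * (20 / h ^ 2 * nodeCurv (c (n - 1)) i)
          + γ ^ 2 * f (knot a b (m + 1) i) (n * k) := by
    intro n hn hnT i hi0 hi1
    lift i to ℕ using hi0
    have := hc.step n hn hnT i (by omega)
    simpa only [quinticSpline_knot (N := m + 1) hab (by omega) _ (Int.natCast_nonneg i)
      (by push_cast; exact hi1), iteratedDeriv_quinticSpline_knot (N := m + 1) hab (by omega) _
      (Int.natCast_nonneg i) (by push_cast; exact hi1), ← hh] using this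
  have hbdry : ∀ p : ℤ, p = 0 ∨ p = m + 1 → _ := fun p hp =>
    boundary_curvature (V := fun n => nodeValue (c n) p)
      (W := fun n => 20 / h ^ 2 * nodeCurv (c n) p) (M := M) hb (hmem p (by omega) (by omega))
      hk hk1 hγ hkγ hG hγk hT (fun t ht => hu.pde _ (hmem p (by omega) (by omega)) t ht)
      (fun n hn => hv n hn p hp)
      (fun n hn hnT => hstep n hn hnT p (by omega) (by omega))
      (fun n hn => by
        have := hst n hn
        rw [iteratedDeriv_quinticSpline_left hab, iteratedDeriv_quinticSpline_right hab,
          ← hh] at this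
        rcases hp with rfl | rfl
        exacts [this.1, this.2]) hC₁ hC₂
  have hscale : ∀ {y z r : ℝ}, |20 / h ^ 2 * y - z| ≤ r → |y - h ^ 2 / 20 * z| ≤ h ^ 2 / 20 * r := by
    intro y z r hy
    have e : y - h ^ 2 / 20 * z = h ^ 2 / 20 * (20 / h ^ 2 * y - z) := by field_simp
    rw [e, abs_mul, abs_of_pos (by positivity)]
    gcongr
  obtain ⟨g, hg1, hg2, hg3, hg4, hg5⟩ := exists_comparison hb hab hm hh hh1 hk hk1 hS0 hC₂0 hv hs
    (fun n hn p hp => hscale ((hbdry p hp).2 n hn))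
    (fun n hn hnT p hp => by
      have h1 := (hbdry p hp).1 n hn (by push_cast at hnT; exact hnT)
      rw [← hsucc, ← hpred n hn] at h1
      have e : ∀ y y' z z' : ℝ, (y - h ^ 2 / 20 * z) + (y' - h ^ 2 / 20 * z')
          = (y + y') - h ^ 2 / 20 * (z + z') := fun _ _ _ _ => by ring
      rw [e]
      refine hscale (le_trans (le_of_eq ?_) h1)
      congr 1
      ring)
    (fun i hi0 hi1 => by
      lift i to ℕ using by omega
      have := hc.start_zero i (by omega)
      rw [quinticSpline_knot (N := m + 1) hab (by omega) _ (by omega) (by omega)] at this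
      rw [this, Nat.cast_zero, zero_mul, hu.initial_value _ (hmem i (by omega) (by omega))])
    (fun hkT i hi0 hi1 => by
      lift i to ℕ using by omega
      have := hc.start_one hkT i (by omega) (by omega)
      rw [quinticSpline_knot (N := m + 1) hab (by omega) _ (by omega) (by omega)] at this
      rw [this, Nat.cast_one, one_mul]
      exact abs_taylorStart_sub_le hT hu hb hk hkT (hmem i (by omega) (by omega)))
  set ε := h ^ 2 + k with hε
  have hε0 : 0 < ε := by positivity
  have hkε : k ≤ ε := by rw [hε]; linarith [sq_nonneg h]
  set e : ℕ → ℤ → ℝ := fun n => c n - g n with he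
  -- The source is defined as the residual, so the scheme holds for `e` by construction and the work
  -- lies in bounding it.
  set σ : ℕ → ℤ → ℝ := fun n i => ((1 + α * γ) * nodeValue (e (n + 1)) i
      - γ ^ 2 / 2 * (20 / h ^ 2) * nodeCurv (e (n + 1)) i
      - ((2 - (β * γ) ^ 2) * nodeValue (e n) i + (α * γ - 1) * nodeValue (e (n - 1)) i
        + γ ^ 2 / 2 * (20 / h ^ 2) * nodeCurv (e (n - 1)) i)) / γ ^ 2 with hσdef
  have hσ : ∀ l, 1 ≤ l → l + 1 ≤ n → ∀ i : ℤ, 1 ≤ i → i ≤ m → |σ l i| ≤ C₄ * ε := by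
    intro l hl hln i hi0 hi1
    have hlp := hmono (l + 1) n hn hln
    have hl0 := hmono l n hn (by omega)
    have hlm := hmono (l - 1) n hn (by omega)
    have hxi := hmem i (by omega) (by omega)
    have tp := htime _ hlp
    have tm := htime _ hlm
    have dp := hg3 _ hlp i hi0 hi1
    have dm := hg3 _ hlm i hi0 hi1
    have hr := hg4 l hl hlp i hi0 hi1
    rw [hsucc] at tp hlp dp hr
    rw [hpred l hl] at tm dm hr
    have hA := abs_time_residual_le hb hxi (htime l hl0) tp tm hk hk1 hγ hkγ hG hγk
      (hu.pde _ hxi _ (htime l hl0))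
    have hmean := abs_curvature_mean_le hb hxi (htime l hl0) tp tm hk
    have hcs := hstep l hl (by linarith) i (by omega) (by omega)
    set X := iteratedDerivWithin 2 (fun y => u y (l * k)) (Icc a b) (knot a b (m + 1) i)
    set Xp := iteratedDerivWithin 2 (fun y => u y (l * k + k)) (Icc a b) (knot a b (m + 1) i)
    set Xm := iteratedDerivWithin 2 (fun y => u y (l * k - k)) (Icc a b) (knot a b (m + 1) i)
    have hr' : |20 / h ^ 2 * (nodeCurv (g (l + 1)) i + nodeCurv (g (l - 1)) i) - (Xp + Xm)|
        ≤ (2400000 * K + 360 * C₂) * ε := by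
      refine le_of_mul_le_mul_left (le_trans (le_of_eq ?_) hr) (by positivity : 0 < h ^ 2 / 20)
      rw [← abs_of_pos (by positivity : 0 < h ^ 2 / 20), ← abs_mul,
        abs_of_pos (by positivity : 0 < h ^ 2 / 20)]
      congr 1
      field_simp
    have hres := abs_consistency_le (α := α) (β := β) hK hC₁0 hk hγ (by linarith) hkγ hkε hA hr'
      hmean (hg3 l hl0 i hi0 hi1) dp dm
    rw [hσdef, abs_div, abs_of_pos (by positivity : 0 < γ ^ 2), div_le_iff₀ (by positivity),
      mul_comm (C₄ * ε)]
    refine le_trans (le_of_eq ?_) hres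
    congr 1
    simp only [he, nodeValue_sub, nodeCurv_sub]
    linear_combination hcs
  have hstab := collocation_stability hm hγ hh0 (ℓ := b - a) (by rw [hh]; push_cast; field_simp)
    -- The stability estimate counts time in units of γ ≤ 2k, so the horizon doubles.
    hsmall (n₀ := n) (τ := 2 * T) (by nlinarith [(Nat.cast_nonneg n : (0 : ℝ) ≤ n)])
    (e := e) (fun l hl => hg1 l (hmono l n hn hl)) (hg2 0 (by omega)) (fun _ => hg2 1 le_rfl) hσ
    (fun l hl hln i hi0 hi1 => by rw [hσdef]; field_simp; ring) n le_rfl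
  have hsq : ∀ i : ℤ, 1 ≤ i → i ≤ m → |nodeValue (e n) i| ≤ √Q * C₄ * ε := fun i hi0 hi1 => by
    refine abs_le_of_sq_le_sq ((hstab i hi0 hi1).trans (le_of_eq ?_)) (by positivity)
    rw [← hQ, mul_assoc (√Q), mul_pow (√Q), Real.sq_sqrt hQ0]
  have hom : IsHomogeneous (m + 1) (e n) := hg1 n hn
  have hr1 := hom.value_right
  have hr2 := hom.slope_right
  have hr3 := hom.curv_right
  push_cast at hr1 hr2 hr3
  have hB0 : 0 ≤ √Q * C₄ * ε := by positivity
  have hcoef := abs_coeff_le (m := m) (by omega) (c := e n) (η := √Q * C₄ * ε) (fun i hi0 hi1 => by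
      have : i = 0 ∨ i = m + 1 ∨ (1 ≤ i ∧ i ≤ m) := by omega
      rcases this with rfl | rfl | ⟨h0, h1⟩
      · rwa [hom.value_left, abs_zero]
      · rwa [hr1, abs_zero]
      · exact hsq i h0 h1)
    (by rwa [hom.slope_left, abs_zero]) (by rwa [hom.curv_left, abs_zero])
    (by rwa [hr2, abs_zero]) (by rwa [hr3, abs_zero])
  obtain ⟨B, hB⟩ := hg5 n hn x hx
  have hfin := abs_quinticSpline_sub_le (N := m + 1) hab (by omega) (c n) hx (u x (n * k)) B
    ((5000 * K + 30 * S) * ε + 30 * (√Q * C₄ * ε)) (fun i hi0 hi1 hi => by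
      rw [← hh] at hi ⊢
      push_cast at hi1
      have e1 := hB i hi0 (by omega) hi
      have e2 := hcoef i hi0 (by omega)
      have e3 : c n i = g n i + e n i := by simp [he]
      rw [abs_le] at e1 e2 ⊢
      constructor <;> linarith [e1.1, e1.2, e2.1, e2.2])
  rw [abs_sub_comm]
  refine hfin.trans ?_
  linarith

end convergence

/-! ### The denominator function and the final assembly. -/

/-- What the hypotheses on the denominator function say for small time steps. -/
theorem exists_denominator_bounds {Γ : ℝ → ℝ} {j : ℕ} (hj : 1 ≤ j)
    (hΓ_pos : ∀ᶠ k in 𝓝[>] (0 : ℝ), 0 < Γ k)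
    (hΓ : (fun k : ℝ => Γ k ^ 2 / k ^ 2 - 1) =O[𝓝[>] (0 : ℝ)] (fun k : ℝ => k ^ j)) :
    ∃ G ≥ 0, ∃ δ > 0, ∀ k : ℝ, 0 < k → k < δ →
      k ≤ 1 ∧ 0 < Γ k ∧ k ≤ 2 * Γ k ∧ Γ k ≤ 2 * k ∧ |Γ k ^ 2 - k ^ 2| ≤ G * k ^ 3 := by
  obtain ⟨G, hG, hGb⟩ := hΓ.exists_nonneg
  obtain ⟨δ, hδ, hδk⟩ := mem_nhdsGT_iff_exists_Ioo_subset.1 (hΓ_pos.and hGb.bound)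
  have hδ0 : 0 < δ := hδ
  -- The last entry gives G k ≤ 1/2, hence |Γ² − k²| ≤ k²/2, which makes Γ and k comparable within a
  -- factor 2.
  refine ⟨G, hG, min δ (min 1 (1 / (2 * (G + 1)))), by positivity, fun k hk hkδ => ?_⟩
  obtain ⟨h1, h2⟩ := lt_min_iff.1 hkδ
  obtain ⟨h2, h3⟩ := lt_min_iff.1 h2
  obtain ⟨hpos, hb⟩ := hδk ⟨hk, h1⟩
  have hGk : G * k ≤ 1 / 2 := by
    rw [lt_div_iff₀ (by positivity)] at h3
    nlinarith
  have hkj : k ^ j ≤ k := by simpa using pow_le_pow_of_le_one hk.le h2.le hj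
  rw [Real.norm_eq_abs, Real.norm_eq_abs, abs_of_pos (by positivity : 0 < k ^ j)] at hb
  have hb' : |Γ k ^ 2 - k ^ 2| ≤ G * k ^ 3 := by
    have e : Γ k ^ 2 - k ^ 2 = k ^ 2 * (Γ k ^ 2 / k ^ 2 - 1) := by field_simp
    rw [e, abs_mul, abs_of_pos (by positivity : 0 < k ^ 2)]
    calc _ ≤ k ^ 2 * (G * k) := by gcongr; exact hb.trans (by gcongr)
      _ = _ := by ring
  have hq : G * k ^ 3 ≤ k ^ 2 / 2 := by nlinarith [sq_nonneg k]
  have hp : 0 < Γ k := hpos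
  have := abs_le.1 (hb'.trans hq)
  exact ⟨h2.le, hp, by nlinarith, by nlinarith, hb'⟩

theorem theorem1
    (a b T α β L : ℝ) (hab : a < b) (hT : 0 < T)
    (f : ℝ → ℝ → ℝ) (f₀ f₁ g₀ g₁ g₂ g₃ : ℝ → ℝ) (u : ℝ → ℝ → ℝ)
    (hu : IsTelegraphSolution a b T α β f f₀ f₁ g₀ g₁ g₂ g₃ u)
    (hu_joint : ContDiffOn ℝ 3 (fun p : ℝ × ℝ => u p.1 p.2) (Icc a b ×ˢ Icc 0 T))
    (hu_space : ∀ t ∈ Icc 0 T, ContDiffOn ℝ 5 (fun x => u x t) (Icc a b))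
    (hL : ∀ t ∈ Icc 0 T, ∀ x ∈ Icc a b,
      |iteratedDerivWithin 5 (fun y => u y t) (Icc a b) x| ≤ L)
    (Γ : ℝ → ℝ) (j : ℕ) (hj : 1 ≤ j)
    (hΓ_pos : ∀ᶠ k in 𝓝[>] (0 : ℝ), 0 < Γ k)
    (hΓ : (fun k : ℝ => Γ k ^ 2 / k ^ 2 - 1) =O[𝓝[>] (0 : ℝ)] (fun k : ℝ => k ^ j))
    (M : ℝ) (hM : 0 ≤ M) :
    ∃ C > 0, ∃ δ > 0, ∀ (N : ℕ) (k : ℝ), 1 ≤ N → (b - a) / N < δ → 0 < k → k < δ →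
      (∃ c : ℕ → ℤ → ℝ,
        IsCollocationSolution a b T α β f f₀ f₁ g₀ g₁ g₂ g₃ N k (Γ k) c ∧
        StartBoundedBy a b N c M) ∧
      ∀ c : ℕ → ℤ → ℝ,
        IsCollocationSolution a b T α β f f₀ f₁ g₀ g₁ g₂ g₃ N k (Γ k) c →
        StartBoundedBy a b N c M →
        ∀ n : ℕ, n * k ≤ T → ∀ x ∈ Icc a b,
          |u x (n * k) - quinticSpline a b N (c n) x| ≤ C * (((b - a) / N) ^ 2 + k) := by
  obtain ⟨K, hb⟩ := exists_derivBounds hab hT hu_joint hu_space hL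
  obtain ⟨G, hG, δ, hδ, hδk⟩ := exists_denominator_bounds hj hΓ_pos hΓ
  obtain ⟨C, hC, hbound⟩ := exists_error_bound hab hT hu hb hG hM
  set D := 2 * |α| + 1 + 2 * (b - a) ^ 2 * β ^ 4 with hD
  have hD0 : 0 < D := by rw [hD]; positivity
  have hba : 0 < b - a := sub_pos.2 hab
  -- With Γ ≤ 2k, the bound k < 1/(4D) gives D Γ ≤ 1/2, for the Gronwall step and for 1 + αΓ > 0.
  -- The bound h < (b − a)/9 ensures enough nodes for the coercivity estimate.
  refine ⟨C, hC, min (min δ (1 / (4 * D))) (min 1 ((b - a) / 9)), by positivity,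
    fun N k hN hh hk hkδ => ?_⟩
  obtain ⟨hh1, hh2⟩ := lt_min_iff.1 (lt_min_iff.1 hh).2
  obtain ⟨hk1, hk2⟩ := lt_min_iff.1 (lt_min_iff.1 hkδ).1
  obtain ⟨hk3, hγ, hkγ, hγk2, hγk⟩ := hδk k hk hk1
  have hN0 : (0 : ℝ) < N := by exact_mod_cast hN
  have hN9 : 9 < N := by
    rw [div_lt_div_iff_of_pos_left hba hN0 (by norm_num)] at hh2
    exact_mod_cast hh2
  have hDγ : D * Γ k ≤ 1 / 2 := by
    rw [lt_div_iff₀ (by positivity)] at hk2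
    nlinarith
  have hαγ : 0 < 1 + α * Γ k := by
    have h1 : |α * Γ k| ≤ 1 / 2 := by
      rw [abs_mul, abs_of_pos hγ]
      refine le_trans ?_ hDγ
      gcongr
      have : 0 ≤ 2 * (b - a) ^ 2 * β ^ 4 := by positivity
      linarith [abs_nonneg α]
    linarith [(abs_le.1 h1).1]
  obtain ⟨m, rfl⟩ : ∃ m, N = m + 1 := ⟨N - 1, by omega⟩
  exact ⟨exists_isCollocationSolution hab hT hu (by omega) hγ hαγ hM, fun c hc hst =>
    hbound m k (Γ k) c (by omega) hh1.le hk hk3 hγ hkγ hγk2 hγk hDγ hc hst⟩
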